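/- Let $\mathcal X\subset\mathbb R^d$ be compact, let $P$ be a Borel probability measure on $\mathcal X$, and let $K:\mathcal X\times\mathcal X\to\mathbb R$ be a Mercer kernel (continuous, symmetric, positive definite) with Mercer decomposition $$K(x,y)=\sum_{j=1}^\infty\lambda_j\phi_j(x)\phi_j(y)\qquad(x,y\in\mathcal X),$$ where $\{\phi_j\}_{j\ge1}$ is an orthonormal system in $L_2(\mathcal X,P)$ and $\lambda_1\ge\lambda_2\ge\dots>0$. Let $\{f(\omega,x)\}_{x\in\mathcal X}$ be a jointly measurable centered Gaussian random field on a probability space $(\Omega,\mathbb P)$ with covariance function $K$, let $\boldsymbol\omega=(\omega_1,\dots,\omega_k)$ be $k$ i.i.d. samples from $\mathbb P$, and put $g_i(x)=f(\omega_i,x)$, $G_{ij}=\langle g_i,g_j\rangle_{L_2(\mathcal X,P)}$ ($1\le i,j\le k$). Let $\xi_{i\ell}=\lambda_\ell^{-1/2}\int_{\mathcal X} g_i\phi_\ell\,dP$ be the Karhunen–Loève coefficients of $g_i$, let $\xi_\ell=(\xi_{1\ell},\dots,\xi_{k\ell})^\top$, and let $M_{\ell m}=\xi_\ell^\top G^{-1}\xi_m$.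 Let $\Pi h(x)=\int_{\mathcal X}\sum_{i,j=1}^k (G^{-1})_{ij}\,g_i(x)g_j(y)\,h(y)\,dP(y)$ be the orthogonal projection of $L_2(\mathcal X,P)$ onto $\mathrm{span}(g_1,\dots,g_k)$, and let $K_P^{\boldsymbol\omega}=\big((I-\Pi)\otimes(I-\Pi)\big)[K]$ be the residual kernel, that is, $$K_P^{\boldsymbol\omega}(x,y)=K(x,y)-\Pi[K(x,\cdot)](y)-\Pi[K(\cdot,y)](x)+\Pi\big[s\mapsto\Pi[K(s,\cdot)](y)\big](x).$$ Then, almost surely, $g_1,\dots,g_k\in L_2(\mathcal X,P)$ and $G$ is invertible; the random variables $M_{ii}$, $M_{ij}^2$ and $K_P^{\boldsymbol\omega}(x,y)$ are integrable for all $i,j\ge1$ and $x,y\in\mathcal X$; the series $\sum_{j}\lambda_j^2\,\mathbb E[M_{ij}^2]$ converges for every $i$; and the function $(x,y)\mapsto\mathbb E_{\boldsymbol\omega}[K_P^{\boldsymbol\omega}(x,y)]$ is a Mercer kernel with $$\mathbb E_{\boldsymbol\omega}[K_P^{\boldsymbol\omega}(x,y)]=\sum_{i=1}^\infty\mu_i\phi_i(x)\phi_i(y)\qquad(x,y\in\mathcal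 X),$$ $$\mu_i=\lambda_i\Big(1-2\lambda_i\,\mathbb E[M_{ii}]+\sum_{j=1}^\infty\lambda_j^2\,\mathbb E[M_{ij}^2]\Big)\ge0 .$$ In particular the kernel is diagonal in the eigenbasis $\{\phi_i\}$ of $K$: $\int_{\mathcal X}\mathbb E_{\boldsymbol\omega}[K_P^{\boldsymbol\omega}(x,y)]\,\phi_i(y)\,dP(y)=\mu_i\phi_i(x)$ for all $i\ge1$ and $x\in\mathcal X$. -/

import Mathlib

open MeasureTheory ProbabilityTheory

noncomputable section

/-- A Mercer kernel: continuous, symmetric and positive definite. -/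
def IsMercerKernel {X : Type*} [TopologicalSpace X] (K : X → X → ℝ) : Prop :=
  Continuous (fun p : X × X => K p.1 p.2) ∧
  (∀ x y, K x y = K y x) ∧
  ∀ (n : ℕ) (x : Fin n → X) (α : Fin n → ℝ), 0 ≤ ∑ i, ∑ j, α i * α j * K (x i) (x j)

/-- `K(x,y) = ∑ j, lam j * φ j x * φ j y` with `φ` an orthonormal system of `L₂(X,P)` and
`lam` positive and decreasing. -/
structure IsMercerDecomposition {X : Type*} [MeasurableSpace X] (P : Measure X)
    (K : X → X → ℝ) (lam : ℕ → ℝ) (φ : ℕ → X → ℝ) : Prop where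
  memLp : ∀ j, MemLp (φ j) 2 P
  orthonormal : ∀ i j, ∫ x, φ i x * φ j x ∂P = if i = j then 1 else 0
  pos : ∀ j, 0 < lam j
  antitone : Antitone lam
  hasSum : ∀ x y, HasSum (fun j => lam j * φ j x * φ j y) (K x y)

/-- A centered Gaussian random field `f(ω, x)`, jointly measurable, with covariance `K`. -/
structure IsCenteredGaussianField {Ω X : Type*} [MeasurableSpace Ω] [MeasurableSpace X]
    (Q : Measure Ω) (K : X → X → ℝ) (f : Ω → X → ℝ) : Prop where
  measurable : Measurable (fun p : Ω × X => f p.1 p.2)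
  gaussian : IsGaussianProcess (fun x ω => f ω x) Q
  centered : ∀ x, ∫ ω, f ω x ∂Q = 0
  covariance : ∀ x y, covariance (fun ω => f ω x) (fun ω => f ω y) Q = K x y

section Residual

variable {X : Type*} [MeasurableSpace X] (P : Measure X) {k : ℕ}

/-- The Gram matrix `⟨g i, g j⟩` in `L₂(X,P)`. -/
def gramMatrix (g : Fin k → X → ℝ) : Matrix (Fin k) (Fin k) ℝ :=
  Matrix.of fun i j => ∫ x, g i x * g j x ∂P

/-- The kernel `Π(x,y)` of the orthogonal projection of `L₂(X,P)` onto `span (g i)`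
(the Gram matrix being invertible). -/
def projKernel (g : Fin k → X → ℝ) (x y : X) : ℝ :=
  ∑ i, ∑ j, (gramMatrix P g)⁻¹ i j * g i x * g j y

/-- The projection `Π_P h (x) = ∫ Π(x,y) h(y) dP(y)`. -/
def proj (g : Fin k → X → ℝ) (h : X → ℝ) (x : X) : ℝ :=
  ∫ y, projKernel P g x y * h y ∂P

/-- The residual kernel of `K` with respect to `span (g i)`, that is
`((I - Π_P) ⊗ (I - Π_P)) [K]`. -/
def residualKernel (K : X → X → ℝ) (g : Fin k → X → ℝ) (x y : X) : ℝ :=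
  K x y - proj P g (fun t => K x t) y - proj P g (fun s => K s y) x
    + proj P g (fun s => proj P g (fun t => K s t) y) x

end Residual

/-- The `k` realizations `g i = f (ω i, ·)` of the field `f`. -/
def realizations {Ω X : Type*} (f : Ω → X → ℝ) {k : ℕ} (ω : Fin k → Ω) : Fin k → X → ℝ :=
  fun i => f (ω i)

/-- The Karhunen–Loève coefficients `ξ i ℓ` of `g i = ∑ ℓ, √(lam ℓ) * ξ i ℓ * φ ℓ`. -/
def klCoeff {X : Type*} [MeasurableSpace X] (P : Measure X) (lam : ℕ → ℝ) (φ : ℕ → X → ℝ)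
    {k : ℕ} (g : Fin k → X → ℝ) (i : Fin k) (l : ℕ) : ℝ :=
  (√(lam l))⁻¹ * ∫ x, g i x * φ l x ∂P

/-- `M l m = ξ_lᵀ G⁻¹ ξ_m`, where `ξ_l = (ξ i l)_i`. -/
def projCoeff {X : Type*} [MeasurableSpace X] (P : Measure X) (lam : ℕ → ℝ) (φ : ℕ → X → ℝ)
    {k : ℕ} (g : Fin k → X → ℝ) (l m : ℕ) : ℝ :=
  ∑ i, ∑ j, klCoeff P lam φ g i l * (gramMatrix P g)⁻¹ i j * klCoeff P lam φ g j m

section Expectation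

variable {Ω X : Type*} [MeasurableSpace Ω] [MeasurableSpace X]
  (Q : Measure Ω) (P : Measure X) (f : Ω → X → ℝ) (k : ℕ)

/-- The law of `k` independent samples `ω 1, …, ω k` from `Q`. -/
def sampleLaw : Measure (Fin k → Ω) := Measure.pi fun _ => Q

/-- `𝔼[K_P^ω (x,y)]`, over `k` i.i.d. realizations of the field. -/
def expectedResidualKernel (K : X → X → ℝ) (x y : X) : ℝ :=
  ∫ ω, residualKernel P K (realizations f ω) x y ∂(sampleLaw Q k)

/-- `μ i = lam i * (1 - 2 * lam i * 𝔼[M i i] + ∑ j, (lam j)² * 𝔼[(M i j)²])`. -/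
def pushedEigenvalue (lam : ℕ → ℝ) (φ : ℕ → X → ℝ) (i : ℕ) : ℝ :=
  lam i * (1 - 2 * lam i * ∫ ω, projCoeff P lam φ (realizations f ω) i i ∂(sampleLaw Q k)
    + ∑' j, lam j ^ 2 * ∫ ω, projCoeff P lam φ (realizations f ω) i j ^ 2 ∂(sampleLaw Q k))

end Expectation

end

/-!
In Karhunen–Loève coordinates the sample is an array of independent standard Gaussian variables:
its columns `ξ l ∈ ℝᵏ` give `G = ∑ l, lam l • ξ l (ξ l)ᵀ`, `⟨g a, K g b⟩ = C` with
`C = ∑ l, lam l ^ 2 • ξ l (ξ l)ᵀ`, and, in mean square, `g(x) = ∑ l, √(lam l) φ l x • ξ l` for the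
vector of values at `x` and `u(x) = ∑ l, √(lam l) lam l φ l x • ξ l` for the vector of pairings with
`K x`. The residual kernel is (`residualKernel_eq`)
`K x y - g(y)ᵀ G⁻¹ u(x) - g(x)ᵀ G⁻¹ u(y) + g(x)ᵀ G⁻¹ C G⁻¹ g(y)`.
Reversing the sign of a single column preserves the law of the array and the matrices `G` and `C`.
Hence `𝔼 (ξ l)ᵀ S (ξ m) = 0` for `l ≠ m`, where `S` is `G⁻¹` or `G⁻¹ C G⁻¹`
(`integral_column_mulVec_column_eq_zero`), and only the diagonal terms of the double series survive:
`𝔼 (ξ l)ᵀ G⁻¹ (ξ l) = 𝔼 M l l` and `𝔼 (ξ l)ᵀ G⁻¹ C G⁻¹ (ξ l) = ∑ j, lam j ^ 2 𝔼 (M l j) ^ 2`.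

The analytic point is the exchange of the expectation with the series, since `G⁻¹` is unbounded and
depends on all the columns. It rests on the bound `𝔼 M l l ≤ k / lam (k + 1)`, uniform in `l`
(`integral_projCoeff_self_le`). By monotonicity of the inverse, `G` may be replaced by a truncation
`W = ∑ l < n, lam l • ξ l (ξ l)ᵀ`. For the resolvent `R = (W + ε)⁻¹`, Gaussian integration by parts
gives
`𝔼 (ξ l)ᵀ R ξ l = 𝔼 (tr R - lam l (tr R (ξ l)ᵀ R ξ l + |R ξ l| ^ 2))`.
Since `∑ lam l (ξ l)ᵀ R ξ l ≤ k` and `∑ lam l |R ξ l| ^ 2 ≤ tr R`, the sum over `k + 2` columns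
bounds `𝔼 tr R` uniformly in `ε`. This makes `W`, hence `G`, almost surely invertible, and bounds
the inverse moments of `W` by Fatou's lemma (`lintegral_column_inv_wishart_column_le`).

Given the bound, the partial sums of the series for `g(x)` and `u(x)` are Cauchy for the seminorm
`𝔼 vᵀ S v`, and a version of Parseval's identity for this seminorm
(`IsUncorrelated.integrable_and_hasSum`) yields the expansion of the expected kernel. Its
coefficients satisfy `0 ≤ μ i ≤ B lam i`, so that it inherits continuity from `K`
(`IsMercerDecomposition.isMercerKernel`).

That the Karhunen–Loève coefficients are independent standard Gaussian variables follows from the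
characteristic functions of the linear functionals `∫ f h dP` (`integral_exp_pairing`), and that
almost every path of `f` satisfies Parseval's identity from `𝔼 ‖f‖² = ∑ l, lam l`
(`ae_hasSum_sq`).
-/

/-! ### Quadratic forms and inverses of positive definite matrices -/

section Matrices

open Matrix

variable {n : Type*} [Fintype n]

lemma Matrix.PosSemidef.dotProduct_mulVec_comm {R : Matrix n n ℝ} (hR : R.PosSemidef)
    (x y : n → ℝ) : x ⬝ᵥ R *ᵥ y = y ⬝ᵥ R *ᵥ x := by
  have hT : Rᵀ = R := hR.1
  rw [dotProduct_mulVec, ← mulVec_transpose, hT, dotProduct_comm]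

lemma Matrix.PosSemidef.dotProduct_mulVec_self_nonneg {R : Matrix n n ℝ} (hR : R.PosSemidef)
    (x : n → ℝ) : 0 ≤ x ⬝ᵥ R *ᵥ x := by
  simpa using hR.dotProduct_mulVec_nonneg x

/-- The Cauchy–Schwarz inequality for a positive semidefinite form. -/
lemma Matrix.PosSemidef.dotProduct_mulVec_sq_le {R : Matrix n n ℝ} (hR : R.PosSemidef)
    (x y : n → ℝ) :
    (x ⬝ᵥ R *ᵥ y) ^ 2 ≤ (x ⬝ᵥ R *ᵥ x) * (y ⬝ᵥ R *ᵥ y) := by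
  have h (t : ℝ) : 0 ≤ (y ⬝ᵥ R *ᵥ y) * (t * t) + (2 * (x ⬝ᵥ R *ᵥ y)) * t + x ⬝ᵥ R *ᵥ x := by
    have := hR.dotProduct_mulVec_self_nonneg (x + t • y)
    simp only [mulVec_add, mulVec_smul, dotProduct_add, add_dotProduct,
      smul_dotProduct, dotProduct_smul, smul_eq_mul, hR.dotProduct_mulVec_comm y x] at this
    linarith
  have := discrim_le_zero h
  rw [discrim] at this
  linarith

variable [DecidableEq n]

lemma Matrix.PosDef.det_isUnit {G : Matrix n n ℝ} (hG : G.PosDef) : IsUnit G.det :=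
  hG.det_pos.ne'.isUnit

/-- The quadratic form of `G⁻¹` is the least constant in the Cauchy–Schwarz inequality
`(c ⬝ v)² ≤ t * cᵀ G c`. -/
lemma Matrix.PosDef.dotProduct_inv_mulVec_le {G : Matrix n n ℝ} (hG : G.PosDef) {v : n → ℝ} {t : ℝ}
    (ht : 0 ≤ t) (h : ∀ c : n → ℝ, (c ⬝ᵥ v) ^ 2 ≤ t * (c ⬝ᵥ G *ᵥ c)) : v ⬝ᵥ G⁻¹ *ᵥ v ≤ t := by
  have h1 := h (G⁻¹ *ᵥ v)
  rw [mulVec_mulVec, mul_nonsing_inv _ hG.det_isUnit, one_mulVec, dotProduct_comm] at h1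
  have h0 := hG.inv.posSemidef.dotProduct_mulVec_self_nonneg v
  nlinarith

/-- Inversion reverses the order of positive definite matrices. -/
lemma Matrix.PosDef.dotProduct_inv_mulVec_anti {G W : Matrix n n ℝ} (hG : G.PosDef) (hW : W.PosDef)
    (h : ∀ c : n → ℝ, c ⬝ᵥ W *ᵥ c ≤ c ⬝ᵥ G *ᵥ c) (v : n → ℝ) :
    v ⬝ᵥ G⁻¹ *ᵥ v ≤ v ⬝ᵥ W⁻¹ *ᵥ v := by
  have h0 := hW.inv.posSemidef.dotProduct_mulVec_self_nonneg v
  refine hG.dotProduct_inv_mulVec_le h0 fun c => ?_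
  have h1 := hW.posSemidef.dotProduct_mulVec_sq_le c (W⁻¹ *ᵥ v)
  rw [mulVec_mulVec, mul_nonsing_inv _ hW.det_isUnit, one_mulVec, dotProduct_comm (W⁻¹ *ᵥ v)] at h1
  nlinarith [h c]

lemma Matrix.PosSemidef.dotProduct_mulVec_self_le_trace {R : Matrix n n ℝ} (hR : R.PosSemidef)
    (c : n → ℝ) : c ⬝ᵥ R *ᵥ c ≤ (c ⬝ᵥ c) * R.trace := by
  obtain ⟨B, rfl⟩ : ∃ B : Matrix n n ℝ, R = Bᵀ * B := by
    open scoped MatrixOrder in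
    obtain ⟨B, hB⟩ := CStarAlgebra.nonneg_iff_eq_star_mul_self.1 hR.nonneg
    exact ⟨B, by simpa [star_eq_conjTranspose] using hB⟩
  have h1 : c ⬝ᵥ (Bᵀ * B) *ᵥ c = ∑ i, (B *ᵥ c) i ^ 2 := by
    rw [← mulVec_mulVec, dotProduct_mulVec, vecMul_transpose, dotProduct]
    simp [sq]
  have h2 : (Bᵀ * B).trace = ∑ i, ∑ j, B i j ^ 2 := by
    simp only [trace, diag, mul_apply, transpose_apply, sq]
    rw [Finset.sum_comm]
  rw [h1, h2, Finset.mul_sum]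
  refine Finset.sum_le_sum fun i _ => ?_
  have := Finset.sum_mul_sq_le_sq_mul_sq Finset.univ (fun j => B i j) c
  rw [mul_comm]
  simpa [mulVec, dotProduct, sq] using this

end Matrices

section MatrixDerivative

open Matrix Filter Topology

variable {n : Type*} [Fintype n] [DecidableEq n]

lemma Matrix.tendsto_inv_entry {α : Type*} {l : Filter α} {B : α → Matrix n n ℝ} {A : Matrix n n ℝ}
    (hB : ∀ i j, Tendsto (fun s => B s i j) l (𝓝 (A i j))) (hA : IsUnit A.det) (i j : n) :
    Tendsto (fun s => (B s)⁻¹ i j) l (𝓝 (A⁻¹ i j)) := by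
  have h1 : Tendsto B l (𝓝 A) :=
    tendsto_pi_nhds.2 fun i => tendsto_pi_nhds.2 fun j => hB i j
  have h2 : ContinuousAt Ring.inverse A.det := by
    have : (Ring.inverse : ℝ → ℝ) = fun x => x⁻¹ := funext Ring.inverse_eq_inv
    rw [this]
    exact continuousAt_inv₀ hA.ne_zero
  have h3 := (continuousAt_matrix_inv A h2).tendsto.comp h1
  exact (tendsto_pi_nhds.1 ((tendsto_pi_nhds.1 h3) i)) j

lemma Matrix.hasDerivAt_inv_entry {B : ℝ → Matrix n n ℝ} {B' : Matrix n n ℝ} {t : ℝ}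
    (hB : ∀ i j, HasDerivAt (fun s => B s i j) (B' i j) t) (hu : IsUnit (B t).det) (i j : n) :
    HasDerivAt (fun s => (B s)⁻¹ i j) ((-((B t)⁻¹ * B' * (B t)⁻¹)) i j) t := by
  have hBc : Tendsto B (𝓝 t) (𝓝 (B t)) :=
    tendsto_pi_nhds.2 fun i => tendsto_pi_nhds.2 fun j => (hB i j).continuousAt
  have hdet : ∀ᶠ s in 𝓝 t, IsUnit (B s).det := by
    have : Tendsto (fun s => (B s).det) (𝓝 t) (𝓝 (B t).det) :=
      ((Continuous.matrix_det continuous_id).tendsto _).comp hBc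
    filter_upwards [this.eventually_ne hu.ne_zero] with s hs using hs.isUnit
  have hinv (i j : n) : Tendsto (fun s => (B s)⁻¹ i j) (𝓝[≠] t) (𝓝 ((B t)⁻¹ i j)) :=
    (tendsto_inv_entry (fun i j => (hB i j).continuousAt) hu i j).mono_left nhdsWithin_le_nhds
  rw [hasDerivAt_iff_tendsto_slope]
  have hlim : Tendsto (fun s => -∑ b, (∑ a, (B s)⁻¹ i a * slope (fun s => B s a b) t s) *
      (B t)⁻¹ b j) (𝓝[≠] t) (𝓝 ((-((B t)⁻¹ * B' * (B t)⁻¹)) i j)) := by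
    simp only [neg_apply, mul_apply]
    exact (tendsto_finsetSum _ fun b _ => (tendsto_finsetSum _ fun a _ => (hinv i a).mul
      (hasDerivAt_iff_tendsto_slope.1 (hB a b))).mul_const _).neg
  refine hlim.congr' ?_
  filter_upwards [nhdsWithin_le_nhds hdet, self_mem_nhdsWithin] with s hs hst
  -- the resolvent identity `R s - R t = -R s (B s - B t) R t`
  have hres : (B s)⁻¹ - (B t)⁻¹ = -((B s)⁻¹ * (B s - B t) * (B t)⁻¹) := by
    rw [mul_sub, sub_mul, nonsing_inv_mul _ hs, one_mul, mul_assoc, mul_nonsing_inv _ hu, mul_one]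
    abel
  have h1 := congrFun (congrFun hres i) j
  simp only [sub_apply, neg_apply, mul_apply] at h1
  simp only [slope_def_field]
  rw [h1, neg_div, Finset.sum_div]
  congr 1
  refine Finset.sum_congr rfl fun b _ => ?_
  rw [mul_div_right_comm, Finset.sum_div]
  simp only [mul_div_assoc]

end MatrixDerivative

/-! ### Gaussian integration by parts -/

section Stein

open Filter Topology

lemma gaussianPDFReal_zero_one (x : ℝ) :
    gaussianPDFReal 0 1 x = (√(2 * Real.pi))⁻¹ * Real.exp (-(1 / 2) * x ^ 2) := by
  rw [gaussianPDFReal]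
  simp only [NNReal.coe_one, mul_one, sub_zero]
  congr 2
  ring

lemma hasDerivAt_gaussianPDFReal_zero_one (x : ℝ) :
    HasDerivAt (gaussianPDFReal 0 1) (-x * gaussianPDFReal 0 1 x) x := by
  have : gaussianPDFReal 0 1 = fun x => (√(2 * Real.pi))⁻¹ * Real.exp (-(1 / 2) * x ^ 2) :=
    funext gaussianPDFReal_zero_one
  rw [this]
  have h := (((hasDerivAt_pow 2 x).const_mul (-(1 / 2) : ℝ)).exp).const_mul (√(2 * Real.pi))⁻¹
  refine h.congr_deriv ?_
  push_cast
  ring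

/-- **Gaussian integration by parts** on the line. -/
lemma integral_mul_gaussianReal_eq_integral_deriv {F F' : ℝ → ℝ} (hF : ∀ t, HasDerivAt F (F' t) t)
    {C : ℝ} (hC : ∀ t, |F t| ≤ C) {C' : ℝ} (hC' : ∀ t, |F' t| ≤ C') :
    ∫ t, t * F t ∂(gaussianReal 0 1) = ∫ t, F' t ∂(gaussianReal 0 1) := by
  have hFc : Continuous F := continuous_iff_continuousAt.2 fun t => (hF t).continuousAt
  have hF'm : Measurable F' := by
    have : F' = deriv F := funext fun t => (hF t).deriv.symm
    rw [this]
    exact measurable_deriv F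
  have hpdf := integrable_gaussianPDFReal 0 1
  have hxpdf : Integrable (fun x : ℝ => -x * gaussianPDFReal 0 1 x) := by
    have h := (integrable_mul_exp_neg_mul_sq (b := 1 / 2) (by norm_num)).const_mul
      (-(√(2 * Real.pi))⁻¹)
    refine h.congr (ae_of_all _ fun x => ?_)
    simp only [gaussianPDFReal_zero_one]
    ring
  have hbound {g h : ℝ → ℝ} {D : ℝ} (hg : Measurable g) (hD : ∀ t, |g t| ≤ D) (hh : Integrable h) :
      Integrable (g * h) :=
    hh.bdd_mul hg.aestronglyMeasurable (ae_of_all _ hD)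
  have key := integral_mul_deriv_eq_deriv_mul_of_integrable
    (u := F) (v := gaussianPDFReal 0 1) (fun t _ => hF t)
    (fun t _ => hasDerivAt_gaussianPDFReal_zero_one t)
    (hbound hFc.measurable hC hxpdf) (hbound hF'm hC' hpdf) (hbound hFc.measurable hC hpdf)
  rw [integral_gaussianReal_eq_integral_smul one_ne_zero,
    integral_gaussianReal_eq_integral_smul one_ne_zero]
  simp only [smul_eq_mul]
  rw [← neg_eq_iff_eq_neg, ← integral_neg] at key
  calc ∫ x, gaussianPDFReal 0 1 x * (x * F x) = ∫ x, -(F x * (-x * gaussianPDFReal 0 1 x)) := by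
        congr 1 with x
        ring
    _ = ∫ x, F' x * gaussianPDFReal 0 1 x := key
    _ = _ := by
        congr 1 with x
        ring

variable {ι : Type*}

/-- The law of a family of independent standard Gaussian variables. -/
noncomputable def gaussianProduct (ι : Type*) : Measure (ι → ℝ) :=
  Measure.infinitePi fun _ => gaussianReal 0 1

instance : IsProbabilityMeasure (gaussianProduct ι) := by
  unfold gaussianProduct; infer_instance

variable [DecidableEq ι]

/-- Resampling one coordinate preserves a product measure. -/
lemma measurePreserving_update_gaussianProduct (p : ι) :
    MeasurePreserving (fun z : (ι → ℝ) × ℝ => Function.update z.1 p z.2)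
      ((gaussianProduct ι).prod (gaussianReal 0 1)) (gaussianProduct ι) := by
  have hm : Measurable (fun z : (ι → ℝ) × ℝ => Function.update z.1 p z.2) := by
    refine measurable_pi_iff.2 fun i => ?_
    by_cases hi : i = p
    · subst hi
      simpa using measurable_snd
    · simp only [Function.update_of_ne hi]
      fun_prop
  refine ⟨hm, Measure.eq_infinitePi _ fun s t ht => ?_⟩
  rw [Measure.map_apply hm (.pi s.countable_toSet fun _ _ => ht _)]
  by_cases hp : p ∈ s
  · have : (fun z : (ι → ℝ) × ℝ => Function.update z.1 p z.2) ⁻¹' ((s : Set ι).pi t)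
        = (((s.erase p : Finset ι) : Set ι).pi t) ×ˢ (t p) := by
      ext z
      simp only [Set.mem_preimage, Set.mem_pi, Finset.mem_coe, Finset.coe_erase, Set.mem_prod]
      constructor
      · intro h
        refine ⟨fun i hi => ?_, by simpa using h p hp⟩
        have := h i hi.1
        rwa [Function.update_of_ne (by simpa using hi.2)] at this
      · rintro ⟨h1, h2⟩ i hi
        by_cases hip : i = p
        · subst hip; simpa using h2
        · rw [Function.update_of_ne hip]
          exact h1 i ⟨hi, by simpa using hip⟩
    rw [this, Measure.prod_prod, gaussianProduct, Measure.infinitePi_pi _ (fun i _ => ht i),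
      Finset.prod_erase_mul _ _ hp]
  · have : (fun z : (ι → ℝ) × ℝ => Function.update z.1 p z.2) ⁻¹' ((s : Set ι).pi t)
        = ((s : Set ι).pi t) ×ˢ Set.univ := by
      ext z
      simp only [Set.mem_preimage, Set.mem_pi, Finset.mem_coe, Set.mem_prod, Set.mem_univ, and_true]
      refine forall₂_congr fun i hi => ?_
      rw [Function.update_of_ne (by rintro rfl; exact hp hi)]
    rw [this, Measure.prod_prod, gaussianProduct, Measure.infinitePi_pi _ (fun i _ => ht i)]
    simp

/-- **Gaussian integration by parts** in one coordinate of an independent Gaussian family. -/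
lemma integral_mul_gaussianProduct_eq (p : ι) {H H' : (ι → ℝ) → ℝ} (hH : Measurable H)
    (hH' : Measurable H')
    (hd : ∀ η t, HasDerivAt (fun s => H (Function.update η p s)) (H' (Function.update η p t)) t)
    {C : ℝ} (hC : ∀ η, |H η| ≤ C) {C' : ℝ} (hC' : ∀ η, |H' η| ≤ C') :
    ∫ η, η p * H η ∂(gaussianProduct ι) = ∫ η, H' η ∂(gaussianProduct ι) := by
  have hmp := measurePreserving_update_gaussianProduct p
  have hpm : Measurable fun η : ι → ℝ => η p := measurable_pi_apply p
  have hid : Integrable (fun η : ι → ℝ => η p) (gaussianProduct ι) := by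
    have := measurePreserving_eval_infinitePi (fun _ : ι => gaussianReal 0 1) p
    refine (this.integrable_comp (g := fun x : ℝ => x) (by fun_prop)).2 ?_
    exact (memLp_id_gaussianReal 1).integrable le_rfl
  have hint1 : Integrable (fun η : ι → ℝ => η p * H η) (gaussianProduct ι) := by
    have := hid.bdd_mul (f := H) hH.aestronglyMeasurable (ae_of_all _ hC)
    simpa [mul_comm] using this
  have hint2 : Integrable H' (gaussianProduct ι) :=
    Integrable.of_bound hH'.aestronglyMeasurable C' (ae_of_all _ hC')
  rw [← hmp.map_eq, integral_map (f := fun η => η p * H η) hmp.aemeasurable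
      (hpm.mul hH).aestronglyMeasurable,
    integral_map hmp.aemeasurable hH'.aestronglyMeasurable, integral_prod, integral_prod]
  · refine integral_congr_ae (ae_of_all _ fun η => ?_)
    simp only [Function.update_self]
    exact integral_mul_gaussianReal_eq_integral_deriv (hd η) (fun t => hC _) (fun t => hC' _)
  · exact (hmp.integrable_comp hH'.aestronglyMeasurable).2 hint2
  · exact (hmp.integrable_comp (hpm.mul hH).aestronglyMeasurable).2 hint1

end Stein

/-! ### Inverse moments of weighted Wishart matrices -/

section Wishart

open Matrix Filter Topology

lemma measurable_det {α n : Type*} [MeasurableSpace α] [Fintype n] [DecidableEq n]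
    {A : α → Matrix n n ℝ} (hA : ∀ i j, Measurable fun x => A x i j) :
    Measurable fun x => (A x).det := by
  simp only [det_apply]
  fun_prop

lemma measurable_inv_entry {α n : Type*} [MeasurableSpace α] [Fintype n] [DecidableEq n]
    {A : α → Matrix n n ℝ} (hA : ∀ i j, Measurable fun x => A x i j) (i j : n) :
    Measurable fun x => (A x)⁻¹ i j := by
  simp only [inv_def, Matrix.smul_apply, Ring.inverse_eq_inv, smul_eq_mul, adjugate_apply]
  refine (measurable_det hA).inv.mul (measurable_det fun a b => ?_)
  simp only [updateRow_apply]
  split_ifs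
  · exact measurable_const
  · exact hA a b

lemma measurable_dotProduct_mulVec {α n : Type*} [MeasurableSpace α] [Fintype n]
    {S : α → Matrix n n ℝ} {v w : α → n → ℝ} (hS : ∀ i j, Measurable fun x => S x i j)
    (hv : ∀ i, Measurable fun x => v x i) (hw : ∀ i, Measurable fun x => w x i) :
    Measurable fun x => v x ⬝ᵥ S x *ᵥ w x := by
  simp only [dotProduct, mulVec]
  fun_prop

variable {k : ℕ}

/-- The `l`-th column of an array with `k` rows. -/
def column (η : Fin k × ℕ → ℝ) (l : ℕ) : Fin k → ℝ := fun a => η (a, l)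

/-- The weighted Wishart matrix `∑ l < n, c l * η_l η_lᵀ`, where `η_l` is the `l`-th column of the
array `η`. -/
def wishart (c : ℕ → ℝ) (n : ℕ) (η : Fin k × ℕ → ℝ) : Matrix (Fin k) (Fin k) ℝ :=
  ∑ l ∈ Finset.range n, c l • vecMulVec (column η l) (column η l)

/-- The resolvent `(W + ε)⁻¹` of the weighted Wishart matrix. -/
noncomputable def wishartResolvent (c : ℕ → ℝ) (n : ℕ) (ε : ℝ) (η : Fin k × ℕ → ℝ) :
    Matrix (Fin k) (Fin k) ℝ :=
  (wishart c n η + ε • (1 : Matrix (Fin k) (Fin k) ℝ))⁻¹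

lemma wishart_apply (c : ℕ → ℝ) (n : ℕ) (η : Fin k × ℕ → ℝ) (a b : Fin k) :
    wishart c n η a b = ∑ l ∈ Finset.range n, c l * (η (a, l) * η (b, l)) := by
  simp [wishart, Matrix.sum_apply, vecMulVec_apply, column]

lemma measurable_column (l : ℕ) (a : Fin k) : Measurable fun η : Fin k × ℕ → ℝ => column η l a :=
  measurable_pi_apply _

lemma measurable_wishart (c : ℕ → ℝ) (n : ℕ) (a b : Fin k) :
    Measurable fun η : Fin k × ℕ → ℝ => wishart c n η a b := by
  simp only [wishart_apply]
  fun_prop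

lemma dotProduct_wishart_mulVec (c : ℕ → ℝ) (n : ℕ) (η : Fin k × ℕ → ℝ) (v : Fin k → ℝ) :
    v ⬝ᵥ wishart c n η *ᵥ v = ∑ l ∈ Finset.range n, c l * (v ⬝ᵥ column η l) ^ 2 := by
  rw [wishart, sum_mulVec, dotProduct_sum]
  refine Finset.sum_congr rfl fun l _ => ?_
  rw [smul_mulVec, vecMulVec_mulVec, dotProduct_smul, op_smul_eq_smul, dotProduct_smul,
    dotProduct_comm (column η l)]
  simp only [smul_eq_mul]
  ring

variable {c : ℕ → ℝ} (hc : ∀ l, 0 < c l)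

include hc in
lemma posSemidef_wishart (n : ℕ) (η : Fin k × ℕ → ℝ) : (wishart c n η).PosSemidef := by
  refine PosSemidef.of_dotProduct_mulVec_nonneg ?_ fun v => ?_
  · ext a b
    simp [wishart_apply, mul_comm]
  · rw [star_trivial, dotProduct_wishart_mulVec]
    exact Finset.sum_nonneg fun l _ => mul_nonneg (hc l).le (sq_nonneg _)

include hc in
lemma posDef_wishart_add (n : ℕ) (η : Fin k × ℕ → ℝ) {ε : ℝ} (hε : 0 < ε) :
    (wishart c n η + ε • (1 : Matrix (Fin k) (Fin k) ℝ)).PosDef :=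
  PosDef.posSemidef_add (posSemidef_wishart hc n η) (PosDef.one.smul hε)

include hc in
lemma posSemidef_wishartResolvent (n : ℕ) (η : Fin k × ℕ → ℝ) {ε : ℝ} (hε : 0 < ε) :
    (wishartResolvent c n ε η).PosSemidef :=
  (posDef_wishart_add hc n η hε).inv.posSemidef

lemma measurable_wishartResolvent (c : ℕ → ℝ) (n : ℕ) (ε : ℝ) (a b : Fin k) :
    Measurable fun η : Fin k × ℕ → ℝ => wishartResolvent c n ε η a b := by
  refine measurable_inv_entry (fun i j => ?_) a b
  simp only [Matrix.add_apply]
  exact (measurable_wishart c n i j).add_const _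

lemma dotProduct_wishart_add_mulVec (c : ℕ → ℝ) (n : ℕ) (η : Fin k × ℕ → ℝ) (ε : ℝ)
    (v : Fin k → ℝ) : v ⬝ᵥ (wishart c n η + ε • (1 : Matrix (Fin k) (Fin k) ℝ)) *ᵥ v
      = ∑ l ∈ Finset.range n, c l * (v ⬝ᵥ column η l) ^ 2 + ε * (v ⬝ᵥ v) := by
  rw [add_mulVec, dotProduct_add, dotProduct_wishart_mulVec, smul_mulVec, one_mulVec,
    dotProduct_smul, smul_eq_mul]

include hc in
lemma column_resolvent_column_le {n l : ℕ} (hl : l < n) (η : Fin k × ℕ → ℝ) {ε : ℝ} (hε : 0 < ε) :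
    c l * (column η l ⬝ᵥ wishartResolvent c n ε η *ᵥ column η l) ≤ 1 := by
  have h : column η l ⬝ᵥ wishartResolvent c n ε η *ᵥ column η l ≤ (c l)⁻¹ := by
    refine (posDef_wishart_add hc n η hε).dotProduct_inv_mulVec_le (by have := hc l; positivity)
      fun v => ?_
    rw [dotProduct_wishart_add_mulVec, inv_mul_eq_div, le_div_iff₀ (hc l), mul_comm]
    have h1 := Finset.single_le_sum (f := fun l => c l * (v ⬝ᵥ column η l) ^ 2)
      (fun i _ => mul_nonneg (hc i).le (sq_nonneg _)) (Finset.mem_range.2 hl)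
    have h2 : 0 ≤ ε * (v ⬝ᵥ v) := mul_nonneg hε.le (by simpa using dotProduct_star_self_nonneg v)
    linarith
  calc _ ≤ c l * (c l)⁻¹ := mul_le_mul_of_nonneg_left h (hc l).le
    _ = 1 := mul_inv_cancel₀ (hc l).ne'

include hc in
lemma wishartResolvent_diag_le (n : ℕ) (η : Fin k × ℕ → ℝ) {ε : ℝ} (hε : 0 < ε) (a : Fin k) :
    wishartResolvent c n ε η a a ≤ ε⁻¹ := by
  have h : (Pi.single a 1 : Fin k → ℝ) ⬝ᵥ wishartResolvent c n ε η *ᵥ Pi.single a 1 ≤ ε⁻¹ := by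
    refine (posDef_wishart_add hc n η hε).dotProduct_inv_mulVec_le (by positivity) fun v => ?_
    rw [dotProduct_wishart_add_mulVec, inv_mul_eq_div, le_div_iff₀ hε, dotProduct_single, mul_one]
    have h1 : 0 ≤ ∑ l ∈ Finset.range n, c l * (v ⬝ᵥ column η l) ^ 2 :=
      Finset.sum_nonneg fun i _ => mul_nonneg (hc i).le (sq_nonneg _)
    have h2 : v a * v a ≤ v ⬝ᵥ v :=
      Finset.single_le_sum (f := fun i => v i * v i) (fun i _ => mul_self_nonneg _)
        (Finset.mem_univ a)
    nlinarith
  simpa using h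

include hc in
lemma resolvent_column_sq_le (n l : ℕ) (η : Fin k × ℕ → ℝ) {ε : ℝ} (hε : 0 < ε) (a : Fin k) :
    (wishartResolvent c n ε η *ᵥ column η l) a ^ 2 ≤ wishartResolvent c n ε η a a *
      (column η l ⬝ᵥ wishartResolvent c n ε η *ᵥ column η l) := by
  have := (posSemidef_wishartResolvent hc n η hε).dotProduct_mulVec_sq_le (Pi.single a 1)
    (column η l)
  simpa using this

include hc in
lemma wishartResolvent_mul_wishart (n : ℕ) (η : Fin k × ℕ → ℝ) {ε : ℝ} (hε : 0 < ε) :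
    wishartResolvent c n ε η * wishart c n η = 1 - ε • wishartResolvent c n ε η := by
  have := nonsing_inv_mul _ (posDef_wishart_add hc n η hε).det_isUnit
  rw [← wishartResolvent, mul_add, mul_smul_comm, mul_one] at this
  rw [← this, add_sub_cancel_right]

include hc in
/-- The left side is `tr (R W)`, and `R W = 1 - ε R`. -/
lemma sum_column_resolvent_column_le (n : ℕ) (η : Fin k × ℕ → ℝ) {ε : ℝ} (hε : 0 < ε) :
    ∑ l ∈ Finset.range n, c l * (column η l ⬝ᵥ wishartResolvent c n ε η *ᵥ column η l) ≤ k := by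
  have h1 : ∑ l ∈ Finset.range n, c l * (column η l ⬝ᵥ wishartResolvent c n ε η *ᵥ column η l)
      = (wishartResolvent c n ε η * wishart c n η).trace := by
    rw [wishart, Finset.mul_sum, trace_sum]
    refine Finset.sum_congr rfl fun l _ => ?_
    rw [mul_smul_comm, trace_smul, mul_vecMulVec, trace_vecMulVec, smul_eq_mul, dotProduct_comm]
  have h2 := wishartResolvent_mul_wishart hc n η hε
  have h3 := (posSemidef_wishartResolvent hc n η hε).trace_nonneg
  rw [h1, h2, trace_sub, trace_one, trace_smul, Fintype.card_fin, smul_eq_mul]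
  nlinarith

include hc in
/-- The left side is `tr (R W R)`, and `R W R = R - ε R²`. -/
lemma sum_resolvent_column_sq_le (n : ℕ) (η : Fin k × ℕ → ℝ) {ε : ℝ} (hε : 0 < ε) :
    ∑ l ∈ Finset.range n, c l * ((wishartResolvent c n ε η *ᵥ column η l) ⬝ᵥ
      (wishartResolvent c n ε η *ᵥ column η l)) ≤ (wishartResolvent c n ε η).trace := by
  have hR := posSemidef_wishartResolvent hc n η hε
  have hT : (wishartResolvent c n ε η)ᵀ = wishartResolvent c n ε η := hR.1
  have h1 : ∑ l ∈ Finset.range n, c l * ((wishartResolvent c n ε η *ᵥ column η l) ⬝ᵥ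
      (wishartResolvent c n ε η *ᵥ column η l))
      = (wishartResolvent c n ε η * wishart c n η * wishartResolvent c n ε η).trace := by
    rw [wishart, Finset.mul_sum, Finset.sum_mul, trace_sum]
    refine Finset.sum_congr rfl fun l _ => ?_
    rw [mul_smul_comm, smul_mul_assoc, trace_smul, mul_vecMulVec, vecMulVec_mul, trace_vecMulVec,
      smul_eq_mul, ← mulVec_transpose, hT]
  have h2 := wishartResolvent_mul_wishart hc n η hε
  have h3 : 0 ≤ (wishartResolvent c n ε η * wishartResolvent c n ε η).trace := by
    have := (posSemidef_conjTranspose_mul_self (wishartResolvent c n ε η)).trace_nonneg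
    rwa [conjTranspose_eq_transpose_of_trivial, hT] at this
  rw [h1, h2, sub_mul, one_mul, smul_mul_assoc, trace_sub, trace_smul, smul_eq_mul]
  nlinarith

/-- The derivative of `((W + ε)⁻¹ η_l)_a` in the entry `η (a, l)`. -/
noncomputable def resolventDeriv (c : ℕ → ℝ) (n : ℕ) (ε : ℝ) (l : ℕ) (a : Fin k)
    (η : Fin k × ℕ → ℝ) : ℝ :=
  wishartResolvent c n ε η a a - c l * (wishartResolvent c n ε η a a *
    (column η l ⬝ᵥ wishartResolvent c n ε η *ᵥ column η l) +
      (wishartResolvent c n ε η *ᵥ column η l) a ^ 2)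

lemma hasDerivAt_update_apply {ι : Type*} [DecidableEq ι] (η : ι → ℝ) (p q : ι) (t : ℝ) :
    HasDerivAt (fun s => Function.update η p s q) (if q = p then 1 else 0) t := by
  by_cases h : q = p
  · subst h
    simpa using hasDerivAt_id' t
  · simpa [Function.update_of_ne h, h] using hasDerivAt_const t (η q)

include hc in
/-- With `e` the `a`-th basis vector, the entry `(a, l)` moves `W` in the direction
`c l (e η_lᵀ + η_l eᵀ)`, and `R` in the direction `-R (c l (e η_lᵀ + η_l eᵀ)) R`. -/
lemma hasDerivAt_resolvent_column {n l : ℕ} (hl : l < n) {ε : ℝ} (hε : 0 < ε) (a : Fin k)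
    (η : Fin k × ℕ → ℝ) (t : ℝ) :
    HasDerivAt (fun s => (wishartResolvent c n ε (Function.update η (a, l) s) *ᵥ
      column (Function.update η (a, l) s) l) a)
      (resolventDeriv c n ε l a (Function.update η (a, l) t)) t := by
  set ζ := Function.update η (a, l) t with hζ
  set e : Fin k → ℝ := Pi.single a 1 with he
  set x := column ζ l with hx
  set R := wishartResolvent c n ε ζ with hR
  have hd (q : Fin k × ℕ) := hasDerivAt_update_apply η (a, l) q t
  have hW (i j : Fin k) : HasDerivAt (fun s => (wishart c n (Function.update η (a, l) s) +
      ε • (1 : Matrix (Fin k) (Fin k) ℝ)) i j) ((c l • (vecMulVec e x + vecMulVec x e)) i j) t := by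
    simp only [Matrix.add_apply, wishart_apply]
    refine HasDerivAt.add_const _ ?_
    refine (HasDerivAt.fun_sum fun m _ =>
      ((hd (i, m)).mul (hd (j, m))).const_mul (c m)).congr_deriv ?_
    rw [Finset.sum_eq_single l]
    · simp only [Matrix.smul_apply, Matrix.add_apply, vecMulVec_apply, smul_eq_mul, hx, he, column,
        hζ, Prod.mk.injEq, and_true, Pi.single_apply]
    · intro m _ hm
      simp [hm]
    · intro h
      exact absurd (Finset.mem_range.2 hl) h
  have hA := posDef_wishart_add hc n ζ hε
  have hT : Rᵀ = R := hA.inv.posSemidef.1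
  have hinv (j : Fin k) : HasDerivAt (fun s => wishartResolvent c n ε (Function.update η (a, l) s)
      a j) ((-(R * (c l • (vecMulVec e x + vecMulVec x e)) * R)) a j) t :=
    hasDerivAt_inv_entry hW hA.det_isUnit a j
  have h := HasDerivAt.fun_sum (u := Finset.univ) fun j _ => (hinv j).mul (hd (j, l))
  have heR : e ᵥ* R = R *ᵥ e := by rw [← mulVec_transpose, hT]
  have hxR : x ᵥ* R = R *ᵥ x := by rw [← mulVec_transpose, hT]
  refine h.congr_deriv ?_
  have hcomp : (R * (c l • (vecMulVec e x + vecMulVec x e)) * R) *ᵥ x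
      = c l • ((x ⬝ᵥ R *ᵥ x) • R *ᵥ e + ((R *ᵥ x) a) • R *ᵥ x) := by
    have h2 : e ⬝ᵥ R *ᵥ x = (R *ᵥ x) a := by simp [he]
    rw [mul_smul_comm, smul_mul_assoc, smul_mulVec, mul_add, add_mul, add_mulVec, mul_vecMulVec,
      mul_vecMulVec, vecMulVec_mul, vecMulVec_mul, vecMulVec_mulVec, vecMulVec_mulVec,
      op_smul_eq_smul, op_smul_eq_smul, ← dotProduct_mulVec, ← dotProduct_mulVec, h2]
  have hcompa := congrFun hcomp a
  have hRe : (R *ᵥ e) a = R a a := by simp [he]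
  simp only [Pi.smul_apply, Pi.add_apply, smul_eq_mul, hRe] at hcompa
  rw [Finset.sum_add_distrib]
  have h3 : ∑ j, (-(R * (c l • (vecMulVec e x + vecMulVec x e)) * R)) a j *
      Function.update η (a, l) t (j, l) =
      -((R * (c l • (vecMulVec e x + vecMulVec x e)) * R) *ᵥ x) a := by
    simp only [mulVec, dotProduct, Matrix.neg_apply, neg_mul, Finset.sum_neg_distrib]
    rfl
  have h4 : ∑ j, wishartResolvent c n ε (Function.update η (a, l) t) a j *
      (if (j, l) = (a, l) then 1 else 0) = R a a := by
    rw [Finset.sum_eq_single a]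
    · simp [hR, hζ]
    · intro j _ hj
      simp [hj]
    · simp
  rw [h3, h4, hcompa, resolventDeriv]
  ring

end Wishart

section WishartMoments

open Matrix Filter Topology

variable {k : ℕ} {c : ℕ → ℝ} (hc : ∀ l, 0 < c l)

lemma measurable_resolvent_column (c : ℕ → ℝ) (n : ℕ) (ε : ℝ) (l : ℕ) (a : Fin k) :
    Measurable fun η : Fin k × ℕ → ℝ => (wishartResolvent c n ε η *ᵥ column η l) a := by
  simp only [mulVec, dotProduct]
  exact Finset.measurable_sum _ fun j _ =>
    (measurable_wishartResolvent c n ε a j).mul (measurable_column l j)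

lemma measurable_column_resolvent_column (c : ℕ → ℝ) (n : ℕ) (ε : ℝ) (l : ℕ) :
    Measurable fun η : Fin k × ℕ → ℝ => column η l ⬝ᵥ wishartResolvent c n ε η *ᵥ column η l :=
  measurable_dotProduct_mulVec (fun i j => measurable_wishartResolvent c n ε i j)
    (measurable_column l) (measurable_column l)

include hc in
lemma column_resolvent_column_nonneg (n l : ℕ) (η : Fin k × ℕ → ℝ) {ε : ℝ} (hε : 0 < ε) :
    0 ≤ column η l ⬝ᵥ wishartResolvent c n ε η *ᵥ column η l :=
  (posSemidef_wishartResolvent hc n η hε).dotProduct_mulVec_self_nonneg _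

include hc in
lemma wishartResolvent_diag_nonneg (n : ℕ) (η : Fin k × ℕ → ℝ) {ε : ℝ} (hε : 0 < ε) (a : Fin k) :
    0 ≤ wishartResolvent c n ε η a a :=
  (posSemidef_wishartResolvent hc n η hε).diag_nonneg

include hc in
lemma column_resolvent_column_le_inv {n l : ℕ} (hl : l < n) (η : Fin k × ℕ → ℝ) {ε : ℝ}
    (hε : 0 < ε) : column η l ⬝ᵥ wishartResolvent c n ε η *ᵥ column η l ≤ (c l)⁻¹ := by
  rw [← one_div, le_div_iff₀ (hc l), mul_comm]
  exact column_resolvent_column_le hc hl η hε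

include hc in
lemma trace_wishartResolvent_le (n : ℕ) (η : Fin k × ℕ → ℝ) {ε : ℝ} (hε : 0 < ε) :
    (wishartResolvent c n ε η).trace ≤ k * ε⁻¹ := by
  rw [trace]
  refine (Finset.sum_le_sum fun a _ => wishartResolvent_diag_le hc n η hε a).trans ?_
  simp

include hc in
lemma integrable_trace_wishartResolvent (n : ℕ) {ε : ℝ} (hε : 0 < ε) :
    Integrable (fun η : Fin k × ℕ → ℝ => (wishartResolvent c n ε η).trace)
      (gaussianProduct (Fin k × ℕ)) := by
  refine Integrable.of_bound (C := k * ε⁻¹) ?_ (ae_of_all _ fun η => ?_)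
  · simp only [trace, diag]
    exact (Finset.measurable_sum _ fun a _ =>
      measurable_wishartResolvent c n ε a a).aestronglyMeasurable
  · rw [Real.norm_eq_abs, abs_of_nonneg (posSemidef_wishartResolvent hc n η hε).trace_nonneg]
    exact trace_wishartResolvent_le hc n η hε

include hc in
lemma integrable_column_resolvent_column {n l : ℕ} (hl : l < n) {ε : ℝ} (hε : 0 < ε) :
    Integrable (fun η : Fin k × ℕ → ℝ => column η l ⬝ᵥ wishartResolvent c n ε η *ᵥ column η l)
      (gaussianProduct (Fin k × ℕ)) := by
  refine Integrable.of_bound (C := (c l)⁻¹)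
    (measurable_column_resolvent_column c n ε l).aestronglyMeasurable (ae_of_all _ fun η => ?_)
  rw [Real.norm_eq_abs, abs_of_nonneg (column_resolvent_column_nonneg hc n l η hε)]
  exact column_resolvent_column_le_inv hc hl η hε

include hc in
lemma abs_resolventDeriv_le {n l : ℕ} (hl : l < n) {ε : ℝ} (hε : 0 < ε) (a : Fin k)
    (η : Fin k × ℕ → ℝ) : |resolventDeriv c n ε l a η| ≤ 3 * ε⁻¹ := by
  have h1 := wishartResolvent_diag_le hc n η hε a
  have h2 := wishartResolvent_diag_nonneg hc n η hε a
  have h3 := column_resolvent_column_le hc hl η hε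
  have h4 := mul_nonneg (hc l).le (column_resolvent_column_nonneg hc n l η hε)
  have h5 := resolvent_column_sq_le hc n l η hε a
  have h6 := mul_nonneg (hc l).le (sq_nonneg ((wishartResolvent c n ε η *ᵥ column η l) a))
  have h7 := mul_le_mul_of_nonneg_left h5 (hc l).le
  rw [resolventDeriv]
  set r := wishartResolvent c n ε η a a
  set q := column η l ⬝ᵥ wishartResolvent c n ε η *ᵥ column η l
  set s := (wishartResolvent c n ε η *ᵥ column η l) a ^ 2
  have h8 : r * (c l * q) ≤ r := mul_le_of_le_one_right h2 h3
  have h9 : 0 ≤ r * (c l * q) := mul_nonneg h2 h4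
  rw [abs_le]
  constructor <;> nlinarith

lemma measurable_resolventDeriv (c : ℕ → ℝ) (n : ℕ) (ε : ℝ) (l : ℕ) (a : Fin k) :
    Measurable (resolventDeriv c n ε l a) := by
  unfold resolventDeriv
  exact (measurable_wishartResolvent c n ε a a).sub
    ((((measurable_wishartResolvent c n ε a a).mul
      (measurable_column_resolvent_column c n ε l)).add
        ((measurable_resolvent_column c n ε l a).pow_const 2)).const_mul _)

lemma sum_resolventDeriv (c : ℕ → ℝ) (n : ℕ) (ε : ℝ) (l : ℕ) (η : Fin k × ℕ → ℝ) :
    ∑ a, resolventDeriv c n ε l a η = (wishartResolvent c n ε η).trace -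
      ((wishartResolvent c n ε η).trace *
        (c l * (column η l ⬝ᵥ wishartResolvent c n ε η *ᵥ column η l)) +
      c l * ((wishartResolvent c n ε η *ᵥ column η l) ⬝ᵥ
        (wishartResolvent c n ε η *ᵥ column η l))) := by
  simp only [resolventDeriv, Finset.sum_sub_distrib, ← Finset.mul_sum, Finset.sum_add_distrib,
    ← Finset.sum_mul]
  have h1 : ∑ a, wishartResolvent c n ε η a a = (wishartResolvent c n ε η).trace := rfl
  have h2 : ∑ a, (wishartResolvent c n ε η *ᵥ column η l) a ^ 2 =
      (wishartResolvent c n ε η *ᵥ column η l) ⬝ᵥ (wishartResolvent c n ε η *ᵥ column η l) := by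
    simp [dotProduct, sq]
  rw [h1, h2]
  ring

include hc in
/-- Gaussian integration by parts for the vector field `η_l ↦ (W + ε)⁻¹ η_l`. -/
lemma integral_column_resolvent_column {n l : ℕ} (hl : l < n) {ε : ℝ} (hε : 0 < ε) :
    ∫ η, column η l ⬝ᵥ wishartResolvent c n ε η *ᵥ column η l ∂(gaussianProduct (Fin k × ℕ))
      = ∫ η, ∑ a, resolventDeriv c n ε l a η ∂(gaussianProduct (Fin k × ℕ)) := by
  have hbound (a : Fin k) (η : Fin k × ℕ → ℝ) :
      |(wishartResolvent c n ε η *ᵥ column η l) a| ≤ 1 + ε⁻¹ * (c l)⁻¹ := by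
    have h1 := resolvent_column_sq_le hc n l η hε a
    have h2 := mul_le_mul (wishartResolvent_diag_le hc n η hε a)
      (column_resolvent_column_le_inv hc hl η hε) (column_resolvent_column_nonneg hc n l η hε)
      (by positivity)
    rw [abs_le]
    constructor <;> nlinarith
  have hstein (a : Fin k) := integral_mul_gaussianProduct_eq (a, l)
    (measurable_resolvent_column c n ε l a) (measurable_resolventDeriv c n ε l a)
    (hasDerivAt_resolvent_column hc hl hε a) (hbound a) (abs_resolventDeriv_le hc hl hε a)
  rw [integral_finsetSum, ← Finset.sum_congr rfl fun a _ => hstein a, ← integral_finsetSum]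
  · rfl
  · intro a _
    have hid : Integrable (fun η : Fin k × ℕ → ℝ => η (a, l)) (gaussianProduct (Fin k × ℕ)) := by
      have := measurePreserving_eval_infinitePi (fun _ : Fin k × ℕ => gaussianReal 0 1) (a, l)
      refine (this.integrable_comp (g := fun x : ℝ => x) (by fun_prop)).2 ?_
      exact (memLp_id_gaussianReal 1).integrable le_rfl
    have := hid.bdd_mul (measurable_resolvent_column c n ε l a).aestronglyMeasurable
      (ae_of_all _ (hbound a))
    simpa [mul_comm] using this
  · intro a _
    exact Integrable.of_bound (measurable_resolventDeriv c n ε l a).aestronglyMeasurable _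
      (ae_of_all _ (abs_resolventDeriv_le hc hl hε a))

include hc in
lemma integrable_sum_resolventDeriv {n l : ℕ} (hl : l < n) {ε : ℝ} (hε : 0 < ε) :
    Integrable (fun η => ∑ a, resolventDeriv c n ε l a η) (gaussianProduct (Fin k × ℕ)) :=
  integrable_finsetSum _ fun a _ =>
    Integrable.of_bound (measurable_resolventDeriv c n ε l a).aestronglyMeasurable _
      (ae_of_all _ (abs_resolventDeriv_le hc hl hε a))

include hc in
/-- The trace of the resolvent of a Wishart matrix with at least `k + 2` degrees of freedom is
bounded in mean, uniformly in `ε`: summing the integration by parts over `k + 2`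
columns gains `k + 2` traces and loses at most `k + 1` of them. -/
lemma integral_trace_wishartResolvent_le (hanti : Antitone c) {n : ℕ} (hn : k + 2 ≤ n) {ε : ℝ}
    (hε : 0 < ε) :
    ∫ η, (wishartResolvent c n ε η).trace ∂(gaussianProduct (Fin k × ℕ)) ≤ k / c (k + 1) := by
  have hlt {l : ℕ} (hl : l ∈ Finset.range (k + 2)) : l < n :=
    lt_of_lt_of_le (Finset.mem_range.1 hl) hn
  have hsub : Finset.range (k + 2) ⊆ Finset.range n := Finset.range_subset_range.2 hn
  calc ∫ η, (wishartResolvent c n ε η).trace ∂(gaussianProduct (Fin k × ℕ))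
      ≤ ∫ η, ∑ l ∈ Finset.range (k + 2), ∑ a, resolventDeriv c n ε l a η
          ∂(gaussianProduct (Fin k × ℕ)) := by
        refine integral_mono (integrable_trace_wishartResolvent hc n hε)
          (integrable_finsetSum _ fun l hl => integrable_sum_resolventDeriv hc (hlt hl) hε)
          fun η => ?_
        simp only [sum_resolventDeriv, Finset.sum_sub_distrib, Finset.sum_const, Finset.card_range,
          Finset.sum_add_distrib, ← Finset.mul_sum, nsmul_eq_mul]
        have h0 := (posSemidef_wishartResolvent hc n η hε).trace_nonneg
        have h1 := (Finset.sum_le_sum_of_subset_of_nonneg hsub fun l _ _ => mul_nonneg (hc l).le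
          (column_resolvent_column_nonneg hc n l η hε)).trans
            (sum_column_resolvent_column_le hc n η hε)
        have h2 := (Finset.sum_le_sum_of_subset_of_nonneg hsub fun l _ _ => mul_nonneg (hc l).le
          (by simpa using dotProduct_star_self_nonneg (wishartResolvent c n ε η *ᵥ column η l))
            ).trans (sum_resolvent_column_sq_le hc n η hε)
        have h3 := mul_le_mul_of_nonneg_left h1 h0
        push_cast
        linarith
    _ = ∫ η, ∑ l ∈ Finset.range (k + 2), column η l ⬝ᵥ wishartResolvent c n ε η *ᵥ column η l
          ∂(gaussianProduct (Fin k × ℕ)) := by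
        rw [integral_finsetSum _ fun l hl => integrable_sum_resolventDeriv hc (hlt hl) hε,
          integral_finsetSum _ fun l hl => integrable_column_resolvent_column hc (hlt hl) hε]
        exact Finset.sum_congr rfl fun l hl =>
          (integral_column_resolvent_column hc (hlt hl) hε).symm
    _ ≤ ∫ _, k / c (k + 1) ∂(gaussianProduct (Fin k × ℕ)) := by
        refine integral_mono (integrable_finsetSum _ fun l hl =>
          integrable_column_resolvent_column hc (hlt hl) hε) (integrable_const _) fun η => ?_
        rw [le_div_iff₀ (hc _), Finset.sum_mul]
        refine le_trans (Finset.sum_le_sum fun l hl => ?_)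
          ((Finset.sum_le_sum_of_subset_of_nonneg hsub fun l _ _ => mul_nonneg (hc l).le
          (column_resolvent_column_nonneg hc n l η hε)).trans
            (sum_column_resolvent_column_le hc n η hε))
        rw [mul_comm]
        exact mul_le_mul_of_nonneg_right (hanti (Nat.lt_succ_iff.1 (Finset.mem_range.1 hl)))
          (column_resolvent_column_nonneg hc n l η hε)
    _ = k / c (k + 1) := by simp

include hc in
/-- Dropping the negative terms of the integration by parts leaves the trace of the resolvent. -/
lemma integral_column_resolvent_column_le (hanti : Antitone c) {n l : ℕ} (hn : k + 2 ≤ n)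
    (hl : l < n) {ε : ℝ} (hε : 0 < ε) :
    ∫ η, column η l ⬝ᵥ wishartResolvent c n ε η *ᵥ column η l ∂(gaussianProduct (Fin k × ℕ))
      ≤ k / c (k + 1) := by
  rw [integral_column_resolvent_column hc hl hε]
  refine (integral_mono (integrable_sum_resolventDeriv hc hl hε)
    (integrable_trace_wishartResolvent hc n hε) fun η => ?_).trans
      (integral_trace_wishartResolvent_le hc hanti hn hε)
  simp only [sum_resolventDeriv]
  have h0 := (posSemidef_wishartResolvent hc n η hε).trace_nonneg
  have h1 := mul_nonneg (hc l).le (column_resolvent_column_nonneg hc n l η hε)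
  have h2 : 0 ≤ (wishartResolvent c n ε η *ᵥ column η l) ⬝ᵥ
      (wishartResolvent c n ε η *ᵥ column η l) := by
    simpa using dotProduct_star_self_nonneg (wishartResolvent c n ε η *ᵥ column η l)
  have h3 := mul_nonneg h0 h1
  have h4 := mul_nonneg (hc l).le h2
  linarith

include hc in
/-- The mean of `tr (W + ε)⁻¹` stays bounded as `ε → 0`, whereas `tr (W + ε)⁻¹ ≥ ε⁻¹` on the event
that `W` is singular; Markov's inequality shows that this event is null. -/
lemma ae_posDef_wishart (hanti : Antitone c) {n : ℕ} (hn : k + 2 ≤ n) :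
    ∀ᵐ η ∂(gaussianProduct (Fin k × ℕ)), (wishart c n η).PosDef := by
  set B : ℝ := k / c (k + 1)
  have hB : 0 ≤ B := div_nonneg (Nat.cast_nonneg _) (hc _).le
  -- a unit vector in the kernel of `W` makes the trace of `(W + ε)⁻¹` at least `ε⁻¹`
  have hsing {ε : ℝ} (hε : 0 < ε) (η : Fin k × ℕ → ℝ) (h : (wishart c n η).det = 0) :
      ε⁻¹ ≤ (wishartResolvent c n ε η).trace := by
    obtain ⟨v, hv, hv0⟩ := exists_mulVec_eq_zero_iff.2 h
    have hA := posDef_wishart_add hc n η hε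
    have h1 : wishartResolvent c n ε η *ᵥ v = ε⁻¹ • v := by
      have : (wishart c n η + ε • (1 : Matrix (Fin k) (Fin k) ℝ)) *ᵥ v = ε • v := by
        rw [add_mulVec, hv0, zero_add, smul_mulVec, one_mulVec]
      have h2 : ε • wishartResolvent c n ε η *ᵥ v = v := by
        rw [← mulVec_smul, ← this, wishartResolvent, mulVec_mulVec,
          nonsing_inv_mul _ hA.det_isUnit, one_mulVec]
      rw [eq_inv_smul_iff₀ hε.ne', h2]
    have h2 := (posSemidef_wishartResolvent hc n η hε).dotProduct_mulVec_self_le_trace v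
    have h3 : 0 < v ⬝ᵥ v := by simpa using dotProduct_star_self_pos_iff.2 hv
    rw [h1, dotProduct_smul, smul_eq_mul, mul_comm] at h2
    exact le_of_mul_le_mul_left h2 h3
  have hmeas (ε : ℝ) (hε : 0 < ε) :
      (gaussianProduct (Fin k × ℕ)).real {η | (wishart c n η).det = 0} ≤ ε * B := by
    have h1 := mul_meas_ge_le_integral_of_nonneg
      (ae_of_all _ fun η => (posSemidef_wishartResolvent hc n η hε).trace_nonneg)
      (integrable_trace_wishartResolvent (k := k) hc n hε) ε⁻¹
    have h2 := h1.trans (integral_trace_wishartResolvent_le hc hanti hn hε)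
    rw [inv_mul_le_iff₀ hε] at h2
    refine le_trans (measureReal_mono fun η hη => ?_) h2
    exact hsing hε η hη
  have hzero : (gaussianProduct (Fin k × ℕ)).real {η | (wishart c n η).det = 0} = 0 := by
    refine le_antisymm (le_of_forall_pos_le_add fun δ hδ => ?_) measureReal_nonneg
    refine (hmeas (δ / (B + 1)) (by positivity)).trans ?_
    rw [zero_add, div_mul_eq_mul_div, div_le_iff₀ (by positivity)]
    nlinarith
  rw [measureReal_eq_zero_iff] at hzero
  have : ∀ᵐ η ∂(gaussianProduct (Fin k × ℕ)), ¬ (wishart c n η).det = 0 := by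
    rw [ae_iff]
    simpa using hzero
  filter_upwards [this] with η hη
  exact (posSemidef_wishart hc n η).posDef_iff_det_ne_zero.2 hη

include hc in
/-- Inverse moments of the Wishart matrix along its own columns, uniformly in the column. -/
lemma lintegral_column_inv_wishart_column_le (hanti : Antitone c) {n l : ℕ} (hn : k + 2 ≤ n)
    (hl : l < n) :
    ∫⁻ η, ENNReal.ofReal (column η l ⬝ᵥ (wishart c n η)⁻¹ *ᵥ column η l)
      ∂(gaussianProduct (Fin k × ℕ)) ≤ ENNReal.ofReal (k / c (k + 1)) := by
  have hpos (j : ℕ) : (0 : ℝ) < 1 / ((j : ℝ) + 1) := Nat.one_div_pos_of_nat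
  have hlim : ∀ᵐ η ∂(gaussianProduct (Fin k × ℕ)), Tendsto (fun j : ℕ => ENNReal.ofReal
      (column η l ⬝ᵥ wishartResolvent c n (1 / ((j : ℝ) + 1)) η *ᵥ column η l)) atTop
      (𝓝 (ENNReal.ofReal (column η l ⬝ᵥ (wishart c n η)⁻¹ *ᵥ column η l))) := by
    filter_upwards [ae_posDef_wishart hc hanti hn] with η hη
    refine ENNReal.tendsto_ofReal ?_
    have hent (i j : Fin k) : Tendsto
        (fun m : ℕ => wishartResolvent c n (1 / ((m : ℝ) + 1)) η i j) atTop
        (𝓝 ((wishart c n η)⁻¹ i j)) := by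
      refine tendsto_inv_entry (fun a b => ?_) hη.det_isUnit i j
      have h1 : Tendsto (fun m : ℕ => 1 / ((m : ℝ) + 1)) atTop (𝓝 0) :=
        tendsto_one_div_add_atTop_nhds_zero_nat
      have h2 := (h1.mul_const ((1 : Matrix (Fin k) (Fin k) ℝ) a b)).const_add (wishart c n η a b)
      simpa using h2
    simp only [dotProduct, mulVec]
    exact tendsto_finsetSum _ fun i _ => (tendsto_finsetSum _ fun j _ =>
      (hent i j).mul_const _).const_mul _
  calc _ = ∫⁻ η, liminf (fun j : ℕ => ENNReal.ofReal
        (column η l ⬝ᵥ wishartResolvent c n (1 / ((j : ℝ) + 1)) η *ᵥ column η l)) atTop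
        ∂(gaussianProduct (Fin k × ℕ)) :=
        lintegral_congr_ae (hlim.mono fun η h => h.liminf_eq.symm)
    _ ≤ liminf (fun j : ℕ => ∫⁻ η, ENNReal.ofReal
        (column η l ⬝ᵥ wishartResolvent c n (1 / ((j : ℝ) + 1)) η *ᵥ column η l)
        ∂(gaussianProduct (Fin k × ℕ))) atTop :=
        lintegral_liminf_le fun j =>
          (measurable_column_resolvent_column c n _ l).ennreal_ofReal
    _ ≤ ENNReal.ofReal (k / c (k + 1)) := by
        refine liminf_le_of_frequently_le' (Frequently.of_forall fun j => ?_)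
        rw [← ofReal_integral_eq_lintegral_ofReal
          (integrable_column_resolvent_column hc hl (hpos j))
          (ae_of_all _ fun η => column_resolvent_column_nonneg hc n l η (hpos j))]
        exact ENNReal.ofReal_le_ofReal
          (integral_column_resolvent_column_le hc hanti hn hl (hpos j))

end WishartMoments

/-! ### Sign changes of one column -/

section SignFlip

open Matrix Filter

variable {k : ℕ}

/-- The array `η` with the sign of its `l`-th column reversed. -/
def flipColumn (l : ℕ) (η : Fin k × ℕ → ℝ) : Fin k × ℕ → ℝ :=
  fun p => if p.2 = l then -η p else η p

lemma column_flipColumn_self (l : ℕ) (η : Fin k × ℕ → ℝ) :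
    column (flipColumn l η) l = -column η l := by
  ext a; simp [column, flipColumn]

lemma column_flipColumn_of_ne {l m : ℕ} (h : m ≠ l) (η : Fin k × ℕ → ℝ) :
    column (flipColumn l η) m = column η m := by
  ext a; simp [column, flipColumn, h]

lemma measurePreserving_flipColumn (l : ℕ) :
    MeasurePreserving (flipColumn l) (gaussianProduct (Fin k × ℕ))
      (gaussianProduct (Fin k × ℕ)) := by
  have hm (p : Fin k × ℕ) : Measurable fun x : ℝ => if p.2 = l then -x else x := by
    split_ifs
    · exact measurable_neg
    · exact measurable_id
  refine ⟨measurable_pi_iff.2 fun p => (hm p).comp (measurable_pi_apply p), ?_⟩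
  have := Measure.infinitePi_map_pi (fun _ : Fin k × ℕ => gaussianReal 0 1) hm
  refine this.trans ?_
  rw [gaussianProduct]
  congr 1
  ext1 p
  split_ifs
  · have := gaussianReal_map_neg (μ := 0) (v := 1)
    simpa using this
  · exact Measure.map_id

/-- The matrix `∑ l, w l * η_l η_lᵀ`, as the upper limit of its partial sums so that it depends
measurably on `η` without a convergence assumption. -/
noncomputable def gramLimsup (w : ℕ → ℝ) (η : Fin k × ℕ → ℝ) : Matrix (Fin k) (Fin k) ℝ :=
  Matrix.of fun a b => limsup (fun n => wishart w n η a b) atTop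

lemma measurable_gramLimsup (w : ℕ → ℝ) (a b : Fin k) :
    Measurable fun η : Fin k × ℕ → ℝ => gramLimsup w η a b :=
  Measurable.limsup fun n => measurable_wishart w n a b

lemma gramLimsup_flipColumn (w : ℕ → ℝ) (l : ℕ) (η : Fin k × ℕ → ℝ) :
    gramLimsup w (flipColumn l η) = gramLimsup w η := by
  ext a b
  simp only [gramLimsup, of_apply, wishart_apply]
  congr 1
  ext n
  refine Finset.sum_congr rfl fun m _ => ?_
  simp only [flipColumn]
  split_ifs <;> ring

/-- A bilinear form that depends evenly on the columns has uncorrelated columns. -/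
lemma integral_column_mulVec_column_eq_zero {S : (Fin k × ℕ → ℝ) → Matrix (Fin k) (Fin k) ℝ}
    (hSm : ∀ a b, Measurable fun η => S η a b)
    (hS : ∀ l η, S (flipColumn l η) = S η) {l m : ℕ} (hlm : l ≠ m) :
    ∫ η, column η l ⬝ᵥ S η *ᵥ column η m ∂(gaussianProduct (Fin k × ℕ)) = 0 := by
  have hmp := measurePreserving_flipColumn (k := k) l
  have hmeas : Measurable fun η : Fin k × ℕ → ℝ => column η l ⬝ᵥ S η *ᵥ column η m :=
    measurable_dotProduct_mulVec hSm (measurable_column l) (measurable_column m)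
  have h1 : ∫ η, column η l ⬝ᵥ S η *ᵥ column η m ∂(gaussianProduct (Fin k × ℕ))
      = ∫ η, -(column η l ⬝ᵥ S η *ᵥ column η m) ∂(gaussianProduct (Fin k × ℕ)) := by
    conv_lhs => rw [← hmp.map_eq]
    rw [integral_map hmp.aemeasurable hmeas.aestronglyMeasurable]
    refine integral_congr_ae (ae_of_all _ fun η => ?_)
    simp only [hS, column_flipColumn_self, column_flipColumn_of_ne hlm.symm, neg_dotProduct]
  rw [integral_neg] at h1
  linarith

end SignFlip

/-! ### Orthonormal systems of square integrable functions -/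

section SquareIntegrable

open Filter Topology

variable {α : Type*} [MeasurableSpace α] {μ : Measure α}

lemma MeasureTheory.MemLp.integrable_mul_of_two {u v : α → ℝ} (hu : MemLp u 2 μ)
    (hv : MemLp v 2 μ) : Integrable (fun x => u x * v x) μ :=
  hu.integrable_mul hv

lemma MeasureTheory.MemLp.fun_sub_two {u v : α → ℝ} (hu : MemLp u 2 μ) (hv : MemLp v 2 μ) :
    MemLp (fun x => u x - v x) 2 μ :=
  hu.sub hv

/-- The Cauchy–Schwarz inequality for square integrable functions. -/
lemma sq_integral_mul_le {u v : α → ℝ} (hu : MemLp u 2 μ) (hv : MemLp v 2 μ) :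
    (∫ x, u x * v x ∂μ) ^ 2 ≤ (∫ x, u x ^ 2 ∂μ) * ∫ x, v x ^ 2 ∂μ := by
  have h (t : ℝ) : 0 ≤ (∫ x, v x ^ 2 ∂μ) * (t * t) + (2 * ∫ x, u x * v x ∂μ) * t
      + ∫ x, u x ^ 2 ∂μ := by
    have h1 : ∫ x, (u x + t * v x) ^ 2 ∂μ = (∫ x, v x ^ 2 ∂μ) * (t * t)
        + (2 * ∫ x, u x * v x ∂μ) * t + ∫ x, u x ^ 2 ∂μ := by
      have : ∀ x, (u x + t * v x) ^ 2 = u x ^ 2 + ((2 * t) * (u x * v x) + (t * t) * v x ^ 2) :=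
        fun x => by ring
      simp only [this]
      have hi : Integrable (fun x => (2 * t) * (u x * v x) + (t * t) * v x ^ 2) μ :=
        ((hu.integrable_mul_of_two hv).const_mul _).add (hv.integrable_sq.const_mul _)
      rw [integral_add hu.integrable_sq hi, integral_add ((hu.integrable_mul_of_two hv).const_mul _)
        (hv.integrable_sq.const_mul _), integral_const_mul, integral_const_mul]
      ring
    rw [← h1]
    exact integral_nonneg fun x => sq_nonneg _
  have := discrim_le_zero h
  rw [discrim] at this
  linarith

lemma tendsto_integral_mul_of_tendsto_sq {u : ℕ → α → ℝ} {v w : α → ℝ}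
    (hu : ∀ n, MemLp (u n) 2 μ) (hv : MemLp v 2 μ) (hw : MemLp w 2 μ)
    (h : Tendsto (fun n => ∫ x, (v x - u n x) ^ 2 ∂μ) atTop (𝓝 0)) :
    Tendsto (fun n => ∫ x, w x * u n x ∂μ) atTop (𝓝 (∫ x, w x * v x ∂μ)) := by
  have h1 : Tendsto (fun n => (∫ x, w x * (v x - u n x) ∂μ) ^ 2) atTop (𝓝 0) := by
    refine squeeze_zero (fun n => sq_nonneg _)
      (fun n => sq_integral_mul_le hw (hv.fun_sub_two (hu n))) ?_
    simpa using h.const_mul (∫ x, w x ^ 2 ∂μ)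
  have h2 : Tendsto (fun n => ∫ x, w x * (v x - u n x) ∂μ) atTop (𝓝 0) := by
    rw [tendsto_zero_iff_abs_tendsto_zero]
    have := h1.sqrt
    simp only [Real.sqrt_sq_eq_abs, Real.sqrt_zero] at this
    exact this
  have h3 (n : ℕ) : ∫ x, w x * u n x ∂μ
      = ∫ x, w x * v x ∂μ - ∫ x, w x * (v x - u n x) ∂μ := by
    rw [← integral_sub (hw.integrable_mul_of_two hv)
      (hw.integrable_mul_of_two (hv.fun_sub_two (hu n)))]
    congr 1 with x
    ring
  simp only [h3]
  simpa using h2.const_sub (∫ x, w x * v x ∂μ)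

lemma tendsto_integral_sq_of_tendsto_sq {u : ℕ → α → ℝ} {v : α → ℝ}
    (hu : ∀ n, MemLp (u n) 2 μ) (hv : MemLp v 2 μ)
    (h : Tendsto (fun n => ∫ x, (v x - u n x) ^ 2 ∂μ) atTop (𝓝 0)) :
    Tendsto (fun n => ∫ x, u n x ^ 2 ∂μ) atTop (𝓝 (∫ x, v x ^ 2 ∂μ)) := by
  have h1 := tendsto_integral_mul_of_tendsto_sq hu hv hv h
  have h2 (n : ℕ) : ∫ x, u n x ^ 2 ∂μ = ∫ x, (v x - u n x) ^ 2 ∂μ + 2 * ∫ x, v x * u n x ∂μ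
      - ∫ x, v x ^ 2 ∂μ := by
    have hi : Integrable (fun x => (v x - u n x) ^ 2 + 2 * (v x * u n x)) μ :=
      (hv.fun_sub_two (hu n)).integrable_sq.add ((hv.integrable_mul_of_two (hu n)).const_mul _)
    rw [← integral_const_mul, ← integral_add (hv.fun_sub_two (hu n)).integrable_sq
      ((hv.integrable_mul_of_two (hu n)).const_mul _), ← integral_sub hi hv.integrable_sq]
    congr 1 with x
    ring
  simp only [h2]
  have h3 := (h.add (h1.const_mul 2)).sub_const (∫ x, v x ^ 2 ∂μ)
  convert h3 using 2
  simp only [sq]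
  ring

/-- A family of pairwise orthogonal square integrable functions of norm one. -/
structure IsOrthonormalSystem (μ : Measure α) (e : ℕ → α → ℝ) : Prop where
  memLp : ∀ j, MemLp (e j) 2 μ
  orthonormal : ∀ i j, ∫ x, e i x * e j x ∂μ = if i = j then 1 else 0

namespace IsOrthonormalSystem

variable {e : ℕ → α → ℝ} (he : IsOrthonormalSystem μ e)

include he

lemma memLp_sum (b : ℕ → ℝ) (n : ℕ) : MemLp (fun x => ∑ l ∈ Finset.range n, b l * e l x) 2 μ :=
  memLp_finsetSum _ fun l _ => (he.memLp l).const_mul (b l)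

lemma integral_mul_sum {w : α → ℝ} (hw : MemLp w 2 μ) (b : ℕ → ℝ) (n : ℕ) :
    ∫ x, w x * ∑ l ∈ Finset.range n, b l * e l x ∂μ
      = ∑ l ∈ Finset.range n, b l * ∫ x, w x * e l x ∂μ := by
  simp only [Finset.mul_sum]
  rw [integral_finsetSum]
  · refine Finset.sum_congr rfl fun l _ => ?_
    rw [← integral_const_mul]
    congr 1 with x
    ring
  · intro l _
    have := (hw.integrable_mul_of_two (he.memLp l)).const_mul (b l)
    refine this.congr (ae_of_all _ fun x => ?_)
    ring

lemma integral_sum_mul (b : ℕ → ℝ) (n l : ℕ) :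
    ∫ x, (∑ m ∈ Finset.range n, b m * e m x) * e l x ∂μ = if l < n then b l else 0 := by
  have := he.integral_mul_sum (he.memLp l) b n
  simp only [mul_comm _ (e l _)]
  rw [this]
  simp [he.orthonormal]

lemma integral_sum_sq (b : ℕ → ℝ) (n : ℕ) :
    ∫ x, (∑ l ∈ Finset.range n, b l * e l x) ^ 2 ∂μ = ∑ l ∈ Finset.range n, b l ^ 2 := by
  simp only [sq]
  rw [he.integral_mul_sum (he.memLp_sum b n)]
  refine Finset.sum_congr rfl fun l hl => ?_
  rw [he.integral_sum_mul, if_pos (Finset.mem_range.1 hl)]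

lemma integral_sub_sum_sq {F : α → ℝ} (hF : MemLp F 2 μ) {b : ℕ → ℝ} {n : ℕ}
    (hb : ∀ l < n, ∫ x, F x * e l x ∂μ = b l) :
    ∫ x, (F x - ∑ l ∈ Finset.range n, b l * e l x) ^ 2 ∂μ
      = ∫ x, F x ^ 2 ∂μ - ∑ l ∈ Finset.range n, b l ^ 2 := by
  have hS := he.memLp_sum b n
  have h1 : ∀ x, (F x - ∑ l ∈ Finset.range n, b l * e l x) ^ 2 = F x ^ 2 -
      (2 * (F x * ∑ l ∈ Finset.range n, b l * e l x) - (∑ l ∈ Finset.range n, b l * e l x) ^ 2) :=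
    fun x => by ring
  simp only [h1]
  have hi : Integrable (fun x => 2 * (F x * ∑ l ∈ Finset.range n, b l * e l x) -
      (∑ l ∈ Finset.range n, b l * e l x) ^ 2) μ :=
    ((hF.integrable_mul_of_two hS).const_mul 2).sub hS.integrable_sq
  rw [integral_sub hF.integrable_sq hi,
    integral_sub ((hF.integrable_mul_of_two hS).const_mul 2) hS.integrable_sq,
    integral_const_mul, he.integral_mul_sum hF, he.integral_sum_sq]
  have : ∑ l ∈ Finset.range n, b l * ∫ x, F x * e l x ∂μ = ∑ l ∈ Finset.range n, b l ^ 2 :=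
    Finset.sum_congr rfl fun l hl => by rw [hb l (Finset.mem_range.1 hl), sq]
  rw [this]
  ring

/-- **Bessel's inequality**. -/
lemma sum_sq_le {F : α → ℝ} (hF : MemLp F 2 μ) (n : ℕ) :
    ∑ l ∈ Finset.range n, (∫ x, F x * e l x ∂μ) ^ 2 ≤ ∫ x, F x ^ 2 ∂μ := by
  have := he.integral_sub_sum_sq hF (b := fun l => ∫ x, F x * e l x ∂μ) (n := n) fun _ _ => rfl
  have h2 : 0 ≤ ∫ x, (F x - ∑ l ∈ Finset.range n, (∫ x, F x * e l x ∂μ) * e l x) ^ 2 ∂μ :=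
    integral_nonneg fun x => sq_nonneg _
  linarith

lemma summable_sq {F : α → ℝ} (hF : MemLp F 2 μ) :
    Summable fun l => (∫ x, F x * e l x ∂μ) ^ 2 :=
  summable_of_sum_range_le (fun _ => sq_nonneg _) (he.sum_sq_le hF)

lemma tendsto_integral_sub_sum_sq {F : α → ℝ} (hF : MemLp F 2 μ) {b : ℕ → ℝ}
    (hb : ∀ l, ∫ x, F x * e l x ∂μ = b l) (hsum : HasSum (fun l => b l ^ 2) (∫ x, F x ^ 2 ∂μ)) :
    Tendsto (fun n => ∫ x, (F x - ∑ l ∈ Finset.range n, b l * e l x) ^ 2 ∂μ) atTop (𝓝 0) := by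
  simp only [he.integral_sub_sum_sq hF fun l _ => hb l]
  have := hsum.tendsto_sum_nat.const_sub (∫ x, F x ^ 2 ∂μ)
  rwa [sub_self] at this

lemma hasSum_of_tendsto {F : α → ℝ} (hF : MemLp F 2 μ) {b : ℕ → ℝ} (hb : Summable fun l => b l ^ 2)
    (hlim : Tendsto (fun n => ∫ x, (F x - ∑ l ∈ Finset.range n, b l * e l x) ^ 2 ∂μ) atTop (𝓝 0))
    {h : α → ℝ} (hh : MemLp h 2 μ) :
    HasSum (fun l => b l * ∫ x, h x * e l x ∂μ) (∫ x, h x * F x ∂μ) := by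
  have hs : Summable fun l => b l * ∫ x, h x * e l x ∂μ := by
    refine Summable.of_norm_bounded ((hb.add (he.summable_sq hh)).div_const 2) fun l => ?_
    rw [Real.norm_eq_abs, abs_mul, ← sq_abs (b l), ← sq_abs (∫ x, h x * e l x ∂μ)]
    nlinarith [sq_nonneg (|b l| - |∫ x, h x * e l x ∂μ|)]
  have h1 := tendsto_integral_mul_of_tendsto_sq (he.memLp_sum b) hF hh hlim
  simp only [he.integral_mul_sum hh] at h1
  rw [← tendsto_nhds_unique hs.hasSum.tendsto_sum_nat h1]
  exact hs.hasSum

/-- **Parseval's identity** for a function whose norm is the norm of its Fourier coefficients. -/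
lemma hasSum_integral_mul {F : α → ℝ} (hF : MemLp F 2 μ)
    (hsum : HasSum (fun l => (∫ x, F x * e l x ∂μ) ^ 2) (∫ x, F x ^ 2 ∂μ)) {h : α → ℝ}
    (hh : MemLp h 2 μ) :
    HasSum (fun l => (∫ x, F x * e l x ∂μ) * ∫ x, h x * e l x ∂μ) (∫ x, h x * F x ∂μ) :=
  he.hasSum_of_tendsto hF hsum.summable
    (he.tendsto_integral_sub_sum_sq hF (fun _ => rfl) hsum) hh

/-- The pointwise sum of a series with square summable coefficients is its sum in `L²`. -/
lemma memLp_and_hasSum_of_hasSum {a : ℕ → ℝ} (ha : Summable fun l => a l ^ 2) {F : α → ℝ}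
    (hF : ∀ x, HasSum (fun l => a l * e l x) (F x)) :
    MemLp F 2 μ ∧ ∀ h : α → ℝ, MemLp h 2 μ →
      HasSum (fun l => a l * ∫ x, h x * e l x ∂μ) (∫ x, h x * F x ∂μ) := by
  set S : ℕ → α → ℝ := fun n x => ∑ l ∈ Finset.range n, a l * e l x with hS
  have hSm (n : ℕ) : MemLp (S n) 2 μ := he.memLp_sum a n
  have hFm : AEStronglyMeasurable F μ :=
    aestronglyMeasurable_of_tendsto_ae atTop (fun n => (hSm n).aestronglyMeasurable)
      (ae_of_all _ fun x => (hF x).tendsto_sum_nat)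
  have hdiff {n m : ℕ} (hnm : n ≤ m) : ∫ x, (S m x - S n x) ^ 2 ∂μ
      = ∑ l ∈ Finset.range m, a l ^ 2 - ∑ l ∈ Finset.range n, a l ^ 2 := by
    rw [he.integral_sub_sum_sq (hSm m) (n := n) fun l hl => by
      rw [he.integral_sum_mul, if_pos (hl.trans_le hnm)], he.integral_sum_sq]
  -- Fatou's lemma bounds the distance to the pointwise limit by the tail of the coefficients
  have hfatou (n : ℕ) : ∫⁻ x, ENNReal.ofReal ((F x - S n x) ^ 2) ∂μ
      ≤ ENNReal.ofReal (∑' l, a l ^ 2 - ∑ l ∈ Finset.range n, a l ^ 2) := by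
    have hlim (x : α) : Tendsto (fun m => ENNReal.ofReal ((S m x - S n x) ^ 2)) atTop
        (𝓝 (ENNReal.ofReal ((F x - S n x) ^ 2))) :=
      ENNReal.tendsto_ofReal (((hF x).tendsto_sum_nat.sub_const _).pow 2)
    calc _ = ∫⁻ x, liminf (fun m => ENNReal.ofReal ((S m x - S n x) ^ 2)) atTop ∂μ :=
          lintegral_congr fun x => (hlim x).liminf_eq.symm
      _ ≤ liminf (fun m => ∫⁻ x, ENNReal.ofReal ((S m x - S n x) ^ 2) ∂μ) atTop :=
          lintegral_liminf_le' fun m =>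
            ((hSm m).fun_sub_two
              (hSm n)).integrable_sq.aestronglyMeasurable.aemeasurable.ennreal_ofReal
      _ ≤ _ := by
          refine liminf_le_of_frequently_le' (Eventually.frequently ?_)
          filter_upwards [eventually_ge_atTop n] with m hm
          rw [← ofReal_integral_eq_lintegral_ofReal ((hSm m).fun_sub_two (hSm n)).integrable_sq
            (ae_of_all _ fun x => sq_nonneg _)]
          refine ENNReal.ofReal_le_ofReal ((hdiff hm).trans_le ?_)
          exact sub_le_sub_right (ha.sum_le_tsum _ fun l _ => sq_nonneg _) _
  have hrm (n : ℕ) : MemLp (fun x => F x - S n x) 2 μ := by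
    have hm := hFm.sub (hSm n).aestronglyMeasurable
    refine (memLp_two_iff_integrable_sq hm).2 ⟨hm.pow 2, ?_⟩
    rw [hasFiniteIntegral_iff_ofReal (ae_of_all _ fun x => sq_nonneg _)]
    exact (hfatou n).trans_lt ENNReal.ofReal_lt_top
  have hF2 : MemLp F 2 μ := by
    have := hrm 0
    simpa [hS] using this
  refine ⟨hF2, fun h hh => he.hasSum_of_tendsto hF2 ha ?_ hh⟩
  refine squeeze_zero (fun n => integral_nonneg fun x => sq_nonneg _) (fun n => ?_)
    (g := fun n => ∑' l, a l ^ 2 - ∑ l ∈ Finset.range n, a l ^ 2) ?_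
  · have h0 : 0 ≤ ∑' l, a l ^ 2 - ∑ l ∈ Finset.range n, a l ^ 2 :=
      sub_nonneg.2 (ha.sum_le_tsum _ fun l _ => sq_nonneg _)
    rw [← ENNReal.ofReal_le_ofReal_iff h0, ofReal_integral_eq_lintegral_ofReal
      (hrm n).integrable_sq (ae_of_all _ fun x => sq_nonneg _)]
    exact hfatou n
  · have := ha.hasSum.tendsto_sum_nat.const_sub (∑' l, a l ^ 2)
    rwa [sub_self] at this

end IsOrthonormalSystem

end SquareIntegrable

/-! ### Mercer kernels and their eigenfunctions -/

lemma IsMercerKernel.exists_bound {X : Type*} [TopologicalSpace X] [CompactSpace X] {K : X → X → ℝ}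
    (hK : IsMercerKernel K) : ∃ C, ∀ x y, |K x y| ≤ C := by
  obtain ⟨C, hC⟩ := isCompact_univ.exists_bound_of_continuousOn hK.1.continuousOn
  exact ⟨C, fun x y => hC (x, y) (Set.mem_univ _)⟩

lemma IsMercerKernel.continuous_diag {X : Type*} [TopologicalSpace X] {K : X → X → ℝ}
    (hK : IsMercerKernel K) : Continuous fun x => K x x :=
  hK.1.comp (continuous_id.prodMk continuous_id)

section Expansion

variable {X : Type*} [MeasurableSpace X]
  {P : Measure X} {K : X → X → ℝ} {lam : ℕ → ℝ} {φ : ℕ → X → ℝ}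

lemma IsMercerDecomposition.isOrthonormalSystem (hdec : IsMercerDecomposition P K lam φ) :
    IsOrthonormalSystem P φ :=
  ⟨hdec.memLp, hdec.orthonormal⟩

lemma IsMercerDecomposition.hasSum_diag (hdec : IsMercerDecomposition P K lam φ) (x : X) :
    HasSum (fun l => lam l * φ l x ^ 2) (K x x) := by
  simpa [sq, mul_assoc] using hdec.hasSum x x

lemma IsMercerDecomposition.summable_mul_sq (hdec : IsMercerDecomposition P K lam φ) {w : ℕ → ℝ}
    {B : ℝ} (hw0 : ∀ l, 0 ≤ w l) (hw : ∀ l, w l ≤ B * lam l) (x : X) :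
    Summable fun l => w l * φ l x ^ 2 := by
  refine Summable.of_nonneg_of_le (fun l => mul_nonneg (hw0 l) (sq_nonneg _)) (fun l => ?_)
    ((hdec.hasSum_diag x).summable.mul_left B)
  rw [← mul_assoc]
  exact mul_le_mul_of_nonneg_right (hw l) (sq_nonneg _)

lemma IsMercerDecomposition.summable_sq_mul (hdec : IsMercerDecomposition P K lam φ) {w : ℕ → ℝ}
    {B : ℝ} (hw0 : ∀ l, 0 ≤ w l) (hw : ∀ l, w l ≤ B * lam l) (x : X) :
    Summable fun l => (w l * φ l x) ^ 2 := by
  have hB : 0 ≤ B := nonneg_of_mul_nonneg_left ((hw0 0).trans (hw 0)) (hdec.pos 0)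
  refine Summable.of_nonneg_of_le (fun l => sq_nonneg _) (fun l => ?_)
    ((hdec.summable_mul_sq hw0 hw x).mul_left (B * lam 0))
  have h1 : w l ≤ B * lam 0 :=
    (hw l).trans (mul_le_mul_of_nonneg_left (hdec.antitone (Nat.zero_le l)) hB)
  have h2 : 0 ≤ w l * φ l x ^ 2 := mul_nonneg (hw0 l) (sq_nonneg _)
  calc (w l * φ l x) ^ 2 = w l * (w l * φ l x ^ 2) := by ring
    _ ≤ _ := mul_le_mul_of_nonneg_right h1 h2

/-- A kernel with a pointwise expansion in `φ` acts on `L²` through this expansion, at every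
point. -/
lemma IsMercerDecomposition.memLp_and_hasSum_kernel (hdec : IsMercerDecomposition P K lam φ)
    {w : ℕ → ℝ} {B : ℝ} (hw0 : ∀ l, 0 ≤ w l) (hw : ∀ l, w l ≤ B * lam l) {K' : X → X → ℝ}
    (hK' : ∀ x y, HasSum (fun l => w l * φ l x * φ l y) (K' x y)) (x : X) :
    MemLp (K' x) 2 P ∧ ∀ h : X → ℝ, MemLp h 2 P →
      HasSum (fun l => w l * φ l x * ∫ y, h y * φ l y ∂P) (∫ y, h y * K' x y ∂P) :=
  hdec.isOrthonormalSystem.memLp_and_hasSum_of_hasSum (hdec.summable_sq_mul hw0 hw x) (hK' x)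

lemma IsMercerDecomposition.integral_kernel_mul (hdec : IsMercerDecomposition P K lam φ)
    {w : ℕ → ℝ} {B : ℝ} (hw0 : ∀ l, 0 ≤ w l) (hw : ∀ l, w l ≤ B * lam l) {K' : X → X → ℝ}
    (hK' : ∀ x y, HasSum (fun l => w l * φ l x * φ l y) (K' x y)) (i : ℕ) (x : X) :
    ∫ y, K' x y * φ i y ∂P = w i * φ i x := by
  have h := (hdec.memLp_and_hasSum_kernel hw0 hw hK' x).2 (φ i) (hdec.memLp i)
  simp only [hdec.orthonormal] at h
  have h2 : HasSum (fun l => w l * φ l x * if i = l then 1 else 0) (w i * φ i x) := by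
    have := hasSum_ite_eq i (w i * φ i x)
    convert this using 2 with l
    by_cases hl : l = i
    · simp [hl]
    · simp [hl, Ne.symm hl]
  simp only [mul_comm (K' x _)]
  exact h.unique h2

lemma IsMercerDecomposition.memLp_kernel (hdec : IsMercerDecomposition P K lam φ) (x : X) :
    MemLp (K x) 2 P :=
  (hdec.memLp_and_hasSum_kernel (B := 1) (fun l => (hdec.pos l).le) (by simp) hdec.hasSum x).1

lemma IsMercerDecomposition.hasSum_kernel (hdec : IsMercerDecomposition P K lam φ) (x : X)
    {h : X → ℝ} (hh : MemLp h 2 P) :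
    HasSum (fun l => lam l * φ l x * ∫ y, h y * φ l y ∂P) (∫ y, h y * K x y ∂P) :=
  (hdec.memLp_and_hasSum_kernel (B := 1) (fun l => (hdec.pos l).le) (by simp) hdec.hasSum x).2 h hh

lemma IsMercerDecomposition.integral_kernel_mul_eigenfunction
    (hdec : IsMercerDecomposition P K lam φ) (i : ℕ) (x : X) :
    ∫ y, K x y * φ i y ∂P = lam i * φ i x :=
  hdec.integral_kernel_mul (B := 1) (fun l => (hdec.pos l).le) (by simp) hdec.hasSum i x

/-- The integral operator of `K`, as a quadratic form in Fourier coefficients. -/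
lemma IsMercerDecomposition.hasSum_integral_kernel (hdec : IsMercerDecomposition P K lam φ)
    {h h' : X → ℝ} (hh : MemLp h 2 P) (hh' : MemLp h' 2 P) :
    MemLp (fun x => ∫ y, h y * K x y ∂P) 2 P ∧
      HasSum (fun l => lam l * (∫ y, h y * φ l y ∂P) * ∫ x, h' x * φ l x ∂P)
      (∫ x, h' x * ∫ y, h y * K x y ∂P ∂P) := by
  have hs : Summable fun l => (lam l * ∫ y, h y * φ l y ∂P) ^ 2 := by
    refine Summable.of_nonneg_of_le (fun l => sq_nonneg _) (fun l => ?_)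
      ((hdec.isOrthonormalSystem.summable_sq hh).mul_left (lam 0 ^ 2))
    rw [mul_pow]
    exact mul_le_mul_of_nonneg_right
      (pow_le_pow_left₀ (hdec.pos l).le (hdec.antitone (Nat.zero_le l)) 2) (sq_nonneg _)
  have := hdec.isOrthonormalSystem.memLp_and_hasSum_of_hasSum hs
    (F := fun x => ∫ y, h y * K x y ∂P) fun x => by
      convert hdec.hasSum_kernel x hh using 2 with l
      ring
  exact ⟨this.1, this.2 h' hh'⟩

end Expansion

section Kernel

open Filter Topology

variable {X : Type*} [MetricSpace X] [CompactSpace X] [MeasurableSpace X] [BorelSpace X]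
  {P : Measure X} [IsProbabilityMeasure P] {K : X → X → ℝ} {lam : ℕ → ℝ} {φ : ℕ → X → ℝ}

lemma IsMercerDecomposition.hasSum_eigenvalues (hdec : IsMercerDecomposition P K lam φ)
    (hK : IsMercerKernel K) : HasSum lam (∫ x, K x x ∂P) := by
  have hint : Integrable (fun x => K x x) P := by
    obtain ⟨C, hC⟩ := hK.exists_bound
    exact Integrable.of_bound hK.continuous_diag.aestronglyMeasurable C
      (ae_of_all _ fun x => hC x x)
  have hi (l : ℕ) : Integrable (fun x => lam l * φ l x ^ 2) P :=
    (hdec.memLp l).integrable_sq.const_mul _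
  have heq (l : ℕ) : ∫ x, lam l * φ l x ^ 2 ∂P = lam l := by
    rw [integral_const_mul]
    have := hdec.orthonormal l l
    simp only [← sq, if_true] at this
    rw [this, mul_one]
  have hs : Summable lam := by
    refine summable_of_sum_range_le (c := ∫ x, K x x ∂P) (fun l => (hdec.pos l).le) fun n => ?_
    rw [← Finset.sum_congr rfl fun l _ => heq l, ← integral_finsetSum _ fun l _ => hi l]
    exact integral_mono (integrable_finsetSum _ fun l _ => hi l) hint fun x =>
      sum_le_hasSum _ (fun l _ => mul_nonneg (hdec.pos l).le (sq_nonneg _)) (hdec.hasSum_diag x)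
  have h := hasSum_integral_of_summable_integral_norm hi (by
    refine hs.congr fun l => ?_
    refine (heq l).symm.trans ?_
    congr 1 with x
    rw [Real.norm_eq_abs, abs_of_nonneg (mul_nonneg (hdec.pos l).le (sq_nonneg _))])
  simp only [heq] at h
  rwa [integral_congr_ae (ae_of_all _ fun x => (hdec.hasSum_diag x).tsum_eq)] at h

end Kernel

/-! ### Linear functionals of a Gaussian field -/

section Functionals

variable {X : Type*} [MeasurableSpace X] {P : Measure X} {K : X → X → ℝ}
  {Ω : Type*} [MeasurableSpace Ω] {Q : Measure Ω} {f : Ω → X → ℝ}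

/-- The random variable `⟨f, h⟩` in `L₂(X,P)`. -/
noncomputable def pairing (P : Measure X) (f : Ω → X → ℝ) (h : X → ℝ) (ω : Ω) : ℝ :=
  ∫ x, f ω x * h x ∂P

namespace IsCenteredGaussianField

variable [SFinite P]

lemma memLp_eval (hf : IsCenteredGaussianField Q K f) (x : X) : MemLp (fun ω => f ω x) 2 Q :=
  (hf.gaussian.hasGaussianLaw_eval x).memLp_two

lemma integral_mul (hf : IsCenteredGaussianField Q K f) (x y : X) :
    ∫ ω, f ω x * f ω y ∂Q = K x y := by
  have := hf.gaussian.isProbabilityMeasure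
  have h := covariance_eq_sub (hf.memLp_eval x) (hf.memLp_eval y)
  rw [hf.covariance, hf.centered x, zero_mul, sub_zero] at h
  exact h.symm

lemma measurable_eval (hf : IsCenteredGaussianField Q K f) (x : X) : Measurable fun ω => f ω x :=
  hf.measurable.comp (measurable_id.prodMk measurable_const)

lemma measurable_path (hf : IsCenteredGaussianField Q K f) (ω : Ω) : Measurable (f ω) :=
  hf.measurable.comp (measurable_const.prodMk measurable_id)

lemma measurable_pairing (hf : IsCenteredGaussianField Q K f) {h : X → ℝ}
    (hh : AEStronglyMeasurable h P) : Measurable (pairing P f h) := by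
  have h1 : pairing P f h = fun ω => ∫ x, f ω x * hh.mk h x ∂P := by
    ext ω
    refine integral_congr_ae ?_
    filter_upwards [hh.ae_eq_mk] with x hx
    rw [hx]
  rw [h1]
  exact (StronglyMeasurable.integral_prod_right (hf.measurable.mul
    (hh.stronglyMeasurable_mk.measurable.comp measurable_snd)).stronglyMeasurable).measurable

lemma integral_exp_of_hasGaussianLaw {Y : Ω → ℝ} (hY : HasGaussianLaw Y Q)
    (h0 : ∫ ω, Y ω ∂Q = 0) :
    ∫ ω, Complex.exp (Y ω * Complex.I) ∂Q = Complex.exp (-((∫ ω, Y ω ^ 2 ∂Q : ℝ) / 2 : ℂ)) := by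
  have := hY.isProbabilityMeasure
  have hvar : Var[Y; Q] = ∫ ω, Y ω ^ 2 ∂Q := variance_of_integral_eq_zero hY.aemeasurable h0
  have h1 : charFun (Q.map Y) 1 = ∫ ω, Complex.exp (Y ω * Complex.I) ∂Q := by
    rw [charFun_apply_real, integral_map hY.aemeasurable (by fun_prop)]
    simp
  rw [← h1, hY.map_eq_gaussianReal, charFun_gaussianReal, h0, hvar,
    Real.coe_toNNReal _ (integral_nonneg fun ω => sq_nonneg _)]
  simp

end IsCenteredGaussianField

end Functionals

section Field

open Filter Topology

variable {X : Type*} [MetricSpace X] [CompactSpace X] [MeasurableSpace X] [BorelSpace X]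
  {P : Measure X} [IsProbabilityMeasure P] {K : X → X → ℝ}
  {Ω : Type*} [MeasurableSpace Ω] {Q : Measure Ω} [IsProbabilityMeasure Q] {f : Ω → X → ℝ}

namespace IsCenteredGaussianField

lemma memLp_prod (hf : IsCenteredGaussianField Q K f) (hK : IsMercerKernel K) :
    MemLp (fun z : Ω × X => f z.1 z.2) 2 (Q.prod P) := by
  rw [memLp_two_iff_integrable_sq hf.measurable.aestronglyMeasurable,
    integrable_prod_iff' (hf.measurable.pow_const 2).aestronglyMeasurable]
  refine ⟨ae_of_all _ fun x => (hf.memLp_eval x).integrable_sq, ?_⟩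
  obtain ⟨C, hC⟩ := hK.exists_bound
  have : (fun x => ∫ ω, ‖f ω x ^ 2‖ ∂Q) = fun x => K x x := by
    ext x
    rw [← hf.integral_mul x x]
    congr 1 with ω
    rw [Real.norm_eq_abs, abs_of_nonneg (sq_nonneg _), sq]
  rw [this]
  exact Integrable.of_bound hK.continuous_diag.aestronglyMeasurable C
    (ae_of_all _ fun x => hC x x)

lemma ae_memLp_path (hf : IsCenteredGaussianField Q K f) (hK : IsMercerKernel K) :
    ∀ᵐ ω ∂Q, MemLp (f ω) 2 P := by
  have h := (hf.memLp_prod (P := P) hK).integrable_sq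
  filter_upwards [h.prod_right_ae] with ω hω
  exact (memLp_two_iff_integrable_sq (hf.measurable_path ω).aestronglyMeasurable).2 hω

lemma memLp_pairing (hf : IsCenteredGaussianField Q K f) (hK : IsMercerKernel K) {h : X → ℝ}
    (hh : MemLp h 2 P) : MemLp (pairing P f h) 2 Q := by
  have hm := hf.measurable_pairing hh.aestronglyMeasurable
  rw [memLp_two_iff_integrable_sq hm.aestronglyMeasurable]
  have hint := (hf.memLp_prod (P := P) hK).integrable_sq.integral_prod_left
  refine (hint.mul_const (∫ x, h x ^ 2 ∂P)).mono' (hm.pow_const 2).aestronglyMeasurable ?_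
  filter_upwards [hf.ae_memLp_path (P := P) hK] with ω hω
  rw [Real.norm_eq_abs, abs_of_nonneg (sq_nonneg _)]
  exact sq_integral_mul_le hω hh

/-- Fubini's theorem for the pairing of the field with a function on `X`. -/
lemma integral_mul_pairing (hf : IsCenteredGaussianField Q K f) (hK : IsMercerKernel K) {h : X → ℝ}
    (hh : MemLp h 2 P) {Y : Ω → ℝ} (hY : MemLp Y 2 Q) :
    ∫ ω, Y ω * pairing P f h ω ∂Q = ∫ x, h x * ∫ ω, Y ω * f ω x ∂Q ∂P := by
  have hYh : MemLp (fun z : Ω × X => Y z.1 * h z.2) 2 (Q.prod P) := by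
    have hm : AEStronglyMeasurable (fun z : Ω × X => Y z.1 * h z.2) (Q.prod P) :=
      hY.aestronglyMeasurable.comp_fst.mul hh.aestronglyMeasurable.comp_snd
    rw [memLp_two_iff_integrable_sq hm]
    simp only [mul_pow]
    exact hY.integrable_sq.mul_prod hh.integrable_sq
  have hint : Integrable (fun z : Ω × X => Y z.1 * h z.2 * f z.1 z.2) (Q.prod P) :=
    hYh.integrable_mul_of_two (hf.memLp_prod hK)
  have h1 := integral_integral_swap (f := fun ω x => Y ω * h x * f ω x) hint
  calc ∫ ω, Y ω * pairing P f h ω ∂Q = ∫ ω, ∫ x, Y ω * h x * f ω x ∂P ∂Q := by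
        congr 1 with ω
        rw [pairing, ← integral_const_mul]
        congr 1 with x
        ring
    _ = ∫ x, ∫ ω, Y ω * h x * f ω x ∂Q ∂P := h1
    _ = _ := by
        congr 1 with x
        rw [← integral_const_mul]
        congr 1 with ω
        ring

lemma integral_eval_mul_pairing (hf : IsCenteredGaussianField Q K f) (hK : IsMercerKernel K)
    {h : X → ℝ} (hh : MemLp h 2 P) (x : X) :
    ∫ ω, f ω x * pairing P f h ω ∂Q = ∫ y, h y * K x y ∂P := by
  rw [hf.integral_mul_pairing hK hh (hf.memLp_eval x)]
  simp only [hf.integral_mul]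

lemma integral_pairing_mul_pairing (hf : IsCenteredGaussianField Q K f) (hK : IsMercerKernel K)
    {h h' : X → ℝ} (hh : MemLp h 2 P) (hh' : MemLp h' 2 P) :
    ∫ ω, pairing P f h ω * pairing P f h' ω ∂Q = ∫ x, h' x * ∫ y, h y * K x y ∂P ∂P := by
  rw [hf.integral_mul_pairing hK hh' (hf.memLp_pairing hK hh)]
  congr 1 with x
  rw [← hf.integral_eval_mul_pairing hK hh]
  simp only [mul_comm]

/-- The pairing of a Gaussian field that has a continuous covariance with a square integrable
function is Gaussian: it is the limit in `L²` of the pairings of the field with its argument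
discretized, which are finite linear combinations of values of the field. -/
lemma integral_exp_pairing (hf : IsCenteredGaussianField Q K f) (hK : IsMercerKernel K) {h : X → ℝ}
    (hh : MemLp h 2 P) :
    ∫ ω, Complex.exp (pairing P f h ω * Complex.I) ∂Q
      = Complex.exp (-((∫ ω, pairing P f h ω ^ 2 ∂Q : ℝ) / 2 : ℂ)) := by
  obtain ⟨x₀⟩ : Nonempty X := P.nonempty_of_neZero
  -- simple functions from `X` to `X` that converge to the identity discretize the argument
  set s : ℕ → SimpleFunc X X := fun n =>
    SimpleFunc.approxOn id measurable_id Set.univ x₀ (Set.mem_univ _) n with hs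
  have hslim (x : X) : Tendsto (fun n => s n x) atTop (𝓝 x) :=
    SimpleFunc.tendsto_approxOn measurable_id (Set.mem_univ x₀) (by simp)
  have hfs (n : ℕ) : Measurable fun z : Ω × X => f z.1 (s n z.2) :=
    hf.measurable.comp (measurable_fst.prodMk ((s n).measurable.comp measurable_snd))
  set Y : ℕ → Ω → ℝ := fun n => pairing P (fun ω x => f ω (s n x)) h with hY
  have hi : Integrable h P := hh.integrable (by norm_num)
  have hYsum (n : ℕ) (ω : Ω) : Y n ω =
      ∑ y ∈ (s n).range, (∫ x, (s n ⁻¹' {y}).indicator h x ∂P) * f ω y := by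
    have h1 (x : X) : f ω (s n x) * h x =
        ∑ y ∈ (s n).range, (s n ⁻¹' {y}).indicator h x * f ω y := by
      rw [Finset.sum_eq_single (s n x)]
      · rw [Set.indicator_of_mem (by simp), mul_comm]
      · intro y _ hy
        rw [Set.indicator_of_notMem (by simpa using hy.symm), zero_mul]
      · intro hx
        exact absurd (SimpleFunc.mem_range_self _ _) hx
    simp only [hY, pairing, h1]
    rw [integral_finsetSum _ fun y _ =>
      (hi.indicator ((s n).measurableSet_preimage {y})).mul_const _]
    exact Finset.sum_congr rfl fun y _ => integral_mul_const _ _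
  have hYg (n : ℕ) : HasGaussianLaw (Y n) Q := by
    have h1 := (hf.gaussian.smul fun y => ∫ x, (s n ⁻¹' {y}).indicator h x ∂P)
    have h2 := h1.hasGaussianLaw_fun_sum (I := (s n).range)
    refine h2.congr (ae_of_all _ fun ω => ?_)
    simp [hYsum]
  have hY0 (n : ℕ) : ∫ ω, Y n ω ∂Q = 0 := by
    simp only [hYsum]
    rw [integral_finsetSum _ fun y _ =>
      ((hf.memLp_eval y).integrable (by norm_num)).const_mul _]
    simp [integral_const_mul, hf.centered]
  have hYm (n : ℕ) : MemLp (Y n) 2 Q := (hYg n).memLp_two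
  have hZm := hf.memLp_pairing hK hh
  have hsq (n : ℕ) (x : X) : ∫ ω, (f ω x - f ω (s n x)) ^ 2 ∂Q
      = K x x - 2 * K x (s n x) + K (s n x) (s n x) := by
    rw [← hf.integral_mul, ← hf.integral_mul, ← hf.integral_mul, ← integral_const_mul,
      ← integral_sub, ← integral_add]
    · congr 1 with ω
      ring
    · exact ((hf.memLp_eval x).integrable_mul_of_two (hf.memLp_eval x)).sub
        (((hf.memLp_eval x).integrable_mul_of_two (hf.memLp_eval (s n x))).const_mul 2)
    · exact (hf.memLp_eval _).integrable_mul_of_two (hf.memLp_eval _)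
    · exact (hf.memLp_eval _).integrable_mul_of_two (hf.memLp_eval _)
    · exact ((hf.memLp_eval _).integrable_mul_of_two (hf.memLp_eval _)).const_mul 2
  obtain ⟨C, hC⟩ := hK.exists_bound
  have hKm (n : ℕ) : Measurable fun x => K x x - 2 * K x (s n x) + K (s n x) (s n x) := by
    have hKmeas : Measurable fun p : X × X => K p.1 p.2 := hK.1.measurable
    have h1 := hKmeas.comp (measurable_id.prodMk measurable_id)
    have h2 := hKmeas.comp (measurable_id.prodMk (s n).measurable)
    have h3 := hKmeas.comp ((s n).measurable.prodMk (s n).measurable)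
    exact (h1.sub (h2.const_mul 2)).add h3
  have hKb (n : ℕ) (x : X) : |K x x - 2 * K x (s n x) + K (s n x) (s n x)| ≤ 4 * C := by
    have h1 := abs_le.1 (hC x x)
    have h2 := abs_le.1 (hC x (s n x))
    have h3 := abs_le.1 (hC (s n x) (s n x))
    rw [abs_le]
    constructor <;> linarith
  have hKlim : Tendsto (fun n => ∫ x, (K x x - 2 * K x (s n x) + K (s n x) (s n x)) ∂P) atTop
      (𝓝 0) := by
    have h0 : ∫ _ : X, (0 : ℝ) ∂P = 0 := by simp
    rw [← h0]
    refine tendsto_integral_of_dominated_convergence (fun _ => 4 * C)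
      (fun n => (hKm n).aestronglyMeasurable) (integrable_const _)
      (fun n => ae_of_all _ (hKb n)) (ae_of_all _ fun x => ?_)
    have hc2 := (hK.1.tendsto (x, x)).comp ((tendsto_const_nhds (x := x)).prodMk_nhds (hslim x))
    have hc3 := (hK.1.tendsto (x, x)).comp ((hslim x).prodMk_nhds (hslim x))
    have := ((hc2.const_mul 2).const_sub (K x x)).add hc3
    have h2 : K x x - 2 * K x x + K x x = 0 := by ring
    rw [← h2]
    exact this
  have hdiffm (n : ℕ) : MemLp (fun z : Ω × X => f z.1 z.2 - f z.1 (s n z.2)) 2 (Q.prod P) := by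
    have hm : Measurable fun z : Ω × X => f z.1 z.2 - f z.1 (s n z.2) := hf.measurable.sub (hfs n)
    rw [memLp_two_iff_integrable_sq hm.aestronglyMeasurable,
      integrable_prod_iff' (hm.pow_const 2).aestronglyMeasurable]
    refine ⟨ae_of_all _ fun x =>
      ((hf.memLp_eval x).fun_sub_two (hf.memLp_eval (s n x))).integrable_sq, ?_⟩
    have : (fun x => ∫ ω, ‖(f ω x - f ω (s n x)) ^ 2‖ ∂Q)
        = fun x => K x x - 2 * K x (s n x) + K (s n x) (s n x) := by
      ext x
      rw [← hsq]
      congr 1 with ω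
      rw [Real.norm_eq_abs, abs_of_nonneg (sq_nonneg _)]
    rw [this]
    exact Integrable.of_bound (hKm n).aestronglyMeasurable _ (ae_of_all _ (hKb n))
  have hL2 (n : ℕ) : ∫ ω, (pairing P f h ω - Y n ω) ^ 2 ∂Q ≤
      (∫ x, (K x x - 2 * K x (s n x) + K (s n x) (s n x)) ∂P) * ∫ x, h x ^ 2 ∂P := by
    have hint := (hdiffm n).integrable_sq
    have h2 : ∫ ω, ∫ x, (f ω x - f ω (s n x)) ^ 2 ∂P ∂Q
        = ∫ x, (K x x - 2 * K x (s n x) + K (s n x) (s n x)) ∂P := by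
      rw [integral_integral_swap hint]
      simp only [hsq]
    rw [← h2, ← integral_mul_const]
    refine integral_mono_ae ((hZm.fun_sub_two (hYm n)).integrable_sq)
      (hint.integral_prod_left.mul_const _) ?_
    filter_upwards [hf.ae_memLp_path (P := P) hK, hint.prod_right_ae] with ω hω hω2
    have hd : MemLp (fun x => f ω x - f ω (s n x)) 2 P :=
      (memLp_two_iff_integrable_sq ((hf.measurable_path ω).sub
        ((hf.measurable_path ω).comp (s n).measurable)).aestronglyMeasurable).2 hω2
    have h3 : pairing P f h ω - Y n ω = ∫ x, (f ω x - f ω (s n x)) * h x ∂P := by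
      have hω3 : MemLp (fun x => f ω (s n x)) 2 P := by
        have := hω.fun_sub_two hd
        simpa using this
      simp only [hY, pairing]
      rw [← integral_sub (hω.integrable_mul_of_two hh) (hω3.integrable_mul_of_two hh)]
      congr 1 with x
      ring
    simp only [h3]
    exact sq_integral_mul_le hd hh
  have hlim0 : Tendsto (fun n => ∫ ω, (pairing P f h ω - Y n ω) ^ 2 ∂Q) atTop (𝓝 0) := by
    refine squeeze_zero (fun n => integral_nonneg fun ω => sq_nonneg _) hL2 ?_
    simpa using hKlim.mul_const (∫ x, h x ^ 2 ∂P)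
  have hlim2 := tendsto_integral_sq_of_tendsto_sq hYm hZm hlim0
  have hrhs : Tendsto (fun n => Complex.exp (-((∫ ω, Y n ω ^ 2 ∂Q : ℝ) / 2 : ℂ))) atTop
      (𝓝 (Complex.exp (-((∫ ω, pairing P f h ω ^ 2 ∂Q : ℝ) / 2 : ℂ)))) :=
    ((Complex.continuous_exp.comp ((Complex.continuous_ofReal.div_const 2).neg)).tendsto _).comp
      hlim2
  simp only [← integral_exp_of_hasGaussianLaw (hYg _) (hY0 _)] at hrhs
  refine tendsto_nhds_unique ?_ hrhs
  have hexpi {Z : Ω → ℝ} (hZ : AEStronglyMeasurable Z Q) :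
      Integrable (fun ω => Complex.exp (Z ω * Complex.I)) Q := by
    refine Integrable.of_bound (C := 1) ?_ (ae_of_all _ fun ω => ?_)
    · exact (Complex.continuous_exp.comp
        (Complex.continuous_ofReal.mul continuous_const)).comp_aestronglyMeasurable hZ
    · rw [Complex.norm_exp_ofReal_mul_I]
  rw [tendsto_iff_norm_sub_tendsto_zero]
  -- `x ↦ exp (i x)` is 1-Lipschitz, and the mean distance is at most the distance in `L²`
  have habs (n : ℕ) : ‖∫ ω, Complex.exp (Y n ω * Complex.I) ∂Q -
      ∫ ω, Complex.exp (pairing P f h ω * Complex.I) ∂Q‖ ≤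
        √(∫ ω, (pairing P f h ω - Y n ω) ^ 2 ∂Q) := by
    have hd := hZm.fun_sub_two (hYm n)
    rw [← integral_sub (hexpi (hYm n).aestronglyMeasurable) (hexpi hZm.aestronglyMeasurable)]
    calc _ ≤ ∫ ω, |pairing P f h ω - Y n ω| * 1 ∂Q := by
          refine norm_integral_le_of_norm_le ?_ (ae_of_all _ fun ω => ?_)
          · simpa using (hd.integrable (by norm_num)).abs
          · have h1 : Complex.exp (Y n ω * Complex.I) - Complex.exp (pairing P f h ω * Complex.I)
                = -(Complex.exp (Y n ω * Complex.I) *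
                  (Complex.exp (Complex.I * (pairing P f h ω - Y n ω : ℝ)) - 1)) := by
              rw [mul_sub, ← Complex.exp_add]
              push_cast
              ring_nf
            rw [h1, norm_neg, norm_mul, Complex.norm_exp_ofReal_mul_I, one_mul, mul_one]
            exact Real.norm_exp_I_mul_ofReal_sub_one_le
      _ ≤ _ := by
          refine Real.le_sqrt_of_sq_le ?_
          have := sq_integral_mul_le (u := fun ω => |pairing P f h ω - Y n ω|) (v := fun _ => 1)
            hd.norm (memLp_const 1)
          simpa using this
  refine squeeze_zero (fun n => norm_nonneg _) habs ?_
  simpa using hlim0.sqrt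

end IsCenteredGaussianField

end Field

/-! ### The Karhunen–Loève expansion -/

section KLCoefficients

variable {X : Type*} [MeasurableSpace X] {P : Measure X} {K : X → X → ℝ} {lam : ℕ → ℝ}
  {φ : ℕ → X → ℝ} {Ω : Type*} [MeasurableSpace Ω] {Q : Measure Ω} {f : Ω → X → ℝ}

/-- The Karhunen–Loève coefficients of the field, as random variables. -/
noncomputable def klVar (P : Measure X) (lam : ℕ → ℝ) (φ : ℕ → X → ℝ) (f : Ω → X → ℝ) (l : ℕ)
    (ω : Ω) : ℝ :=
  (√(lam l))⁻¹ * pairing P f (φ l) ω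

lemma IsCenteredGaussianField.measurable_klVar [SFinite P] (hf : IsCenteredGaussianField Q K f)
    (hdec : IsMercerDecomposition P K lam φ) (l : ℕ) : Measurable (klVar P lam φ f l) :=
  (hf.measurable_pairing (hdec.memLp l).aestronglyMeasurable).const_mul _

end KLCoefficients

section KarhunenLoeve

open Filter Topology

variable {X : Type*} [MetricSpace X] [CompactSpace X] [MeasurableSpace X] [BorelSpace X]
  {P : Measure X} [IsProbabilityMeasure P] {K : X → X → ℝ} {lam : ℕ → ℝ} {φ : ℕ → X → ℝ}
  {Ω : Type*} [MeasurableSpace Ω] {Q : Measure Ω} [IsProbabilityMeasure Q] {f : Ω → X → ℝ}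

namespace IsCenteredGaussianField

variable (hf : IsCenteredGaussianField Q K f) (hK : IsMercerKernel K)
  (hdec : IsMercerDecomposition P K lam φ)

include hf hK hdec

lemma integral_pairing_mul_klVar {h : X → ℝ} (hh : MemLp h 2 P) (l : ℕ) :
    ∫ ω, pairing P f h ω * klVar P lam φ f l ω ∂Q = √(lam l) * ∫ x, h x * φ l x ∂P := by
  have h1 : ∀ ω, pairing P f h ω * klVar P lam φ f l ω
      = (√(lam l))⁻¹ * (pairing P f (φ l) ω * pairing P f h ω) := fun ω => by
    rw [klVar]; ring
  simp only [h1]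
  rw [integral_const_mul, hf.integral_pairing_mul_pairing hK (hdec.memLp l) hh]
  have h2 : ∀ x, ∫ y, φ l y * K x y ∂P = lam l * φ l x := fun x => by
    rw [← hdec.integral_kernel_mul_eigenfunction l x]
    simp only [mul_comm]
  simp only [h2]
  have h3 : ∀ x, h x * (lam l * φ l x) = lam l * (h x * φ l x) := fun x => by ring
  simp only [h3]
  rw [integral_const_mul, ← mul_assoc, inv_mul_eq_div, Real.div_sqrt]

lemma integral_eval_mul_klVar (x : X) (l : ℕ) :
    ∫ ω, f ω x * klVar P lam φ f l ω ∂Q = √(lam l) * φ l x := by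
  have h1 : ∀ ω, f ω x * klVar P lam φ f l ω = (√(lam l))⁻¹ * (f ω x * pairing P f (φ l) ω) :=
    fun ω => by rw [klVar]; ring
  simp only [h1]
  rw [integral_const_mul, hf.integral_eval_mul_pairing hK (hdec.memLp l)]
  have h2 : ∫ y, φ l y * K x y ∂P = lam l * φ l x := by
    rw [← hdec.integral_kernel_mul_eigenfunction l x]
    simp only [mul_comm]
  rw [h2, ← mul_assoc, inv_mul_eq_div, Real.div_sqrt]

lemma isOrthonormalSystem_klVar : IsOrthonormalSystem Q (klVar P lam φ f) := by
  refine ⟨fun l => (hf.memLp_pairing hK (hdec.memLp l)).const_mul _, fun i j => ?_⟩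
  have h1 : ∀ ω, klVar P lam φ f i ω * klVar P lam φ f j ω
      = (√(lam i))⁻¹ * (pairing P f (φ i) ω * klVar P lam φ f j ω) := fun ω => by
    rw [klVar]; ring
  simp only [h1]
  rw [integral_const_mul, hf.integral_pairing_mul_klVar hK hdec (hdec.memLp i), hdec.orthonormal]
  split_ifs with h
  · subst h
    rw [mul_one, inv_mul_cancel₀ (Real.sqrt_ne_zero'.2 (hdec.pos i))]
  · simp

/-- The field at a point is the `L²` sum of its Karhunen–Loève expansion. -/
lemma tendsto_eval_sub_sum (x : X) :
    Tendsto (fun n => ∫ ω, (f ω x - ∑ l ∈ Finset.range n,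
      (√(lam l) * φ l x) * klVar P lam φ f l ω) ^ 2 ∂Q) atTop (𝓝 0) := by
  refine (hf.isOrthonormalSystem_klVar hK hdec).tendsto_integral_sub_sum_sq (hf.memLp_eval x)
    (hf.integral_eval_mul_klVar hK hdec x) ?_
  simp only [mul_pow, Real.sq_sqrt (hdec.pos _).le]
  have := hdec.hasSum_diag x
  rw [← hf.integral_mul x x] at this
  simpa only [← sq] using this

/-- A linear functional of the field is the `L²` sum of its Karhunen–Loève expansion. -/
lemma tendsto_pairing_sub_sum {h : X → ℝ} (hh : MemLp h 2 P) :
    Tendsto (fun n => ∫ ω, (pairing P f h ω - ∑ l ∈ Finset.range n,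
      (√(lam l) * ∫ x, h x * φ l x ∂P) * klVar P lam φ f l ω) ^ 2 ∂Q) atTop (𝓝 0) := by
  refine (hf.isOrthonormalSystem_klVar hK hdec).tendsto_integral_sub_sum_sq
    (hf.memLp_pairing hK hh) (hf.integral_pairing_mul_klVar hK hdec hh) ?_
  have h1 := (hdec.hasSum_integral_kernel hh hh).2
  rw [← hf.integral_pairing_mul_pairing hK hh hh] at h1
  simp only [mul_pow, Real.sq_sqrt (hdec.pos _).le]
  simpa only [mul_assoc, ← sq] using h1

/-- The joint characteristic function of finitely many Karhunen–Loève coefficients: a linear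
combination of coefficients is itself a pairing of the field, of variance `∑ t i ^ 2`. -/
lemma integral_exp_sum_klVar {ι : Type*} (s : Finset ι) (j : ι → ℕ) (hj : Function.Injective j)
    (t : ι → ℝ) :
    ∫ ω, Complex.exp ((∑ i ∈ s, t i * klVar P lam φ f (j i) ω : ℝ) * Complex.I) ∂Q
      = Complex.exp (-((∑ i ∈ s, t i ^ 2 : ℝ) / 2 : ℂ)) := by
  classical
  set h : X → ℝ := fun x => ∑ i ∈ s, (t i * (√(lam (j i)))⁻¹) * φ (j i) x with hh
  have hhm : MemLp h 2 P := memLp_finsetSum _ fun i _ => (hdec.memLp (j i)).const_mul _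
  have hsum : ∀ᵐ ω ∂Q, pairing P f h ω = ∑ i ∈ s, t i * klVar P lam φ f (j i) ω := by
    filter_upwards [hf.ae_memLp_path (P := P) hK] with ω hω
    simp only [pairing, hh, Finset.mul_sum, klVar]
    rw [integral_finsetSum]
    · refine Finset.sum_congr rfl fun i _ => ?_
      rw [← mul_assoc, ← integral_const_mul]
      congr 1 with x
      ring
    · intro i _
      have := (hω.integrable_mul_of_two (hdec.memLp (j i))).const_mul (t i * (√(lam (j i)))⁻¹)
      refine this.congr (ae_of_all _ fun x => ?_)
      ring
  have hsq : ∫ ω, pairing P f h ω ^ 2 ∂Q = ∑ i ∈ s, t i ^ 2 := by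
    have hξ := hf.isOrthonormalSystem_klVar hK hdec
    have h1 : ∫ ω, pairing P f h ω ^ 2 ∂Q = ∫ ω, ∑ i ∈ s, ∑ i' ∈ s, (t i * t i') *
        (klVar P lam φ f (j i) ω * klVar P lam φ f (j i') ω) ∂Q := by
      refine integral_congr_ae ?_
      filter_upwards [hsum] with ω hω
      rw [hω, sq, Finset.sum_mul_sum]
      refine Finset.sum_congr rfl fun i _ => Finset.sum_congr rfl fun i' _ => ?_
      ring
    have hint (i i' : ι) : Integrable (fun ω => (t i * t i') *
        (klVar P lam φ f (j i) ω * klVar P lam φ f (j i') ω)) Q :=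
      ((hξ.memLp _).integrable_mul_of_two (hξ.memLp _)).const_mul _
    rw [h1, integral_finsetSum _ fun i _ => integrable_finsetSum _ fun i' _ => hint i i']
    refine Finset.sum_congr rfl fun i hi => ?_
    rw [integral_finsetSum _ fun i' _ => hint i i']
    simp only [integral_const_mul, hξ.orthonormal, hj.eq_iff]
    simp [hi, sq]
  rw [← hsq, ← hf.integral_exp_pairing hK hhm]
  refine integral_congr_ae ?_
  filter_upwards [hsum] with ω hω
  rw [hω]

lemma map_klVar (l : ℕ) : Q.map (klVar P lam φ f l) = gaussianReal 0 1 := by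
  have hm := hf.measurable_klVar hdec l
  have := Measure.isProbabilityMeasure_map (μ := Q) hm.aemeasurable
  refine Measure.ext_of_charFun (funext fun t => ?_)
  have h1 := hf.integral_exp_sum_klVar hK hdec {l} id Function.injective_id (fun _ => t)
  rw [charFun_apply_real, integral_map hm.aemeasurable (by fun_prop), charFun_gaussianReal]
  simp only [Finset.sum_singleton, id] at h1
  push_cast at h1
  rw [h1]
  congr 1
  simp

/-- The Karhunen–Loève coefficients are independent. -/
lemma iIndepFun_klVar : iIndepFun (klVar P lam φ f) Q := by
  rw [iIndepFun_iff_finset]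
  intro s
  have hm (i : s) : AEMeasurable (s.restrict (klVar P lam φ f) i) Q :=
    (hf.measurable_klVar hdec _).aemeasurable
  rw [iIndepFun_iff_charFun_pi hm]
  intro t
  have h1 := hf.integral_exp_sum_klVar hK hdec (Finset.univ : Finset s) (fun i => (i : ℕ))
    Subtype.val_injective (fun i => t i)
  have hmt : Measurable fun ω => WithLp.toLp 2 fun i : s => s.restrict (klVar P lam φ f) i ω :=
    (WithLp.measurable_toLp 2 _).comp
      (measurable_pi_iff.2 fun i => hf.measurable_klVar hdec _)
  rw [charFun_apply, integral_map hmt.aemeasurable (by fun_prop)]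
  have h2 (i : s) : charFun (Q.map (s.restrict (klVar P lam φ f) i)) (t i)
      = Complex.exp (-((t i ^ 2 : ℝ) / 2 : ℂ)) := by
    have : s.restrict (klVar P lam φ f) i = klVar P lam φ f i := rfl
    rw [this, hf.map_klVar hK hdec, charFun_gaussianReal]
    simp
  simp only [h2, ← Complex.exp_sum, Finset.sum_neg_distrib, ← Finset.sum_div]
  rw [← Complex.ofReal_sum, ← h1]
  congr 1 with ω

/-- Almost every path of the field satisfies Parseval's identity in the eigenfunctions, although
these need not be complete in `L²`. -/
lemma ae_hasSum_sq :
    ∀ᵐ ω ∂Q, HasSum (fun l => (∫ x, f ω x * φ l x ∂P) ^ 2) (∫ x, f ω x ^ 2 ∂P) := by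
  have hφ := hdec.isOrthonormalSystem
  have hint := (hf.memLp_prod (P := P) hK).integrable_sq
  have hNint : Integrable (fun ω => ∫ x, f ω x ^ 2 ∂P) Q := hint.integral_prod_left
  have hNm : Measurable fun ω => ∫ x, f ω x ^ 2 ∂P :=
    (StronglyMeasurable.integral_prod_right
      (hf.measurable.pow_const 2).stronglyMeasurable).measurable
  have hpm (l : ℕ) : Measurable (pairing P f (φ l)) :=
    hf.measurable_pairing (hdec.memLp l).aestronglyMeasurable
  have hpint (l : ℕ) : Integrable (fun ω => pairing P f (φ l) ω ^ 2) Q :=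
    (hf.memLp_pairing hK (hdec.memLp l)).integrable_sq
  have hN : ∫ ω, ∫ x, f ω x ^ 2 ∂P ∂Q = ∫ x, K x x ∂P := by
    rw [integral_integral_swap hint]
    simp only [sq, hf.integral_mul]
  have hp (l : ℕ) : ∫ ω, pairing P f (φ l) ω ^ 2 ∂Q = lam l := by
    simp only [sq]
    rw [hf.integral_pairing_mul_pairing hK (hdec.memLp l) (hdec.memLp l)]
    have h2 : ∀ x, ∫ y, φ l y * K x y ∂P = lam l * φ l x := fun x => by
      rw [← hdec.integral_kernel_mul_eigenfunction l x]
      simp only [mul_comm]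
    have h3 : ∀ x, φ l x * (lam l * φ l x) = lam l * (φ l x * φ l x) := fun x => by ring
    simp only [h2, h3]
    rw [integral_const_mul, hdec.orthonormal, if_pos rfl, mul_one]
  set r : ℕ → Ω → ℝ := fun n ω =>
    ∫ x, f ω x ^ 2 ∂P - ∑ l ∈ Finset.range n, pairing P f (φ l) ω ^ 2 with hr
  have hrm (n : ℕ) : Measurable (r n) :=
    hNm.sub (Finset.measurable_sum _ fun l _ => (hpm l).pow_const 2)
  have hrint (n : ℕ) : Integrable (r n) Q := hNint.sub (integrable_finsetSum _ fun l _ => hpint l)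
  have hr0 (n : ℕ) : 0 ≤ᵐ[Q] r n := by
    filter_upwards [hf.ae_memLp_path (P := P) hK] with ω hω
    exact sub_nonneg.2 (hφ.sum_sq_le hω n)
  -- the mean squared distance to the span of the first `n` eigenfunctions is a tail of `lam`
  have hrE (n : ℕ) : ∫ ω, r n ω ∂Q = ∫ x, K x x ∂P - ∑ l ∈ Finset.range n, lam l := by
    rw [hr, integral_sub hNint (integrable_finsetSum _ fun l _ => hpint l), hN,
      integral_finsetSum _ fun l _ => hpint l]
    simp only [hp]
  have hrlim : Tendsto (fun n => ∫⁻ ω, ENNReal.ofReal (r n ω) ∂Q) atTop (𝓝 0) := by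
    have h1 := (hdec.hasSum_eigenvalues hK).tendsto_sum_nat.const_sub (∫ x, K x x ∂P)
    rw [sub_self] at h1
    have h2 := ENNReal.tendsto_ofReal h1
    rw [ENNReal.ofReal_zero] at h2
    refine h2.congr fun n => ?_
    rw [← hrE, ofReal_integral_eq_lintegral_ofReal (hrint n) (hr0 n)]
  have hinf : ∀ᵐ ω ∂Q, ⨅ n, ENNReal.ofReal (r n ω) = 0 := by
    have hm : Measurable fun ω => ⨅ n, ENNReal.ofReal (r n ω) :=
      Measurable.iInf fun n => (hrm n).ennreal_ofReal
    rw [← EventuallyEq, ← Pi.zero_def, ← lintegral_eq_zero_iff hm]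
    refine le_antisymm (ge_of_tendsto' hrlim fun n => lintegral_mono fun ω => iInf_le _ n)
      zero_le
  filter_upwards [hinf, hf.ae_memLp_path (P := P) hK] with ω hω hωm
  have hs := hφ.summable_sq hωm
  have hle : ∫ x, f ω x ^ 2 ∂P ≤ ∑' l, (∫ x, f ω x * φ l x ∂P) ^ 2 := by
    have h1 : ENNReal.ofReal (∫ x, f ω x ^ 2 ∂P - ∑' l, (∫ x, f ω x * φ l x ∂P) ^ 2)
        ≤ ⨅ n, ENNReal.ofReal (r n ω) :=
      le_iInf fun n => ENNReal.ofReal_le_ofReal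
        (sub_le_sub_left (hs.sum_le_tsum _ fun l _ => sq_nonneg _) _)
    rw [hω, nonpos_iff_eq_zero, ENNReal.ofReal_eq_zero] at h1
    linarith
  have hge : ∑' l, (∫ x, f ω x * φ l x ∂P) ^ 2 ≤ ∫ x, f ω x ^ 2 ∂P :=
    Real.tsum_le_of_sum_range_le (fun _ => sq_nonneg _) (hφ.sum_sq_le hωm)
  rw [le_antisymm hle hge]
  exact hs.hasSum

end IsCenteredGaussianField

end KarhunenLoeve

/-! ### The residual kernel of a fixed family of functions -/

section Deterministic

open Matrix Filter Topology

/-- The bilinear form of a series of rank one matrices `w l • x l (x l)ᵀ`. -/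
lemma hasSum_dotProduct_mulVec {n : Type*} [Fintype n] {w : ℕ → ℝ} {x : ℕ → n → ℝ}
    {A : Matrix n n ℝ} (hA : ∀ a b, HasSum (fun l => w l * (x l a * x l b)) (A a b))
    (u v : n → ℝ) : HasSum (fun l => w l * ((u ⬝ᵥ x l) * (v ⬝ᵥ x l))) (u ⬝ᵥ A *ᵥ v) := by
  have h : HasSum (fun l => ∑ a, ∑ b, u a * v b * (w l * (x l a * x l b)))
      (∑ a, ∑ b, u a * v b * A a b) :=
    hasSum_sum fun a _ => hasSum_sum fun b _ => (hA a b).mul_left _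
  have h1 : ∑ a, ∑ b, u a * v b * A a b = u ⬝ᵥ A *ᵥ v := by
    simp only [dotProduct, mulVec, Finset.mul_sum]
    refine Finset.sum_congr rfl fun a _ => Finset.sum_congr rfl fun b _ => by ring
  rw [← h1]
  convert h using 2 with l
  simp only [dotProduct]
  rw [Finset.sum_mul_sum, Finset.mul_sum]
  refine Finset.sum_congr rfl fun a _ => ?_
  rw [Finset.mul_sum]
  refine Finset.sum_congr rfl fun b _ => by ring

variable {X : Type*} [MeasurableSpace X] {P : Measure X} {K : X → X → ℝ} {lam : ℕ → ℝ}
  {φ : ℕ → X → ℝ} {k : ℕ} {g : Fin k → X → ℝ}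

/-- The array of Karhunen–Loève coefficients; its `l`-th column is the vector `ξ l`. -/
noncomputable def klArray (P : Measure X) (lam : ℕ → ℝ) (φ : ℕ → X → ℝ) (g : Fin k → X → ℝ) :
    Fin k × ℕ → ℝ :=
  fun p => klCoeff P lam φ g p.1 p.2

/-- The matrix `⟨g a, K g b⟩` of the integral operator of `K`. -/
noncomputable def kernelMatrix (P : Measure X) (K : X → X → ℝ) (g : Fin k → X → ℝ) :
    Matrix (Fin k) (Fin k) ℝ :=
  Matrix.of fun a b => ∫ x, g a x * ∫ y, g b y * K x y ∂P ∂P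

/-- The matrix `G⁻¹ ⟨g a, K g b⟩ G⁻¹` of the compression `Π K Π`. -/
noncomputable def compressedMatrix (P : Measure X) (K : X → X → ℝ) (g : Fin k → X → ℝ) :
    Matrix (Fin k) (Fin k) ℝ :=
  (gramMatrix P g)⁻¹ * kernelMatrix P K g * (gramMatrix P g)⁻¹

lemma projCoeff_eq (g : Fin k → X → ℝ) (l m : ℕ) :
    projCoeff P lam φ g l m = column (klArray P lam φ g) l ⬝ᵥ (gramMatrix P g)⁻¹ *ᵥ
      column (klArray P lam φ g) m := by
  simp only [projCoeff, dotProduct, mulVec, Finset.mul_sum, column, klArray, mul_assoc]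

lemma gramMatrix_transpose (g : Fin k → X → ℝ) : (gramMatrix P g)ᵀ = gramMatrix P g := by
  ext a b
  simp only [gramMatrix, transpose_apply, of_apply, mul_comm]

lemma gramMatrix_inv_transpose (g : Fin k → X → ℝ) :
    ((gramMatrix P g)⁻¹)ᵀ = (gramMatrix P g)⁻¹ := by
  rw [transpose_nonsing_inv, gramMatrix_transpose]

lemma proj_eq (hg : ∀ i, MemLp (g i) 2 P) {h : X → ℝ} (hh : MemLp h 2 P) (x : X) :
    proj P g h x = (fun a => g a x) ⬝ᵥ (gramMatrix P g)⁻¹ *ᵥ fun a => ∫ y, g a y * h y ∂P := by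
  simp only [proj, projKernel, Finset.sum_mul, dotProduct, mulVec, Finset.mul_sum]
  have hint (i j : Fin k) :
      Integrable (fun y => (gramMatrix P g)⁻¹ i j * g i x * g j y * h y) P := by
    simpa only [mul_assoc] using
      (((hg j).integrable_mul_of_two hh).const_mul (g i x)).const_mul ((gramMatrix P g)⁻¹ i j)
  rw [integral_finsetSum _ fun i _ => integrable_finsetSum _ fun j _ => hint i j]
  refine Finset.sum_congr rfl fun i _ => ?_
  rw [integral_finsetSum _ fun j _ => hint i j]
  refine Finset.sum_congr rfl fun j _ => ?_
  simp only [mul_assoc]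
  rw [integral_const_mul, integral_const_mul]
  ring

/-- The residual kernel in terms of the values of the functions, the Gram matrix, and the
pairings with `K`. The Gram matrix need not be invertible: only the symmetry of `G⁻¹` matters. -/
lemma residualKernel_eq (hsymm : ∀ x y, K x y = K y x) (hdec : IsMercerDecomposition P K lam φ)
    (hg : ∀ i, MemLp (g i) 2 P) (x y : X) :
    residualKernel P K g x y = K x y
      - (fun a => g a y) ⬝ᵥ (gramMatrix P g)⁻¹ *ᵥ (fun a => ∫ z, g a z * K x z ∂P)
      - (fun a => g a x) ⬝ᵥ (gramMatrix P g)⁻¹ *ᵥ (fun a => ∫ z, g a z * K y z ∂P)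
      + (fun a => g a x) ⬝ᵥ compressedMatrix P K g *ᵥ (fun a => g a y) := by
  set R := (gramMatrix P g)⁻¹ with hR
  have hRT : Rᵀ = R := gramMatrix_inv_transpose g
  have hu (b : Fin k) : MemLp (fun s => ∫ z, g b z * K s z ∂P) 2 P :=
    (hdec.hasSum_integral_kernel (hg b) (hg b)).1
  have h1 : proj P g (fun t => K x t) y =
      (fun a => g a y) ⬝ᵥ R *ᵥ (fun a => ∫ z, g a z * K x z ∂P) :=
    proj_eq hg (hdec.memLp_kernel x) y
  have h2 : proj P g (fun s => K s y) x =
      (fun a => g a x) ⬝ᵥ R *ᵥ (fun a => ∫ z, g a z * K y z ∂P) := by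
    simp only [fun s => hsymm s y]
    exact proj_eq hg (hdec.memLp_kernel y) x
  have h3 : (fun s => proj P g (fun t => K s t) y) =
      fun s => ∑ b, (R *ᵥ fun a => g a y) b * ∫ z, g b z * K s z ∂P := by
    ext s
    rw [proj_eq hg (hdec.memLp_kernel s) y, dotProduct_mulVec, ← mulVec_transpose, hRT, dotProduct]
  have h4 : proj P g (fun s => proj P g (fun t => K s t) y) x =
      (fun a => g a x) ⬝ᵥ compressedMatrix P K g *ᵥ (fun a => g a y) := by
    rw [h3, proj_eq hg (memLp_finsetSum _ fun b _ => (hu b).const_mul _), compressedMatrix,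
      ← mulVec_mulVec, ← mulVec_mulVec]
    congr 2
    ext a
    simp only [Finset.mul_sum]
    rw [integral_finsetSum]
    · rw [mulVec, dotProduct]
      refine Finset.sum_congr rfl fun b _ => ?_
      rw [kernelMatrix, of_apply, ← integral_mul_const]
      congr 1 with s
      ring
    · intro b _
      have := ((hg a).integrable_mul_of_two (hu b)).const_mul ((R *ᵥ fun a => g a y) b)
      refine this.congr (ae_of_all _ fun s => ?_)
      ring
  rw [residualKernel, h1, h2, h4]

section Parseval

variable (hdec : IsMercerDecomposition P K lam φ) (hg : ∀ i, MemLp (g i) 2 P)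
  (hpars : ∀ i, HasSum (fun l => (∫ x, g i x * φ l x ∂P) ^ 2) (∫ x, g i x ^ 2 ∂P))

include hdec in
lemma sqrt_mul_column_klArray (a : Fin k) (l : ℕ) :
    ∫ x, g a x * φ l x ∂P = √(lam l) * column (klArray P lam φ g) l a := by
  rw [column, klArray, klCoeff, mul_inv_cancel_left₀ (Real.sqrt_ne_zero'.2 (hdec.pos l))]

include hdec hg hpars in
lemma hasSum_gramMatrix (a b : Fin k) :
    HasSum (fun l => lam l * (column (klArray P lam φ g) l a * column (klArray P lam φ g) l b))
      (gramMatrix P g a b) := by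
  have h := hdec.isOrthonormalSystem.hasSum_integral_mul (hg b) (hpars b) (hg a)
  simp only [sqrt_mul_column_klArray hdec] at h
  have he (l : ℕ) := Real.mul_self_sqrt (hdec.pos l).le
  convert h using 1
  · ext l
    linear_combination
      -(column (klArray P lam φ g) l a * column (klArray P lam φ g) l b) * he l
  · rfl

include hdec hg in
lemma hasSum_kernelMatrix (a b : Fin k) :
    HasSum (fun l => lam l ^ 2 *
      (column (klArray P lam φ g) l a * column (klArray P lam φ g) l b))
      (kernelMatrix P K g a b) := by
  have h := (hdec.hasSum_integral_kernel (hg b) (hg a)).2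
  simp only [sqrt_mul_column_klArray hdec] at h
  have he (l : ℕ) := Real.mul_self_sqrt (hdec.pos l).le
  convert h using 1
  · ext l
    linear_combination
      -(lam l * column (klArray P lam φ g) l a * column (klArray P lam φ g) l b) * he l
  · rfl

include hdec hg hpars in
lemma dotProduct_wishart_le_gramMatrix (n : ℕ) (v : Fin k → ℝ) :
    v ⬝ᵥ wishart lam n (klArray P lam φ g) *ᵥ v ≤ v ⬝ᵥ gramMatrix P g *ᵥ v := by
  rw [dotProduct_wishart_mulVec]
  have h := hasSum_dotProduct_mulVec (hasSum_gramMatrix hdec hg hpars) v v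
  simp only [← pow_two] at h
  exact sum_le_hasSum _ (fun l _ => mul_nonneg (hdec.pos l).le (sq_nonneg _)) h

include hdec hg hpars in
lemma posDef_gramMatrix {n : ℕ} (hW : (wishart lam n (klArray P lam φ g)).PosDef) :
    (gramMatrix P g).PosDef := by
  refine PosDef.of_dotProduct_mulVec_pos ?_ fun v hv => ?_
  · rw [IsHermitian, conjTranspose_eq_transpose_of_trivial, gramMatrix_transpose]
  · have := hW.dotProduct_mulVec_pos hv
    rw [star_trivial] at this ⊢
    exact this.trans_le (dotProduct_wishart_le_gramMatrix hdec hg hpars n v)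

include hdec hg hpars in
/-- By monotonicity of the inverse, truncating the Karhunen–Loève series increases `M l l`. -/
lemma projCoeff_self_le_wishart {n : ℕ} (hW : (wishart lam n (klArray P lam φ g)).PosDef) (l : ℕ) :
    projCoeff P lam φ g l l ≤ column (klArray P lam φ g) l ⬝ᵥ
      (wishart lam n (klArray P lam φ g))⁻¹ *ᵥ column (klArray P lam φ g) l := by
  rw [projCoeff_eq]
  exact (posDef_gramMatrix hdec hg hpars hW).dotProduct_inv_mulVec_anti hW
    (dotProduct_wishart_le_gramMatrix hdec hg hpars n) _

include hdec hg hpars in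
/-- `G` dominates each of its summands `lam l • ξ l (ξ l)ᵀ`. -/
lemma mul_projCoeff_self_le_one (hG : (gramMatrix P g).PosDef) (l : ℕ) :
    lam l * projCoeff P lam φ g l l ≤ 1 := by
  have h : projCoeff P lam φ g l l ≤ (lam l)⁻¹ := by
    rw [projCoeff_eq]
    refine hG.dotProduct_inv_mulVec_le (inv_nonneg.2 (hdec.pos l).le) fun v => ?_
    rw [inv_mul_eq_div, le_div_iff₀ (hdec.pos l), mul_comm]
    have h := hasSum_dotProduct_mulVec (hasSum_gramMatrix hdec hg hpars) v v
    simp only [← pow_two] at h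
    exact le_hasSum h l fun m _ => mul_nonneg (hdec.pos m).le (sq_nonneg _)
  calc _ ≤ lam l * (lam l)⁻¹ := mul_le_mul_of_nonneg_left h (hdec.pos l).le
    _ = 1 := mul_inv_cancel₀ (hdec.pos l).ne'

lemma projCoeff_self_nonneg (hG : (gramMatrix P g).PosDef) (l : ℕ) :
    0 ≤ projCoeff P lam φ g l l := by
  rw [projCoeff_eq]
  exact hG.inv.posSemidef.dotProduct_mulVec_self_nonneg _

lemma projCoeff_sq_le (hG : (gramMatrix P g).PosDef) (l m : ℕ) :
    projCoeff P lam φ g l m ^ 2 ≤ projCoeff P lam φ g l l * projCoeff P lam φ g m m := by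
  simp only [projCoeff_eq]
  exact hG.inv.posSemidef.dotProduct_mulVec_sq_le _ _

include hdec hg hpars in
lemma gramLimsup_klArray : gramLimsup lam (klArray P lam φ g) = gramMatrix P g := by
  ext a b
  refine Tendsto.limsup_eq ?_
  simp only [wishart_apply]
  exact (hasSum_gramMatrix hdec hg hpars a b).tendsto_sum_nat

include hdec hg in
lemma gramLimsup_sq_klArray :
    gramLimsup (fun l => lam l ^ 2) (klArray P lam φ g) = kernelMatrix P K g := by
  ext a b
  refine Tendsto.limsup_eq ?_
  simp only [wishart_apply]
  exact (hasSum_kernelMatrix hdec hg a b).tendsto_sum_nat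

include hdec hg in
lemma hasSum_compressedMatrix (u v : Fin k → ℝ) :
    HasSum (fun j => lam j ^ 2 *
      ((u ⬝ᵥ (gramMatrix P g)⁻¹ *ᵥ column (klArray P lam φ g) j) *
        (v ⬝ᵥ (gramMatrix P g)⁻¹ *ᵥ column (klArray P lam φ g) j)))
      (u ⬝ᵥ compressedMatrix P K g *ᵥ v) := by
  have h := hasSum_dotProduct_mulVec (hasSum_kernelMatrix hdec hg)
    ((gramMatrix P g)⁻¹ *ᵥ u) ((gramMatrix P g)⁻¹ *ᵥ v)
  have hR (u v : Fin k → ℝ) :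
      ((gramMatrix P g)⁻¹ *ᵥ u) ⬝ᵥ v = u ⬝ᵥ (gramMatrix P g)⁻¹ *ᵥ v := by
    conv_lhs => rw [← gramMatrix_inv_transpose]
    rw [mulVec_transpose, ← dotProduct_mulVec]
  simp only [hR] at h
  rwa [compressedMatrix, ← mulVec_mulVec, ← mulVec_mulVec]

include hdec hg in
lemma posSemidef_compressedMatrix : (compressedMatrix P K g).PosSemidef := by
  refine PosSemidef.of_dotProduct_mulVec_nonneg ?_ fun v => ?_
  · rw [IsHermitian, conjTranspose_eq_transpose_of_trivial, compressedMatrix, transpose_mul,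
      transpose_mul, gramMatrix_inv_transpose, Matrix.mul_assoc]
    congr 2
    ext a b
    rw [transpose_apply]
    refine (hasSum_kernelMatrix hdec hg b a).unique ?_
    simpa only [mul_comm] using hasSum_kernelMatrix hdec hg a b
  · rw [star_trivial]
    exact (hasSum_compressedMatrix hdec hg v v).nonneg fun j =>
      mul_nonneg (sq_nonneg _) (mul_self_nonneg _)

include hdec hg in
lemma hasSum_projCoeff_sq (l : ℕ) :
    HasSum (fun j => lam j ^ 2 * projCoeff P lam φ g l j ^ 2)
      (column (klArray P lam φ g) l ⬝ᵥ compressedMatrix P K g *ᵥ column (klArray P lam φ g) l) := by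
  simpa only [projCoeff_eq, ← pow_two] using hasSum_compressedMatrix hdec hg
    (column (klArray P lam φ g) l) (column (klArray P lam φ g) l)

include hdec hg hpars in
/-- `Π K Π ≤ λ₀ Π`, in terms of the coefficient vectors. -/
lemma dotProduct_compressedMatrix_le (hG : (gramMatrix P g).PosDef) (v : Fin k → ℝ) :
    v ⬝ᵥ compressedMatrix P K g *ᵥ v ≤ lam 0 * (v ⬝ᵥ (gramMatrix P g)⁻¹ *ᵥ v) := by
  set R := (gramMatrix P g)⁻¹ with hRdef
  have hR (u v : Fin k → ℝ) : (R *ᵥ u) ⬝ᵥ v = u ⬝ᵥ R *ᵥ v := by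
    conv_lhs => rw [hRdef, ← gramMatrix_inv_transpose]
    rw [mulVec_transpose, ← dotProduct_mulVec]
  have h := hasSum_dotProduct_mulVec (hasSum_gramMatrix hdec hg hpars) (R *ᵥ v) (R *ᵥ v)
  rw [mulVec_mulVec, mul_nonsing_inv _ hG.det_isUnit, one_mulVec] at h
  simp only [hR] at h
  refine hasSum_le (fun j => ?_) (hasSum_compressedMatrix hdec hg v v) (h.mul_left (lam 0))
  rw [← mul_assoc (lam 0), pow_two]
  exact mul_le_mul_of_nonneg_right (mul_le_mul_of_nonneg_right (hdec.antitone (Nat.zero_le j))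
    (hdec.pos j).le) (mul_self_nonneg _)

end Parseval

end Deterministic

/-! ### Random quadratic forms with uncorrelated vectors -/

section RandomForm

open Matrix Filter Topology

variable {Ω n : Type*} [MeasurableSpace Ω] {μ : Measure Ω}

/-- `g` is the sum of the series `∑ l, a l • ξ l`, coordinatewise in mean square, with square
summable coefficients. -/
structure IsMeanSquareSum (μ : Measure Ω) (ξ : ℕ → Ω → n → ℝ) (a : ℕ → ℝ) (g : Ω → n → ℝ) :
    Prop where
  summable : Summable fun l => a l ^ 2
  measurable : ∀ i, Measurable fun ω => g ω i
  memLp : ∀ i m, MemLp (fun ω => g ω i - ∑ l ∈ Finset.range m, a l * ξ l ω i) 2 μ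
  tendsto : ∀ i, Tendsto
    (fun m => ∫ ω, (g ω i - ∑ l ∈ Finset.range m, a l * ξ l ω i) ^ 2 ∂μ) atTop (𝓝 0)

namespace IsMeanSquareSum

variable {ξ : ℕ → Ω → n → ℝ} {a b : ℕ → ℝ} {g h : Ω → n → ℝ}

lemma add_smul (hg : IsMeanSquareSum μ ξ a g) (hh : IsMeanSquareSum μ ξ b h) (t : ℝ) :
    IsMeanSquareSum μ ξ (fun l => a l + t * b l) (fun ω => g ω + t • h ω) := by
  have he (i : n) (m : ℕ) (ω : Ω) :
      (g ω + t • h ω) i - ∑ l ∈ Finset.range m, (a l + t * b l) * ξ l ω i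
        = (g ω i - ∑ l ∈ Finset.range m, a l * ξ l ω i)
          + t * (h ω i - ∑ l ∈ Finset.range m, b l * ξ l ω i) := by
    simp only [add_mul, Finset.sum_add_distrib, mul_sub, Finset.mul_sum, Pi.add_apply,
      Pi.smul_apply, smul_eq_mul, mul_assoc]
    ring
  have hm (i : n) (m : ℕ) := (hg.memLp i m).add ((hh.memLp i m).const_mul t)
  refine ⟨?_, fun i => (hg.measurable i).add ((hh.measurable i).const_mul t), fun i m => ?_,
    fun i => ?_⟩
  · refine Summable.of_nonneg_of_le (fun l => sq_nonneg _) (fun l => ?_)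
      ((hg.summable.mul_left 2).add (hh.summable.mul_left (2 * t ^ 2)))
    nlinarith [sq_nonneg (a l - t * b l)]
  · simp only [he]
    exact hm i m
  · simp only [he]
    have h1 := ((hg.tendsto i).const_mul 2).add ((hh.tendsto i).const_mul (2 * t ^ 2))
    rw [mul_zero, mul_zero, add_zero] at h1
    refine squeeze_zero (fun m => integral_nonneg fun ω => sq_nonneg _) (fun m => ?_) h1
    have i1 := (hg.memLp i m).integrable_sq.const_mul 2
    have i2 := (hh.memLp i m).integrable_sq.const_mul (2 * t ^ 2)
    rw [← integral_const_mul, ← integral_const_mul, ← integral_add i1 i2]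
    refine integral_mono (hm i m).integrable_sq (i1.add i2) fun ω => ?_
    nlinarith [sq_nonneg ((g ω i - ∑ l ∈ Finset.range m, a l * ξ l ω i)
      - t * (h ω i - ∑ l ∈ Finset.range m, b l * ξ l ω i))]

end IsMeanSquareSum

variable [Fintype n] {S : Ω → Matrix n n ℝ}

section CauchySchwarz

variable {u v : Ω → n → ℝ} (hSm : ∀ i j, Measurable fun ω => S ω i j)
  (hS : ∀ᵐ ω ∂μ, (S ω).PosSemidef) (hum : ∀ i, Measurable fun ω => u ω i)
  (hvm : ∀ i, Measurable fun ω => v ω i)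
  (hu : Integrable (fun ω => u ω ⬝ᵥ S ω *ᵥ u ω) μ) (hv : Integrable (fun ω => v ω ⬝ᵥ S ω *ᵥ v ω) μ)

include hSm hS hum hvm hu hv

lemma integrable_dotProduct_mulVec : Integrable (fun ω => u ω ⬝ᵥ S ω *ᵥ v ω) μ := by
  refine (hu.add hv).mono' (measurable_dotProduct_mulVec hSm hum hvm).aestronglyMeasurable ?_
  filter_upwards [hS] with ω hω
  have h1 := hω.dotProduct_mulVec_self_nonneg (u ω)
  have h2 := hω.dotProduct_mulVec_self_nonneg (v ω)
  have h3 := hω.dotProduct_mulVec_sq_le (u ω) (v ω)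
  rw [Real.norm_eq_abs]
  refine abs_le_of_sq_le_sq (h3.trans ?_) (add_nonneg h1 h2)
  simp only [Pi.add_apply]
  nlinarith

lemma integrable_form_add_smul (t : ℝ) :
    Integrable (fun ω => (u ω + t • v ω) ⬝ᵥ S ω *ᵥ (u ω + t • v ω)) μ ∧
      ∫ ω, (u ω + t • v ω) ⬝ᵥ S ω *ᵥ (u ω + t • v ω) ∂μ = ∫ ω, u ω ⬝ᵥ S ω *ᵥ u ω ∂μ
        + 2 * t * ∫ ω, u ω ⬝ᵥ S ω *ᵥ v ω ∂μ + t ^ 2 * ∫ ω, v ω ⬝ᵥ S ω *ᵥ v ω ∂μ := by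
  have huv := integrable_dotProduct_mulVec hSm hS hum hvm hu hv
  have he : (fun ω => (u ω + t • v ω) ⬝ᵥ S ω *ᵥ (u ω + t • v ω)) =ᵐ[μ]
      fun ω => u ω ⬝ᵥ S ω *ᵥ u ω + 2 * t * (u ω ⬝ᵥ S ω *ᵥ v ω)
        + t ^ 2 * (v ω ⬝ᵥ S ω *ᵥ v ω) := by
    filter_upwards [hS] with ω hω
    simp only [mulVec_add, mulVec_smul, dotProduct_add, add_dotProduct,
      smul_dotProduct, dotProduct_smul, smul_eq_mul, hω.dotProduct_mulVec_comm (v ω) (u ω)]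
    ring
  have h1 : Integrable (fun ω => u ω ⬝ᵥ S ω *ᵥ u ω + 2 * t * (u ω ⬝ᵥ S ω *ᵥ v ω)) μ :=
    hu.add (huv.const_mul _)
  refine ⟨(h1.add (hv.const_mul _)).congr he.symm, ?_⟩
  rw [integral_congr_ae he, integral_add h1 (hv.const_mul _), integral_add hu (huv.const_mul _),
    integral_const_mul, integral_const_mul]

/-- The Cauchy–Schwarz inequality for the mean of a random positive semidefinite form. -/
lemma sq_integral_dotProduct_mulVec_le :
    (∫ ω, u ω ⬝ᵥ S ω *ᵥ v ω ∂μ) ^ 2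
      ≤ (∫ ω, u ω ⬝ᵥ S ω *ᵥ u ω ∂μ) * ∫ ω, v ω ⬝ᵥ S ω *ᵥ v ω ∂μ := by
  have h (t : ℝ) : 0 ≤ (∫ ω, v ω ⬝ᵥ S ω *ᵥ v ω ∂μ) * (t * t)
      + (2 * ∫ ω, u ω ⬝ᵥ S ω *ᵥ v ω ∂μ) * t + ∫ ω, u ω ⬝ᵥ S ω *ᵥ u ω ∂μ := by
    have h1 := (integrable_form_add_smul hSm hS hum hvm hu hv t).2
    have h2 : 0 ≤ ∫ ω, (u ω + t • v ω) ⬝ᵥ S ω *ᵥ (u ω + t • v ω) ∂μ :=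
      integral_nonneg_of_ae (hS.mono fun ω hω => hω.dotProduct_mulVec_self_nonneg _)
    linarith
  have := discrim_le_zero h
  rw [discrim] at this
  linarith

end CauchySchwarz

/-- A random positive semidefinite form `S` and random vectors `ξ l` that are orthogonal for the
form `(u, v) ↦ 𝔼 uᵀ S v`, with `𝔼 (ξ l)ᵀ S (ξ l) ≤ B`. The form may depend on the vectors. -/
structure IsUncorrelated (μ : Measure Ω) (S : Ω → Matrix n n ℝ) (ξ : ℕ → Ω → n → ℝ) (B : ℝ) :
    Prop where
  measurable_form : ∀ i j, Measurable fun ω => S ω i j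
  posSemidef : ∀ᵐ ω ∂μ, (S ω).PosSemidef
  measurable : ∀ l i, Measurable fun ω => ξ l ω i
  integrable : ∀ l, Integrable (fun ω => ξ l ω ⬝ᵥ S ω *ᵥ ξ l ω) μ
  integral_le : ∀ l, ∫ ω, ξ l ω ⬝ᵥ S ω *ᵥ ξ l ω ∂μ ≤ B
  integral_eq_zero : ∀ l m, l ≠ m → ∫ ω, ξ l ω ⬝ᵥ S ω *ᵥ ξ m ω ∂μ = 0

namespace IsMeanSquareSum

variable {ξ : ℕ → Ω → n → ℝ} {a : ℕ → ℝ} {g : Ω → n → ℝ}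

/-- Mean square convergence gives almost sure convergence along a subsequence. -/
lemma exists_subseq (hg : IsMeanSquareSum μ ξ a g) :
    ∃ ns : ℕ → ℕ, StrictMono ns ∧ ∀ᵐ ω ∂μ, ∀ i,
      Tendsto (fun j => ∑ l ∈ Finset.range (ns j), a l * ξ l ω i) atTop (𝓝 (g ω i)) := by
  set D : ℕ → Ω → ℝ := fun m ω =>
    ∑ i, (g ω i - ∑ l ∈ Finset.range m, a l * ξ l ω i) ^ 2 with hD
  have hint (m : ℕ) : Integrable (D m) μ :=
    integrable_finsetSum _ fun i _ => (hg.memLp i m).integrable_sq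
  have hDnn (m : ℕ) (ω : Ω) : 0 ≤ D m ω := Finset.sum_nonneg fun i _ => sq_nonneg _
  have hlim : Tendsto (fun m => ∫ ω, D m ω ∂μ) atTop (𝓝 0) := by
    have h1 := tendsto_finsetSum Finset.univ fun i _ => hg.tendsto i
    rw [Finset.sum_const_zero] at h1
    refine h1.congr fun m => ?_
    rw [hD, integral_finsetSum _ fun i _ => (hg.memLp i m).integrable_sq]
  have hmeas : TendstoInMeasure μ D atTop fun _ => 0 := by
    refine tendstoInMeasure_of_tendsto_eLpNorm one_ne_zero
      (fun m => (hint m).aestronglyMeasurable) aestronglyMeasurable_const ?_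
    have h2 := ENNReal.tendsto_ofReal hlim
    rw [ENNReal.ofReal_zero] at h2
    refine h2.congr fun m => ?_
    rw [eLpNorm_one_eq_lintegral_enorm,
      ofReal_integral_eq_lintegral_ofReal (hint m) (ae_of_all _ (hDnn m))]
    refine lintegral_congr fun ω => ?_
    simp [Real.enorm_of_nonneg (hDnn m ω)]
  obtain ⟨ns, hns, hae⟩ := hmeas.exists_seq_tendsto_ae
  refine ⟨ns, hns, ?_⟩
  filter_upwards [hae] with ω hω i
  have h1 : Tendsto (fun j => (g ω i - ∑ l ∈ Finset.range (ns j), a l * ξ l ω i) ^ 2) atTop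
      (𝓝 0) := squeeze_zero (fun _ => sq_nonneg _)
    (fun j => Finset.single_le_sum
      (f := fun i => (g ω i - ∑ l ∈ Finset.range (ns j), a l * ξ l ω i) ^ 2)
      (fun i _ => sq_nonneg _) (Finset.mem_univ i)) hω
  have h2 : Tendsto (fun j => g ω i - ∑ l ∈ Finset.range (ns j), a l * ξ l ω i) atTop (𝓝 0) := by
    rw [tendsto_zero_iff_abs_tendsto_zero]
    simpa only [Real.sqrt_sq_eq_abs, Real.sqrt_zero, Function.comp_def] using h1.sqrt
  simpa using h2.const_sub (g ω i)

end IsMeanSquareSum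

namespace IsUncorrelated

variable {ξ : ℕ → Ω → n → ℝ} {B : ℝ} {a b : ℕ → ℝ} {g h : Ω → n → ℝ}

lemma integrable_mul (hξ : IsUncorrelated μ S ξ B) (l m : ℕ) :
    Integrable (fun ω => ξ l ω ⬝ᵥ S ω *ᵥ ξ m ω) μ :=
  integrable_dotProduct_mulVec hξ.measurable_form hξ.posSemidef (hξ.measurable l) (hξ.measurable m)
    (hξ.integrable l) (hξ.integrable m)

lemma integral_nonneg (hξ : IsUncorrelated μ S ξ B) (l : ℕ) :
    0 ≤ ∫ ω, ξ l ω ⬝ᵥ S ω *ᵥ ξ l ω ∂μ :=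
  integral_nonneg_of_ae (hξ.posSemidef.mono fun _ hω => hω.dotProduct_mulVec_self_nonneg _)

lemma summable (hξ : IsUncorrelated μ S ξ B) (ha : Summable fun l => a l ^ 2) :
    Summable fun l => a l ^ 2 * ∫ ω, ξ l ω ⬝ᵥ S ω *ᵥ ξ l ω ∂μ :=
  Summable.of_nonneg_of_le (fun l => mul_nonneg (sq_nonneg _) (hξ.integral_nonneg l))
    (fun l => mul_le_mul_of_nonneg_left (hξ.integral_le l) (sq_nonneg _)) (ha.mul_right B)

lemma integrable_form_sum (hξ : IsUncorrelated μ S ξ B) (a : ℕ → ℝ) (s : Finset ℕ) :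
    Integrable (fun ω => (∑ l ∈ s, a l • ξ l ω) ⬝ᵥ S ω *ᵥ ∑ l ∈ s, a l • ξ l ω) μ ∧
      ∫ ω, (∑ l ∈ s, a l • ξ l ω) ⬝ᵥ S ω *ᵥ ∑ l ∈ s, a l • ξ l ω ∂μ
        = ∑ l ∈ s, a l ^ 2 * ∫ ω, ξ l ω ⬝ᵥ S ω *ᵥ ξ l ω ∂μ := by
  have he (ω : Ω) : (∑ l ∈ s, a l • ξ l ω) ⬝ᵥ S ω *ᵥ ∑ l ∈ s, a l • ξ l ω
      = ∑ l ∈ s, ∑ m ∈ s, a l * a m * (ξ l ω ⬝ᵥ S ω *ᵥ ξ m ω) := by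
    simp only [Matrix.mulVec_sum, mulVec_smul, sum_dotProduct, dotProduct_sum, smul_dotProduct,
      dotProduct_smul, smul_eq_mul]
    rw [Finset.sum_comm]
    refine Finset.sum_congr rfl fun l _ => ?_
    rw [Finset.mul_sum]
    refine Finset.sum_congr rfl fun m _ => by ring
  have hi (l m : ℕ) := (hξ.integrable_mul l m).const_mul (a l * a m)
  simp only [he]
  refine ⟨integrable_finsetSum _ fun l _ => integrable_finsetSum _ fun m _ => hi l m, ?_⟩
  rw [integral_finsetSum _ fun l _ => integrable_finsetSum _ fun m _ => hi l m]
  refine Finset.sum_congr rfl fun l hl => ?_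
  rw [integral_finsetSum _ fun m _ => hi l m, Finset.sum_eq_single_of_mem l hl]
  · rw [integral_const_mul, pow_two]
  · intro m _ hm
    rw [integral_const_mul, hξ.integral_eq_zero l m hm.symm, mul_zero]

/-- Fatou's lemma bounds the remainder of the series by the tail of the squared coefficients. -/
lemma lintegral_form_sub_sum_le (hξ : IsUncorrelated μ S ξ B) (hg : IsMeanSquareSum μ ξ a g)
    (m : ℕ) :
    ∫⁻ ω, ENNReal.ofReal ((g ω - ∑ l ∈ Finset.range m, a l • ξ l ω) ⬝ᵥ S ω *ᵥ
      (g ω - ∑ l ∈ Finset.range m, a l • ξ l ω)) ∂μ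
      ≤ ENNReal.ofReal (∑' l, a l ^ 2 * ∫ ω, ξ l ω ⬝ᵥ S ω *ᵥ ξ l ω ∂μ
        - ∑ l ∈ Finset.range m, a l ^ 2 * ∫ ω, ξ l ω ⬝ᵥ S ω *ᵥ ξ l ω ∂μ) := by
  obtain ⟨ns, hns, hae⟩ := hg.exists_subseq
  set d : ℕ → Ω → n → ℝ := fun j ω => ∑ l ∈ Finset.Ico m (ns j), a l • ξ l ω with hd
  have hdm (j : ℕ) (i : n) : Measurable fun ω => d j ω i := by
    simp only [hd, Finset.sum_apply, Pi.smul_apply, smul_eq_mul]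
    exact Finset.measurable_sum _ fun l _ => (hξ.measurable l i).const_mul _
  have hpt : ∀ᵐ ω ∂μ, ENNReal.ofReal ((g ω - ∑ l ∈ Finset.range m, a l • ξ l ω) ⬝ᵥ S ω *ᵥ
      (g ω - ∑ l ∈ Finset.range m, a l • ξ l ω))
      = liminf (fun j => ENNReal.ofReal (d j ω ⬝ᵥ S ω *ᵥ d j ω)) atTop := by
    filter_upwards [hae] with ω hω
    refine (Tendsto.liminf_eq (ENNReal.tendsto_ofReal ?_)).symm
    have h1 : Tendsto (fun j => d j ω) atTop (𝓝 (g ω - ∑ l ∈ Finset.range m, a l • ξ l ω)) := by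
      refine tendsto_pi_nhds.2 fun i => ?_
      have h2 := (hω i).sub_const (∑ l ∈ Finset.range m, a l * ξ l ω i)
      simp only [Pi.sub_apply, Finset.sum_apply, Pi.smul_apply, smul_eq_mul]
      refine h2.congr' ?_
      filter_upwards [eventually_ge_atTop m] with j hj
      simp only [hd, Finset.sum_apply, Pi.smul_apply, smul_eq_mul]
      rw [Finset.sum_Ico_eq_sub _ (hj.trans (hns.id_le j))]
    have hc : Continuous fun v : n → ℝ => v ⬝ᵥ S ω *ᵥ v := by fun_prop
    exact (hc.tendsto _).comp h1
  rw [lintegral_congr_ae hpt]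
  refine (lintegral_liminf_le fun j => (measurable_dotProduct_mulVec hξ.measurable_form (hdm j)
    (hdm j)).ennreal_ofReal).trans ?_
  refine liminf_le_of_frequently_le' (Eventually.frequently ?_)
  filter_upwards [eventually_ge_atTop m] with j hj
  obtain ⟨h1, h2⟩ := hξ.integrable_form_sum a (Finset.Ico m (ns j))
  rw [← ofReal_integral_eq_lintegral_ofReal h1
    (hξ.posSemidef.mono fun ω hω => hω.dotProduct_mulVec_self_nonneg _)]
  refine ENNReal.ofReal_le_ofReal ?_
  rw [h2, Finset.sum_Ico_eq_sub _ (hj.trans (hns.id_le j))]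
  exact sub_le_sub_right ((hξ.summable hg.summable).sum_le_tsum _
    fun l _ => mul_nonneg (sq_nonneg _) (hξ.integral_nonneg l)) _

/-- Parseval's identity in the mean of a random form. -/
lemma integrable_and_hasSum_self (hξ : IsUncorrelated μ S ξ B) (hg : IsMeanSquareSum μ ξ a g) :
    Integrable (fun ω => g ω ⬝ᵥ S ω *ᵥ g ω) μ ∧
      HasSum (fun l => a l ^ 2 * ∫ ω, ξ l ω ⬝ᵥ S ω *ᵥ ξ l ω ∂μ)
        (∫ ω, g ω ⬝ᵥ S ω *ᵥ g ω ∂μ) := by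
  set s : ℕ → ℝ := fun l => ∫ ω, ξ l ω ⬝ᵥ S ω *ᵥ ξ l ω ∂μ with hs
  set p : ℕ → Ω → n → ℝ := fun m ω => ∑ l ∈ Finset.range m, a l • ξ l ω with hp
  set d : ℕ → Ω → n → ℝ := fun m ω => g ω - p m ω with hd
  have hsum := hξ.summable hg.summable
  have hpm (m : ℕ) (i : n) : Measurable fun ω => p m ω i := by
    simp only [hp, Finset.sum_apply, Pi.smul_apply, smul_eq_mul]
    exact Finset.measurable_sum _ fun l _ => (hξ.measurable l i).const_mul _
  have hdm (m : ℕ) (i : n) : Measurable fun ω => d m ω i := (hg.measurable i).sub (hpm m i)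
  have hpi (m : ℕ) : Integrable (fun ω => p m ω ⬝ᵥ S ω *ᵥ p m ω) μ :=
    (hξ.integrable_form_sum a _).1
  have hpE (m : ℕ) : ∫ ω, p m ω ⬝ᵥ S ω *ᵥ p m ω ∂μ = ∑ l ∈ Finset.range m, a l ^ 2 * s l :=
    (hξ.integrable_form_sum a _).2
  have hdnn (m : ℕ) : 0 ≤ᵐ[μ] fun ω => d m ω ⬝ᵥ S ω *ᵥ d m ω :=
    hξ.posSemidef.mono fun ω hω => hω.dotProduct_mulVec_self_nonneg _
  have hdl (m : ℕ) := hξ.lintegral_form_sub_sum_le hg m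
  have hdi (m : ℕ) : Integrable (fun ω => d m ω ⬝ᵥ S ω *ᵥ d m ω) μ := by
    refine ⟨(measurable_dotProduct_mulVec hξ.measurable_form (hdm m)
      (hdm m)).aestronglyMeasurable, ?_⟩
    rw [hasFiniteIntegral_iff_ofReal (hdnn m)]
    exact (hdl m).trans_lt ENNReal.ofReal_lt_top
  have htail (m : ℕ) : 0 ≤ ∑' l, a l ^ 2 * s l - ∑ l ∈ Finset.range m, a l ^ 2 * s l :=
    sub_nonneg.2 (hsum.sum_le_tsum _
      fun l _ => mul_nonneg (sq_nonneg _) (hξ.integral_nonneg l))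
  have hdE (m : ℕ) : ∫ ω, d m ω ⬝ᵥ S ω *ᵥ d m ω ∂μ
      ≤ ∑' l, a l ^ 2 * s l - ∑ l ∈ Finset.range m, a l ^ 2 * s l := by
    rw [← ENNReal.ofReal_le_ofReal_iff (htail m),
      ofReal_integral_eq_lintegral_ofReal (hdi m) (hdnn m)]
    exact hdl m
  have hd0 : Tendsto (fun m => ∫ ω, d m ω ⬝ᵥ S ω *ᵥ d m ω ∂μ) atTop (𝓝 0) := by
    have h1 := hsum.hasSum.tendsto_sum_nat.const_sub (∑' l, a l ^ 2 * s l)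
    rw [sub_self] at h1
    exact squeeze_zero (fun m => integral_nonneg_of_ae (hdnn m)) hdE h1
  have hx (m : ℕ) := integrable_form_add_smul hξ.measurable_form hξ.posSemidef (hpm m) (hdm m)
    (hpi m) (hdi m) 1
  simp only [one_smul, hd, add_sub_cancel] at hx
  refine ⟨(hx 0).1, (hsum.hasSum_iff_tendsto_nat).2 ?_⟩
  have hcross : Tendsto (fun m => ∫ ω, p m ω ⬝ᵥ S ω *ᵥ d m ω ∂μ) atTop (𝓝 0) := by
    have h1 := hd0.const_mul (∑' l, a l ^ 2 * s l)
    rw [mul_zero] at h1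
    have h2 : Tendsto (fun m => (∫ ω, p m ω ⬝ᵥ S ω *ᵥ d m ω ∂μ) ^ 2) atTop (𝓝 0) := by
      refine squeeze_zero (fun _ => sq_nonneg _) (fun m => ?_) h1
      refine (sq_integral_dotProduct_mulVec_le hξ.measurable_form hξ.posSemidef (hpm m) (hdm m)
        (hpi m) (hdi m)).trans (mul_le_mul_of_nonneg_right ?_ (integral_nonneg_of_ae (hdnn m)))
      rw [hpE]
      exact sub_nonneg.1 (htail m)
    rw [tendsto_zero_iff_abs_tendsto_zero]
    simpa only [Real.sqrt_sq_eq_abs, Real.sqrt_zero, Function.comp_def] using h2.sqrt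
  have h3 := ((tendsto_const_nhds (x := ∫ ω, g ω ⬝ᵥ S ω *ᵥ g ω ∂μ)).sub
    (hcross.const_mul 2)).sub hd0
  rw [mul_zero, sub_zero, sub_zero] at h3
  refine h3.congr fun m => ?_
  have h4 := (hx m).2
  rw [h4, ← hpE]
  simp only [hd]
  ring

/-- Parseval's identity in the mean of a random form, polarized. -/
lemma integrable_and_hasSum (hξ : IsUncorrelated μ S ξ B) (hg : IsMeanSquareSum μ ξ a g)
    (hh : IsMeanSquareSum μ ξ b h) :
    Integrable (fun ω => g ω ⬝ᵥ S ω *ᵥ h ω) μ ∧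
      HasSum (fun l => a l * b l * ∫ ω, ξ l ω ⬝ᵥ S ω *ᵥ ξ l ω ∂μ)
        (∫ ω, g ω ⬝ᵥ S ω *ᵥ h ω ∂μ) := by
  obtain ⟨hgi, hgs⟩ := hξ.integrable_and_hasSum_self hg
  obtain ⟨hhi, hhs⟩ := hξ.integrable_and_hasSum_self hh
  refine ⟨integrable_dotProduct_mulVec hξ.measurable_form hξ.posSemidef hg.measurable
    hh.measurable hgi hhi, ?_⟩
  have h1 := (hξ.integrable_and_hasSum_self (hg.add_smul hh 1)).2
  rw [(integrable_form_add_smul hξ.measurable_form hξ.posSemidef hg.measurable hh.measurable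
    hgi hhi 1).2] at h1
  have h2 := ((h1.sub hgs).sub hhs).mul_left (2⁻¹ : ℝ)
  ring_nf at h2 ⊢
  exact h2

end IsUncorrelated

end RandomForm

/-! ### The Karhunen–Loève array of a sample -/

section Sample

open Matrix Filter Topology

variable {X : Type*} [MetricSpace X] [CompactSpace X] [MeasurableSpace X] [BorelSpace X]
  {P : Measure X} [IsProbabilityMeasure P] {K : X → X → ℝ} {lam : ℕ → ℝ} {φ : ℕ → X → ℝ}
  {Ω : Type*} [MeasurableSpace Ω] {Q : Measure Ω} [IsProbabilityMeasure Q] {f : Ω → X → ℝ} {k : ℕ}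

instance isProbabilityMeasure_sampleLaw : IsProbabilityMeasure (sampleLaw Q k) := by
  unfold sampleLaw; infer_instance

lemma measurePreserving_eval_sampleLaw (i : Fin k) :
    MeasurePreserving (fun ω : Fin k → Ω => ω i) (sampleLaw Q k) Q :=
  measurePreserving_eval (fun _ => Q) i

namespace IsCenteredGaussianField

variable (hf : IsCenteredGaussianField Q K f) (hK : IsMercerKernel K)
  (hdec : IsMercerDecomposition P K lam φ)

include hf hK hdec

/-- The Karhunen–Loève coefficients of an i.i.d. sample are independent and standard Gaussian. -/
lemma measurePreserving_klArray :
    MeasurePreserving (fun ω => klArray P lam φ (realizations f ω)) (sampleLaw Q k)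
      (gaussianProduct (Fin k × ℕ)) := by
  have hm (i : Fin k) (l : ℕ) : Measurable fun ω : Fin k → Ω => klVar P lam φ f l (ω i) :=
    (hf.measurable_klVar hdec l).comp (measurable_pi_apply i)
  have hlaw (i : Fin k) {β : Type} [MeasurableSpace β] {u : Ω → β} (hu : Measurable u) :
      (sampleLaw Q k).map (fun ω => u (ω i)) = Q.map u := by
    conv_rhs => rw [← (measurePreserving_eval_sampleLaw (Q := Q) i).map_eq,
      Measure.map_map hu (measurable_pi_apply _)]
    rfl
  have hind : iIndepFun (fun (p : Fin k × ℕ) (ω : Fin k → Ω) => klVar P lam φ f p.2 (ω p.1))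
      (sampleLaw Q k) := by
    refine iIndepFun_uncurry' (X := fun i l (ω : Fin k → Ω) => klVar P lam φ f l (ω i)) hm ?_ ?_
    · exact iIndepFun_pi (μ := fun _ : Fin k => Q) (X := fun _ ω l => klVar P lam φ f l ω)
        fun _ => (measurable_pi_iff.2 fun l => hf.measurable_klVar hdec l).aemeasurable
    · intro i
      have h1 := (iIndepFun_iff_map_fun_eq_infinitePi_map (hf.measurable_klVar hdec)).1
        (hf.iIndepFun_klVar hK hdec)
      rw [iIndepFun_iff_map_fun_eq_infinitePi_map (hm i),
        hlaw i (measurable_pi_iff.2 fun l => hf.measurable_klVar hdec l), h1]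
      simp only [hlaw i (hf.measurable_klVar hdec _)]
  refine ⟨measurable_pi_iff.2 fun p => hm p.1 p.2, ?_⟩
  have h2 := hind.map_fun_eq_infinitePi_map fun p : Fin k × ℕ => hm p.1 p.2
  refine h2.trans ?_
  rw [gaussianProduct]
  congr 1
  ext1 p
  rw [hlaw p.1 (hf.measurable_klVar hdec p.2), hf.map_klVar hK hdec]

/-- Almost every sample consists of square integrable functions that satisfy Parseval's identity,
and the truncations of its Gram matrix are eventually positive definite. -/
lemma ae_sample : ∀ᵐ ω ∂(sampleLaw Q k), (∀ i, MemLp (realizations f ω i) 2 P) ∧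
    (∀ i, HasSum (fun l => (∫ x, realizations f ω i x * φ l x ∂P) ^ 2)
      (∫ x, realizations f ω i x ^ 2 ∂P)) ∧
    ∀ n, k + 2 ≤ n → (wishart lam n (klArray P lam φ (realizations f ω))).PosDef := by
  refine Filter.Eventually.and ?_ (Filter.Eventually.and ?_ ?_)
  · refine ae_all_iff.2 fun i => ?_
    exact (measurePreserving_eval_sampleLaw i).quasiMeasurePreserving.ae
      (hf.ae_memLp_path (P := P) hK)
  · refine ae_all_iff.2 fun i => ?_
    exact (measurePreserving_eval_sampleLaw i).quasiMeasurePreserving.ae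
      (hf.ae_hasSum_sq hK hdec)
  · refine ae_all_iff.2 fun n => ?_
    by_cases hn : k + 2 ≤ n
    · have := (hf.measurePreserving_klArray hK hdec (k := k)).quasiMeasurePreserving.ae
        (ae_posDef_wishart hdec.pos hdec.antitone hn)
      filter_upwards [this] with ω hω _ using hω
    · exact ae_of_all _ fun ω h => absurd h hn

end IsCenteredGaussianField

end Sample

/-! ### The Gram matrix as a function of the Karhunen–Loève array -/

section ArrayForms

open Matrix Filter Topology

variable {k : ℕ} {lam : ℕ → ℝ}

/-- The inverse Gram matrix, as a function of the Karhunen–Loève array. -/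
noncomputable def arrayInvGram (lam : ℕ → ℝ) (η : Fin k × ℕ → ℝ) : Matrix (Fin k) (Fin k) ℝ :=
  (gramLimsup lam η)⁻¹

/-- The matrix `G⁻¹ ⟨g a, K g b⟩ G⁻¹`, as a function of the Karhunen–Loève array. -/
noncomputable def arrayCompressed (lam : ℕ → ℝ) (η : Fin k × ℕ → ℝ) : Matrix (Fin k) (Fin k) ℝ :=
  arrayInvGram lam η * gramLimsup (fun l => lam l ^ 2) η * arrayInvGram lam η

lemma measurable_arrayInvGram (a b : Fin k) :
    Measurable fun η : Fin k × ℕ → ℝ => arrayInvGram lam η a b :=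
  measurable_inv_entry (measurable_gramLimsup lam) a b

lemma measurable_arrayCompressed (a b : Fin k) :
    Measurable fun η : Fin k × ℕ → ℝ => arrayCompressed lam η a b := by
  simp only [arrayCompressed, Matrix.mul_apply]
  exact Finset.measurable_sum _ fun j _ => (Finset.measurable_sum _ fun i _ =>
    (measurable_arrayInvGram a i).mul (measurable_gramLimsup _ i j)).mul
      (measurable_arrayInvGram j b)

lemma arrayInvGram_flipColumn (l : ℕ) (η : Fin k × ℕ → ℝ) :
    arrayInvGram lam (flipColumn l η) = arrayInvGram lam η := by
  rw [arrayInvGram, gramLimsup_flipColumn, arrayInvGram]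

lemma arrayCompressed_flipColumn (l : ℕ) (η : Fin k × ℕ → ℝ) :
    arrayCompressed lam (flipColumn l η) = arrayCompressed lam η := by
  rw [arrayCompressed, gramLimsup_flipColumn, arrayInvGram_flipColumn, arrayCompressed]

end ArrayForms

section SampleMoments

open Matrix Filter Topology

variable {X : Type*} [MetricSpace X] [CompactSpace X] [MeasurableSpace X] [BorelSpace X]
  {P : Measure X} [IsProbabilityMeasure P] {K : X → X → ℝ} {lam : ℕ → ℝ} {φ : ℕ → X → ℝ}
  {Ω : Type*} [MeasurableSpace Ω] {Q : Measure Ω} [IsProbabilityMeasure Q] {f : Ω → X → ℝ} {k : ℕ}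

namespace IsCenteredGaussianField

variable (hf : IsCenteredGaussianField Q K f) (hK : IsMercerKernel K)
  (hdec : IsMercerDecomposition P K lam φ)

include hf hK hdec

lemma ae_memLp_posDef : ∀ᵐ ω ∂(sampleLaw Q k), (∀ i, MemLp (realizations f ω i) 2 P) ∧
    (gramMatrix P (realizations f ω)).PosDef := by
  filter_upwards [hf.ae_sample hK hdec] with ω ⟨h1, h2, h3⟩
  exact ⟨h1, posDef_gramMatrix hdec h1 h2 (h3 (k + 2) le_rfl)⟩

/-- The series for the matrices `G` and `⟨g a, K g b⟩` converge almost surely, so that their upper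
limits are the matrices themselves. -/
lemma ae_arrayInvGram : ∀ᵐ ω ∂(sampleLaw Q k),
    arrayInvGram lam (klArray P lam φ (realizations f ω)) = (gramMatrix P (realizations f ω))⁻¹ ∧
    arrayCompressed lam (klArray P lam φ (realizations f ω))
      = compressedMatrix P K (realizations f ω) := by
  filter_upwards [hf.ae_sample hK hdec] with ω ⟨h1, h2, _⟩
  have h3 : arrayInvGram lam (klArray P lam φ (realizations f ω))
      = (gramMatrix P (realizations f ω))⁻¹ := by
    rw [arrayInvGram, gramLimsup_klArray hdec h1 h2]
  refine ⟨h3, ?_⟩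
  rw [arrayCompressed, h3, gramLimsup_sq_klArray hdec h1, compressedMatrix]

lemma measurable_column_klArray (l : ℕ) (a : Fin k) :
    Measurable fun ω => column (klArray P lam φ (realizations f ω)) l a :=
  (measurable_column l a).comp (hf.measurePreserving_klArray hK hdec).measurable

lemma aestronglyMeasurable_projCoeff (l m : ℕ) :
    AEStronglyMeasurable (fun ω => projCoeff P lam φ (realizations f ω) l m) (sampleLaw Q k) := by
  have hA := (hf.measurePreserving_klArray hK hdec (k := k)).measurable
  have hm := measurable_dotProduct_mulVec
    (S := fun ω : Fin k → Ω => arrayInvGram lam (klArray P lam φ (realizations f ω)))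
    (fun a b => (measurable_arrayInvGram a b).comp hA)
    (hf.measurable_column_klArray hK hdec l) (hf.measurable_column_klArray hK hdec m)
  refine hm.aestronglyMeasurable.congr ?_
  filter_upwards [hf.ae_arrayInvGram hK hdec] with ω ⟨h, _⟩
  rw [h, projCoeff_eq]

lemma ae_projCoeff_mem : ∀ᵐ ω ∂(sampleLaw Q k), ∀ l,
    0 ≤ projCoeff P lam φ (realizations f ω) l l ∧
      projCoeff P lam φ (realizations f ω) l l ≤ (lam l)⁻¹ := by
  filter_upwards [hf.ae_sample hK hdec] with ω ⟨h1, h2, h3⟩ l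
  have hG := posDef_gramMatrix hdec h1 h2 (h3 (k + 2) le_rfl)
  refine ⟨projCoeff_self_nonneg hG l, ?_⟩
  have := mul_projCoeff_self_le_one hdec h1 h2 hG l
  rwa [← one_div, le_div_iff₀ (hdec.pos l), mul_comm]

/-- The Cauchy–Schwarz inequality for `G⁻¹`, together with `lam l * M l l ≤ 1`. -/
lemma ae_projCoeff_sq_le : ∀ᵐ ω ∂(sampleLaw Q k), ∀ l m,
    projCoeff P lam φ (realizations f ω) l m ^ 2 ≤ (lam l)⁻¹ * (lam m)⁻¹ := by
  filter_upwards [hf.ae_memLp_posDef hK hdec, hf.ae_projCoeff_mem hK hdec] with ω ⟨_, hG⟩ h l m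
  exact (projCoeff_sq_le hG l m).trans
    (mul_le_mul (h l).2 (h m).2 (h m).1 (inv_nonneg.2 (hdec.pos l).le))

lemma integrable_projCoeff_self (l : ℕ) :
    Integrable (fun ω => projCoeff P lam φ (realizations f ω) l l) (sampleLaw Q k) := by
  refine Integrable.of_bound (hf.aestronglyMeasurable_projCoeff hK hdec l l) (lam l)⁻¹ ?_
  filter_upwards [hf.ae_projCoeff_mem hK hdec] with ω h
  rw [Real.norm_eq_abs, abs_of_nonneg (h l).1]
  exact (h l).2

lemma integrable_projCoeff_sq (l m : ℕ) :
    Integrable (fun ω => projCoeff P lam φ (realizations f ω) l m ^ 2) (sampleLaw Q k) := by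
  refine Integrable.of_bound ((hf.aestronglyMeasurable_projCoeff hK hdec l m).pow 2)
    ((lam l)⁻¹ * (lam m)⁻¹) ?_
  filter_upwards [hf.ae_projCoeff_sq_le hK hdec] with ω h
  rw [Real.norm_eq_abs, abs_of_nonneg (sq_nonneg _)]
  exact h l m

/-- The means of `M l l` are bounded uniformly in `l`, through the inverse moments of the truncated
Gram matrices. -/
lemma integral_projCoeff_self_le (l : ℕ) :
    ∫ ω, projCoeff P lam φ (realizations f ω) l l ∂(sampleLaw Q k) ≤ k / lam (k + 1) := by
  have hB : (0 : ℝ) ≤ k / lam (k + 1) := div_nonneg k.cast_nonneg (hdec.pos _).le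
  have hnn : 0 ≤ᵐ[sampleLaw Q k] fun ω => projCoeff P lam φ (realizations f ω) l l :=
    (hf.ae_projCoeff_mem hK hdec).mono fun ω h => (h l).1
  rw [← ENNReal.ofReal_le_ofReal_iff hB,
    ofReal_integral_eq_lintegral_ofReal (hf.integrable_projCoeff_self hK hdec l) hnn]
  -- the truncation has to contain the column `l` and at least `k + 2` columns
  set n := max (l + 1) (k + 2)
  have hmp := hf.measurePreserving_klArray hK hdec (k := k)
  have hm : Measurable fun η : Fin k × ℕ → ℝ =>
      ENNReal.ofReal (column η l ⬝ᵥ (wishart lam n η)⁻¹ *ᵥ column η l) :=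
    (measurable_dotProduct_mulVec (measurable_inv_entry (measurable_wishart lam n))
      (measurable_column l) (measurable_column l)).ennreal_ofReal
  calc _ ≤ ∫⁻ ω, ENNReal.ofReal (column (klArray P lam φ (realizations f ω)) l ⬝ᵥ
        (wishart lam n (klArray P lam φ (realizations f ω)))⁻¹ *ᵥ
          column (klArray P lam φ (realizations f ω)) l) ∂(sampleLaw Q k) := by
        refine lintegral_mono_ae ?_
        filter_upwards [hf.ae_sample hK hdec] with ω ⟨h1, h2, h3⟩
        exact ENNReal.ofReal_le_ofReal
          (projCoeff_self_le_wishart hdec h1 h2 (h3 n (le_max_right _ _)) l)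
    _ = _ := hmp.lintegral_comp hm
    _ ≤ _ := lintegral_column_inv_wishart_column_le hdec.pos hdec.antitone (le_max_right _ _)
        (Nat.lt_of_succ_le (le_max_left _ _))

lemma integral_column_mulVec_column_klArray {S : (Fin k × ℕ → ℝ) → Matrix (Fin k) (Fin k) ℝ}
    (hSm : ∀ a b, Measurable fun η => S η a b) (hS : ∀ l η, S (flipColumn l η) = S η) {l m : ℕ}
    (hlm : l ≠ m) :
    ∫ ω, column (klArray P lam φ (realizations f ω)) l ⬝ᵥ
      S (klArray P lam φ (realizations f ω)) *ᵥ column (klArray P lam φ (realizations f ω)) m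
        ∂(sampleLaw Q k) = 0 := by
  have hmp := hf.measurePreserving_klArray hK hdec (k := k)
  rw [← integral_column_mulVec_column_eq_zero hSm hS hlm, ← hmp.map_eq,
    integral_map hmp.measurable.aemeasurable (measurable_dotProduct_mulVec hSm
      (measurable_column l) (measurable_column m)).aestronglyMeasurable]

lemma isUncorrelated_arrayInvGram :
    IsUncorrelated (sampleLaw Q k)
      (fun ω => arrayInvGram lam (klArray P lam φ (realizations f ω)))
      (fun l ω => column (klArray P lam φ (realizations f ω)) l) (k / lam (k + 1)) := by
  have hA := (hf.measurePreserving_klArray hK hdec (k := k)).measurable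
  have he (l : ℕ) : (fun ω => projCoeff P lam φ (realizations f ω) l l) =ᵐ[sampleLaw Q k]
      fun ω => column (klArray P lam φ (realizations f ω)) l ⬝ᵥ
        arrayInvGram lam (klArray P lam φ (realizations f ω)) *ᵥ
          column (klArray P lam φ (realizations f ω)) l := by
    filter_upwards [hf.ae_arrayInvGram hK hdec] with ω ⟨h, _⟩
    rw [h, projCoeff_eq]
  refine ⟨fun a b => (measurable_arrayInvGram a b).comp hA, ?_,
    hf.measurable_column_klArray hK hdec,
    fun l => (hf.integrable_projCoeff_self hK hdec l).congr (he l), fun l => ?_,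
    fun l m hlm => hf.integral_column_mulVec_column_klArray hK hdec measurable_arrayInvGram
      arrayInvGram_flipColumn hlm⟩
  · filter_upwards [hf.ae_arrayInvGram hK hdec, hf.ae_memLp_posDef hK hdec] with ω ⟨h, _⟩ ⟨_, hG⟩
    rw [h]
    exact hG.inv.posSemidef
  · rw [← integral_congr_ae (he l)]
    exact hf.integral_projCoeff_self_le hK hdec l

lemma ae_compressedMatrix_le : ∀ᵐ ω ∂(sampleLaw Q k), ∀ l,
    column (klArray P lam φ (realizations f ω)) l ⬝ᵥ compressedMatrix P K (realizations f ω) *ᵥ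
      column (klArray P lam φ (realizations f ω)) l
      ≤ lam 0 * projCoeff P lam φ (realizations f ω) l l := by
  filter_upwards [hf.ae_sample hK hdec] with ω ⟨h1, h2, h3⟩ l
  rw [projCoeff_eq]
  exact dotProduct_compressedMatrix_le hdec h1 h2
    (posDef_gramMatrix hdec h1 h2 (h3 (k + 2) le_rfl)) _

lemma integrable_compressedMatrix (l : ℕ) :
    Integrable (fun ω => column (klArray P lam φ (realizations f ω)) l ⬝ᵥ
      compressedMatrix P K (realizations f ω) *ᵥ
        column (klArray P lam φ (realizations f ω)) l) (sampleLaw Q k) := by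
  have hA := (hf.measurePreserving_klArray hK hdec (k := k)).measurable
  have hm := measurable_dotProduct_mulVec
    (S := fun ω : Fin k → Ω => arrayCompressed lam (klArray P lam φ (realizations f ω)))
    (fun a b => (measurable_arrayCompressed a b).comp hA)
    (hf.measurable_column_klArray hK hdec l) (hf.measurable_column_klArray hK hdec l)
  refine ((hf.integrable_projCoeff_self hK hdec l).const_mul (lam 0)).mono'
    (hm.aestronglyMeasurable.congr ?_) ?_
  · filter_upwards [hf.ae_arrayInvGram hK hdec] with ω ⟨_, h⟩
    rw [h]
  · filter_upwards [hf.ae_compressedMatrix_le hK hdec, hf.ae_memLp_posDef hK hdec]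
      with ω h ⟨hg, _⟩
    rw [Real.norm_eq_abs, abs_of_nonneg
      ((posSemidef_compressedMatrix hdec hg).dotProduct_mulVec_self_nonneg _)]
    exact h l

/-- The coefficient `∑ j, lam j ^ 2 * 𝔼 (M l j) ^ 2` is the mean of the form `G⁻¹ C G⁻¹` at
`ξ l`. -/
lemma hasSum_integral_projCoeff_sq (l : ℕ) :
    HasSum (fun j => lam j ^ 2 * ∫ ω, projCoeff P lam φ (realizations f ω) l j ^ 2
      ∂(sampleLaw Q k)) (∫ ω, column (klArray P lam φ (realizations f ω)) l ⬝ᵥ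
        compressedMatrix P K (realizations f ω) *ᵥ
          column (klArray P lam φ (realizations f ω)) l ∂(sampleLaw Q k)) := by
  set F : ℕ → (Fin k → Ω) → ℝ :=
    fun j ω => lam j ^ 2 * projCoeff P lam φ (realizations f ω) l j ^ 2 with hF
  have hFi (j : ℕ) : Integrable (F j) (sampleLaw Q k) :=
    (hf.integrable_projCoeff_sq hK hdec l j).const_mul _
  have hFE (j : ℕ) : ∫ ω, F j ω ∂(sampleLaw Q k)
      = lam j ^ 2 * ∫ ω, projCoeff P lam φ (realizations f ω) l j ^ 2 ∂(sampleLaw Q k) :=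
    integral_const_mul _ _
  have hnorm (j : ℕ) (ω : Fin k → Ω) : ‖F j ω‖ = F j ω := by
    rw [Real.norm_eq_abs, abs_of_nonneg (mul_nonneg (sq_nonneg _) (sq_nonneg _))]
  have hle (j : ℕ) : ∀ᵐ ω ∂(sampleLaw Q k), F j ω ≤ (lam l)⁻¹ * lam j := by
    filter_upwards [hf.ae_projCoeff_sq_le hK hdec] with ω h
    calc F j ω ≤ lam j ^ 2 * ((lam l)⁻¹ * (lam j)⁻¹) :=
          mul_le_mul_of_nonneg_left (h l j) (sq_nonneg _)
      _ = (lam l)⁻¹ * lam j := by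
          have := (hdec.pos j).ne'
          field_simp
  have hs : Summable fun j => ∫ ω, ‖F j ω‖ ∂(sampleLaw Q k) := by
    refine Summable.of_nonneg_of_le (fun j => integral_nonneg fun ω => norm_nonneg _) (fun j => ?_)
      ((hdec.hasSum_eigenvalues hK).summable.mul_left (lam l)⁻¹)
    simp only [hnorm]
    have := integral_mono_ae (hFi j) (integrable_const _) (hle j)
    simpa using this
  have hts : (fun ω => ∑' j, F j ω) =ᵐ[sampleLaw Q k] fun ω =>
      column (klArray P lam φ (realizations f ω)) l ⬝ᵥ
        compressedMatrix P K (realizations f ω) *ᵥ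
          column (klArray P lam φ (realizations f ω)) l := by
    filter_upwards [hf.ae_memLp_posDef hK hdec] with ω ⟨h, _⟩
    exact (hasSum_projCoeff_sq hdec h l).tsum_eq
  have h1 := hasSum_integral_of_summable_integral_norm hFi hs
  simp only [hFE] at h1
  rwa [← integral_congr_ae hts]

lemma isUncorrelated_arrayCompressed :
    IsUncorrelated (sampleLaw Q k)
      (fun ω => arrayCompressed lam (klArray P lam φ (realizations f ω)))
      (fun l ω => column (klArray P lam φ (realizations f ω)) l) (lam 0 * (k / lam (k + 1))) := by
  have hA := (hf.measurePreserving_klArray hK hdec (k := k)).measurable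
  have he (l : ℕ) : (fun ω => column (klArray P lam φ (realizations f ω)) l ⬝ᵥ
      compressedMatrix P K (realizations f ω) *ᵥ column (klArray P lam φ (realizations f ω)) l)
      =ᵐ[sampleLaw Q k]
      fun ω => column (klArray P lam φ (realizations f ω)) l ⬝ᵥ
        arrayCompressed lam (klArray P lam φ (realizations f ω)) *ᵥ
          column (klArray P lam φ (realizations f ω)) l := by
    filter_upwards [hf.ae_arrayInvGram hK hdec] with ω ⟨_, h⟩
    rw [h]
  refine ⟨fun a b => (measurable_arrayCompressed a b).comp hA, ?_,
    hf.measurable_column_klArray hK hdec,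
    fun l => (hf.integrable_compressedMatrix hK hdec l).congr (he l), fun l => ?_,
    fun l m hlm => hf.integral_column_mulVec_column_klArray hK hdec measurable_arrayCompressed
      arrayCompressed_flipColumn hlm⟩
  · filter_upwards [hf.ae_arrayInvGram hK hdec, hf.ae_memLp_posDef hK hdec] with ω ⟨_, h⟩ ⟨hg, _⟩
    rw [h]
    exact posSemidef_compressedMatrix hdec hg
  · rw [← integral_congr_ae (he l)]
    refine le_trans ?_ (mul_le_mul_of_nonneg_left (hf.integral_projCoeff_self_le hK hdec l)
      (hdec.pos 0).le)
    rw [← integral_const_mul]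
    refine integral_mono_ae (hf.integrable_compressedMatrix hK hdec l)
      ((hf.integrable_projCoeff_self hK hdec l).const_mul _) ?_
    exact (hf.ae_compressedMatrix_le hK hdec).mono fun ω h => h l

/-- An expansion of one random variable in the Karhunen–Loève coefficients gives the expansion of
the vector of its values on an i.i.d. sample. -/
lemma isMeanSquareSum_of_tendsto {Y : Ω → ℝ} {a : ℕ → ℝ} (ha : Summable fun l => a l ^ 2)
    (hYm : Measurable Y) (hY : MemLp Y 2 Q) (hlim : Tendsto (fun n => ∫ ω, (Y ω
      - ∑ l ∈ Finset.range n, a l * klVar P lam φ f l ω) ^ 2 ∂Q) atTop (𝓝 0)) :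
    IsMeanSquareSum (sampleLaw Q k) (fun l ω => column (klArray P lam φ (realizations f ω)) l) a
      fun ω i => Y (ω i) := by
  have hmem (m : ℕ) : MemLp (fun ω => Y ω - ∑ l ∈ Finset.range m, a l * klVar P lam φ f l ω) 2 Q :=
    hY.fun_sub_two ((hf.isOrthonormalSystem_klVar hK hdec).memLp_sum a m)
  refine ⟨ha, fun i => hYm.comp (measurable_pi_apply i),
    fun i m => (hmem m).comp_measurePreserving (measurePreserving_eval_sampleLaw i), fun i => ?_⟩
  refine hlim.congr fun m => ?_
  have h := integral_map (μ := sampleLaw Q k) (φ := fun ω : Fin k → Ω => ω i)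
    (f := fun ω => (Y ω - ∑ l ∈ Finset.range m, a l * klVar P lam φ f l ω) ^ 2)
    (measurable_pi_apply i).aemeasurable
    (by
      rw [(measurePreserving_eval_sampleLaw (Q := Q) i).map_eq]
      exact (hmem m).aestronglyMeasurable.pow 2)
  rw [(measurePreserving_eval_sampleLaw (Q := Q) i).map_eq] at h
  exact h

lemma isMeanSquareSum_eval (x : X) :
    IsMeanSquareSum (sampleLaw Q k) (fun l ω => column (klArray P lam φ (realizations f ω)) l)
      (fun l => √(lam l) * φ l x) fun ω i => realizations f ω i x := by
  refine hf.isMeanSquareSum_of_tendsto hK hdec ?_ (hf.measurable_eval x) (hf.memLp_eval x)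
    (hf.tendsto_eval_sub_sum hK hdec x)
  simp only [mul_pow, Real.sq_sqrt (hdec.pos _).le]
  exact (hdec.hasSum_diag x).summable

lemma isMeanSquareSum_integral_kernel (x : X) :
    IsMeanSquareSum (sampleLaw Q k) (fun l ω => column (klArray P lam φ (realizations f ω)) l)
      (fun l => √(lam l) * (lam l * φ l x)) fun ω i => ∫ z, realizations f ω i z * K x z ∂P := by
  have hKx := hdec.memLp_kernel x
  refine hf.isMeanSquareSum_of_tendsto hK hdec ?_ (hf.measurable_pairing hKx.aestronglyMeasurable)
    (hf.memLp_pairing hK hKx) ?_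
  · simp only [mul_pow, Real.sq_sqrt (hdec.pos _).le]
    have := hdec.summable_mul_sq (w := fun l => lam l * lam l ^ 2) (B := lam 0 ^ 2)
      (fun l => mul_nonneg (hdec.pos l).le (sq_nonneg _)) (fun l => ?_) x
    · simpa only [mul_assoc] using this
    · rw [mul_comm]
      exact mul_le_mul_of_nonneg_right (pow_le_pow_left₀ (hdec.pos l).le
        (hdec.antitone (Nat.zero_le l)) 2) (hdec.pos l).le
  · have := hf.tendsto_pairing_sub_sum hK hdec hKx
    simpa only [hdec.integral_kernel_mul_eigenfunction] using this

end IsCenteredGaussianField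

end SampleMoments

/-! ### Kernels that are diagonal in the eigenbasis -/

section DiagonalKernel

open Filter Topology

/-- The Cauchy–Schwarz inequality for weighted sums. -/
lemma HasSum.sq_le_mul {w a b : ℕ → ℝ} {A B C : ℝ} (hw : ∀ l, 0 ≤ w l)
    (hA : HasSum (fun l => w l * a l ^ 2) A) (hB : HasSum (fun l => w l * b l ^ 2) B)
    (hC : HasSum (fun l => w l * a l * b l) C) : C ^ 2 ≤ A * B := by
  have h (t : ℝ) : 0 ≤ B * (t * t) + (2 * C) * t + A := by
    refine (((hB.mul_right (t * t)).add ((hC.mul_left 2).mul_right t)).add hA).nonneg fun l => ?_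
    have := mul_nonneg (hw l) (sq_nonneg (a l + t * b l))
    linarith
  have := discrim_le_zero h
  rw [discrim] at this
  linarith

variable {X : Type*} [MeasurableSpace X] {P : Measure X} {K K' : X → X → ℝ}
  {lam w : ℕ → ℝ} {φ : ℕ → X → ℝ} {B : ℝ}

/-- The increments of the feature map of a kernel `∑ l, w l * φ l x * φ l y` with `w ≤ B * lam` are
controlled by those of the feature map of `K`. -/
lemma IsMercerDecomposition.abs_kernel_sub_le (hdec : IsMercerDecomposition P K lam φ)
    (hw0 : ∀ l, 0 ≤ w l) (hw : ∀ l, w l ≤ B * lam l)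
    (hK' : ∀ x y, HasSum (fun l => w l * φ l x * φ l y) (K' x y)) (x x' y : X) :
    |K' x y - K' x' y| ≤ √(B * (K x x - 2 * K x x' + K x' x') * (B * K y y)) := by
  have hinc : HasSum (fun l => lam l * (φ l x - φ l x') ^ 2) (K x x - 2 * K x x' + K x' x') := by
    have he : (fun l => lam l * (φ l x - φ l x') ^ 2) = fun l => lam l * φ l x * φ l x
        - 2 * (lam l * φ l x * φ l x') + lam l * φ l x' * φ l x' := funext fun l => by ring
    rw [he]
    exact ((hdec.hasSum x x).sub ((hdec.hasSum x x').mul_left 2)).add (hdec.hasSum x' x')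
  have hinc' : Summable fun l => w l * (φ l x - φ l x') ^ 2 := by
    refine Summable.of_nonneg_of_le (fun l => mul_nonneg (hw0 l) (sq_nonneg _)) (fun l => ?_)
      (hinc.summable.mul_left B)
    rw [← mul_assoc]
    exact mul_le_mul_of_nonneg_right (hw l) (sq_nonneg _)
  have hy := hdec.summable_mul_sq hw0 hw y
  have h1 : ∑' l, w l * (φ l x - φ l x') ^ 2 ≤ B * (K x x - 2 * K x x' + K x' x') := by
    refine hasSum_le (fun l => ?_) hinc'.hasSum (hinc.mul_left B)
    rw [← mul_assoc]
    exact mul_le_mul_of_nonneg_right (hw l) (sq_nonneg _)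
  have h2 : ∑' l, w l * φ l y ^ 2 ≤ B * K y y := by
    refine hasSum_le (fun l => ?_) hy.hasSum ((hdec.hasSum_diag y).mul_left B)
    rw [← mul_assoc]
    exact mul_le_mul_of_nonneg_right (hw l) (sq_nonneg _)
  have h3 : HasSum (fun l => w l * (φ l x - φ l x') * φ l y) (K' x y - K' x' y) := by
    simp only [mul_sub, sub_mul]
    exact (hK' x y).sub (hK' x' y)
  refine Real.abs_le_sqrt ((HasSum.sq_le_mul hw0 hinc'.hasSum hy.hasSum h3).trans ?_)
  have h4 : 0 ≤ ∑' l, w l * (φ l x - φ l x') ^ 2 :=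
    tsum_nonneg fun l => mul_nonneg (hw0 l) (sq_nonneg _)
  have h5 : 0 ≤ ∑' l, w l * φ l y ^ 2 := tsum_nonneg fun l => mul_nonneg (hw0 l) (sq_nonneg _)
  exact mul_le_mul h1 h2 h5 (h4.trans h1)

/-- A kernel that is diagonal in the eigenbasis of a Mercer kernel, with eigenvalues of at most
the same order, is a Mercer kernel. -/
lemma IsMercerDecomposition.isMercerKernel [TopologicalSpace X]
    (hdec : IsMercerDecomposition P K lam φ) (hK : IsMercerKernel K)
    (hw0 : ∀ l, 0 ≤ w l) (hw : ∀ l, w l ≤ B * lam l)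
    (hK' : ∀ x y, HasSum (fun l => w l * φ l x * φ l y) (K' x y)) : IsMercerKernel K' := by
  have hsymm (x y : X) : K' x y = K' y x := by
    refine (hK' x y).unique ?_
    convert hK' y x using 2
    ring
  refine ⟨continuous_iff_continuousAt.2 fun p => ?_, hsymm, fun n x α => ?_⟩
  · obtain ⟨x0, y0⟩ := p
    have hKc := hK.1
    have hc1 : Continuous fun p : X × X =>
        √(B * (K p.1 p.1 - 2 * K p.1 x0 + K x0 x0) * (B * K p.2 p.2)) := by
      have e1 : Continuous fun p : X × X => K p.1 p.1 :=
        hKc.comp (continuous_fst.prodMk continuous_fst)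
      have e2 : Continuous fun p : X × X => K p.1 x0 :=
        hKc.comp (continuous_fst.prodMk continuous_const)
      have e3 : Continuous fun p : X × X => K p.2 p.2 :=
        hKc.comp (continuous_snd.prodMk continuous_snd)
      fun_prop
    have hc2 : Continuous fun p : X × X =>
        √(B * (K p.2 p.2 - 2 * K p.2 y0 + K y0 y0) * (B * K x0 x0)) := by
      have e2 : Continuous fun p : X × X => K p.2 y0 :=
        hKc.comp (continuous_snd.prodMk continuous_const)
      have e3 : Continuous fun p : X × X => K p.2 p.2 :=
        hKc.comp (continuous_snd.prodMk continuous_snd)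
      fun_prop
    have hlim := (hc1.add hc2).tendsto (x0, y0)
    simp only [Pi.add_apply] at hlim
    rw [show √(B * (K x0 x0 - 2 * K x0 x0 + K x0 x0) * (B * K y0 y0))
      + √(B * (K y0 y0 - 2 * K y0 y0 + K y0 y0) * (B * K x0 x0)) = 0 by
        rw [two_mul, two_mul]; simp] at hlim
    refine tendsto_iff_dist_tendsto_zero.2 (squeeze_zero (fun _ => dist_nonneg) (fun p => ?_) hlim)
    rw [Real.dist_eq]
    have h1 := hdec.abs_kernel_sub_le hw0 hw hK' p.1 x0 p.2
    have h2 := hdec.abs_kernel_sub_le hw0 hw hK' p.2 y0 x0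
    rw [hsymm p.2 x0, hsymm y0 x0] at h2
    exact (abs_sub_le _ (K' x0 p.2) _).trans (add_le_add h1 h2)
  · have h : HasSum (fun l => ∑ i, ∑ j, α i * α j * (w l * φ l (x i) * φ l (x j)))
        (∑ i, ∑ j, α i * α j * K' (x i) (x j)) :=
      hasSum_sum fun i _ => hasSum_sum fun j _ => (hK' (x i) (x j)).mul_left _
    refine h.nonneg fun l => ?_
    have : ∑ i, ∑ j, α i * α j * (w l * φ l (x i) * φ l (x j))
        = w l * (∑ i, α i * φ l (x i)) ^ 2 := by
      rw [pow_two, Finset.sum_mul_sum, Finset.mul_sum]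
      refine Finset.sum_congr rfl fun i _ => ?_
      rw [Finset.mul_sum]
      refine Finset.sum_congr rfl fun j _ => by ring
    rw [this]
    exact mul_nonneg (hw0 l) (sq_nonneg _)

end DiagonalKernel

/-! ### The expected residual kernel -/

section ExpectedKernel

open Matrix Filter Topology

variable {X : Type*} [MetricSpace X] [CompactSpace X] [MeasurableSpace X] [BorelSpace X]
  {P : Measure X} [IsProbabilityMeasure P] {K : X → X → ℝ} {lam : ℕ → ℝ} {φ : ℕ → X → ℝ}
  {Ω : Type*} [MeasurableSpace Ω] {Q : Measure Ω} [IsProbabilityMeasure Q] {f : Ω → X → ℝ} {k : ℕ}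

namespace IsCenteredGaussianField

variable (hf : IsCenteredGaussianField Q K f) (hK : IsMercerKernel K)
  (hdec : IsMercerDecomposition P K lam φ)

include hf hK hdec

/-- The cross term `Π K` of the residual kernel, in mean. -/
lemma integrable_and_hasSum_cross (x y : X) :
    Integrable (fun ω => (fun a => realizations f ω a y) ⬝ᵥ (gramMatrix P (realizations f ω))⁻¹ *ᵥ
      fun a => ∫ z, realizations f ω a z * K x z ∂P) (sampleLaw Q k) ∧
    HasSum (fun l => lam l ^ 2 * (∫ ω, projCoeff P lam φ (realizations f ω) l l ∂(sampleLaw Q k))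
      * φ l x * φ l y)
      (∫ ω, (fun a => realizations f ω a y) ⬝ᵥ (gramMatrix P (realizations f ω))⁻¹ *ᵥ
        (fun a => ∫ z, realizations f ω a z * K x z ∂P) ∂(sampleLaw Q k)) := by
  have h := (hf.isUncorrelated_arrayInvGram hK hdec (k := k)).integrable_and_hasSum
    (hf.isMeanSquareSum_eval hK hdec y) (hf.isMeanSquareSum_integral_kernel hK hdec x)
  have he : (fun ω => (fun a => realizations f ω a y) ⬝ᵥ
      arrayInvGram lam (klArray P lam φ (realizations f ω)) *ᵥ
        fun a => ∫ z, realizations f ω a z * K x z ∂P) =ᵐ[sampleLaw Q k]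
      fun ω => (fun a => realizations f ω a y) ⬝ᵥ (gramMatrix P (realizations f ω))⁻¹ *ᵥ
        fun a => ∫ z, realizations f ω a z * K x z ∂P := by
    filter_upwards [hf.ae_arrayInvGram hK hdec] with ω ⟨h, _⟩
    rw [h]
  have hs (l : ℕ) : ∫ ω, column (klArray P lam φ (realizations f ω)) l ⬝ᵥ
      arrayInvGram lam (klArray P lam φ (realizations f ω)) *ᵥ
        column (klArray P lam φ (realizations f ω)) l ∂(sampleLaw Q k)
      = ∫ ω, projCoeff P lam φ (realizations f ω) l l ∂(sampleLaw Q k) := by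
    refine integral_congr_ae ?_
    filter_upwards [hf.ae_arrayInvGram hK hdec] with ω ⟨h, _⟩
    rw [h, projCoeff_eq]
  refine ⟨h.1.congr he, ?_⟩
  rw [← integral_congr_ae he]
  convert h.2 using 2 with l
  rw [hs]
  have := Real.mul_self_sqrt (hdec.pos l).le
  linear_combination (-(lam l * φ l x * φ l y *
    ∫ ω, projCoeff P lam φ (realizations f ω) l l ∂(sampleLaw Q k))) * this

/-- The term `Π K Π` of the residual kernel, in mean. -/
lemma integrable_and_hasSum_compressed (x y : X) :
    Integrable (fun ω => (fun a => realizations f ω a x) ⬝ᵥ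
      compressedMatrix P K (realizations f ω) *ᵥ fun a => realizations f ω a y) (sampleLaw Q k) ∧
    HasSum (fun l => lam l * (∑' j, lam j ^ 2 *
        ∫ ω, projCoeff P lam φ (realizations f ω) l j ^ 2 ∂(sampleLaw Q k)) * φ l x * φ l y)
      (∫ ω, (fun a => realizations f ω a x) ⬝ᵥ compressedMatrix P K (realizations f ω) *ᵥ
        (fun a => realizations f ω a y) ∂(sampleLaw Q k)) := by
  have h := (hf.isUncorrelated_arrayCompressed hK hdec (k := k)).integrable_and_hasSum
    (hf.isMeanSquareSum_eval hK hdec x) (hf.isMeanSquareSum_eval hK hdec y)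
  have he : (fun ω => (fun a => realizations f ω a x) ⬝ᵥ
      arrayCompressed lam (klArray P lam φ (realizations f ω)) *ᵥ
        fun a => realizations f ω a y) =ᵐ[sampleLaw Q k]
      fun ω => (fun a => realizations f ω a x) ⬝ᵥ compressedMatrix P K (realizations f ω) *ᵥ
        fun a => realizations f ω a y := by
    filter_upwards [hf.ae_arrayInvGram hK hdec] with ω ⟨_, h⟩
    rw [h]
  have hs (l : ℕ) : ∫ ω, column (klArray P lam φ (realizations f ω)) l ⬝ᵥ
      arrayCompressed lam (klArray P lam φ (realizations f ω)) *ᵥ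
        column (klArray P lam φ (realizations f ω)) l ∂(sampleLaw Q k)
      = ∑' j, lam j ^ 2 *
        ∫ ω, projCoeff P lam φ (realizations f ω) l j ^ 2 ∂(sampleLaw Q k) := by
    rw [(hf.hasSum_integral_projCoeff_sq hK hdec l).tsum_eq]
    refine integral_congr_ae ?_
    filter_upwards [hf.ae_arrayInvGram hK hdec] with ω ⟨_, h⟩
    rw [h]
  refine ⟨h.1.congr he, ?_⟩
  rw [← integral_congr_ae he]
  convert h.2 using 2 with l
  rw [hs]
  have := Real.mul_self_sqrt (hdec.pos l).le
  linear_combination (-(φ l x * φ l y * ∑' j, lam j ^ 2 *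
        ∫ ω, projCoeff P lam φ (realizations f ω) l j ^ 2 ∂(sampleLaw Q k))) * this

lemma integrable_and_hasSum_residualKernel (x y : X) :
    Integrable (fun ω => residualKernel P K (realizations f ω) x y) (sampleLaw Q k) ∧
    HasSum (fun l => pushedEigenvalue Q P f k lam φ l * φ l x * φ l y)
      (expectedResidualKernel Q P f k K x y) := by
  obtain ⟨i1, s1⟩ := hf.integrable_and_hasSum_cross hK hdec (k := k) x y
  obtain ⟨i2, s2⟩ := hf.integrable_and_hasSum_cross hK hdec (k := k) y x
  obtain ⟨i3, s3⟩ := hf.integrable_and_hasSum_compressed hK hdec (k := k) x y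
  have he : (fun ω => residualKernel P K (realizations f ω) x y) =ᵐ[sampleLaw Q k] _ :=
    (hf.ae_memLp_posDef hK hdec).mono fun ω hω => residualKernel_eq hK.2.1 hdec hω.1 x y
  have i0 : Integrable (fun _ : Fin k → Ω => K x y) (sampleLaw Q k) := integrable_const _
  refine ⟨(((i0.sub i1).sub i2).add i3).congr he.symm, ?_⟩
  have hint : expectedResidualKernel Q P f k K x y = _ :=
    (integral_congr_ae he).trans ((integral_add ((i0.sub i1).sub i2) i3).trans
      (congrArg (· + _) ((integral_sub (i0.sub i1) i2).trans
        (congrArg (· - _) (integral_sub i0 i1)))))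
  have hl : (fun l => pushedEigenvalue Q P f k lam φ l * φ l x * φ l y) = fun l =>
      lam l * φ l x * φ l y
        - lam l ^ 2 * (∫ ω, projCoeff P lam φ (realizations f ω) l l ∂(sampleLaw Q k))
          * φ l x * φ l y
        - lam l ^ 2 * (∫ ω, projCoeff P lam φ (realizations f ω) l l ∂(sampleLaw Q k))
          * φ l y * φ l x
        + lam l * (∑' j, lam j ^ 2 *
          ∫ ω, projCoeff P lam φ (realizations f ω) l j ^ 2 ∂(sampleLaw Q k))
            * φ l x * φ l y := by
    ext l
    rw [pushedEigenvalue]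
    ring
  rw [hint, integral_const, probReal_univ, one_smul, hl]
  exact (((hdec.hasSum x y).sub s1).sub s2).add s3

lemma pushedEigenvalue_nonneg (i : ℕ) : 0 ≤ pushedEigenvalue Q P f k lam φ i := by
  refine mul_nonneg (hdec.pos i).le ?_
  have hs := hf.hasSum_integral_projCoeff_sq hK hdec (k := k) i
  have h1 := hs.summable.le_tsum i fun j _ =>
    mul_nonneg (sq_nonneg (lam j)) (integral_nonneg fun ω => sq_nonneg _)
  have i1 := (hf.integrable_projCoeff_self hK hdec (k := k) i).const_mul (2 * lam i)
  have i2 := (hf.integrable_projCoeff_sq hK hdec (k := k) i i).const_mul (lam i ^ 2)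
  have i0 : Integrable (fun _ : Fin k → Ω => (1 : ℝ)) (sampleLaw Q k) := integrable_const _
  -- the diagonal term alone completes the square
  have h2 : 0 ≤ ∫ ω, (1 - 2 * lam i * projCoeff P lam φ (realizations f ω) i i
      + lam i ^ 2 * projCoeff P lam φ (realizations f ω) i i ^ 2) ∂(sampleLaw Q k) := by
    refine integral_nonneg fun ω => ?_
    have := sq_nonneg (1 - lam i * projCoeff P lam φ (realizations f ω) i i)
    simp only [Pi.zero_apply]
    linarith
  have i01 : Integrable (fun ω => 1 - 2 * lam i * projCoeff P lam φ (realizations f ω) i i)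
      (sampleLaw Q k) := i0.sub i1
  rw [integral_add i01 i2, integral_sub i0 i1, integral_const_mul, integral_const_mul,
    integral_const, probReal_univ, one_smul] at h2
  linarith

lemma exists_pushedEigenvalue_le :
    ∃ B, ∀ i, pushedEigenvalue Q P f k lam φ i ≤ B * lam i := by
  refine ⟨1 + lam 0 * (k / lam (k + 1)), fun i => ?_⟩
  rw [pushedEigenvalue, mul_comm]
  refine mul_le_mul_of_nonneg_right ?_ (hdec.pos i).le
  have h0 : 0 ≤ ∫ ω, projCoeff P lam φ (realizations f ω) i i ∂(sampleLaw Q k) :=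
    integral_nonneg_of_ae ((hf.ae_projCoeff_mem hK hdec).mono fun ω h => (h i).1)
  have h1 := mul_nonneg (mul_nonneg zero_le_two (hdec.pos i).le) h0
  have h2 : ∑' j, lam j ^ 2 * ∫ ω, projCoeff P lam φ (realizations f ω) i j ^ 2 ∂(sampleLaw Q k)
      ≤ lam 0 * (k / lam (k + 1)) := by
    rw [(hf.hasSum_integral_projCoeff_sq hK hdec i).tsum_eq]
    refine le_trans ?_ (mul_le_mul_of_nonneg_left (hf.integral_projCoeff_self_le hK hdec i)
      (hdec.pos 0).le)
    rw [← integral_const_mul]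
    exact integral_mono_ae (hf.integrable_compressedMatrix hK hdec i)
      ((hf.integrable_projCoeff_self hK hdec i).const_mul _)
      ((hf.ae_compressedMatrix_le hK hdec).mono fun ω h => h i)
  linarith

end IsCenteredGaussianField

end ExpectedKernel

theorem mainTheorem5 {d : ℕ} (X : Set (EuclideanSpace ℝ (Fin d))) (hX : IsCompact X)
    (P : Measure X) [IsProbabilityMeasure P]
    (K : X → X → ℝ) (hK : IsMercerKernel K)
    (lam : ℕ → ℝ) (φ : ℕ → X → ℝ) (hdec : IsMercerDecomposition P K lam φ)
    {Ω : Type*} [MeasurableSpace Ω] (Q : Measure Ω) [IsProbabilityMeasure Q]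
    (f : Ω → X → ℝ) (hf : IsCenteredGaussianField Q K f) (k : ℕ) :
    -- the realizations are a.s. in `L₂(X,P)` with invertible Gram matrix
    (∀ᵐ ω ∂(sampleLaw Q k), (∀ i, MemLp (realizations f ω i) 2 P) ∧
      IsUnit (gramMatrix P (realizations f ω)).det) ∧
    -- all expectations and sums in the definition of the eigenvalues converge
    (∀ i, Integrable (fun ω => projCoeff P lam φ (realizations f ω) i i) (sampleLaw Q k)) ∧
    (∀ i j, Integrable (fun ω => projCoeff P lam φ (realizations f ω) i j ^ 2)
      (sampleLaw Q k)) ∧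
    (∀ i, Summable fun j =>
      lam j ^ 2 * ∫ ω, projCoeff P lam φ (realizations f ω) i j ^ 2 ∂(sampleLaw Q k)) ∧
    (∀ x y, Integrable (fun ω => residualKernel P K (realizations f ω) x y)
      (sampleLaw Q k)) ∧
    -- the expected residual kernel is a Mercer kernel, diagonal in the eigenbasis of `K`
    IsMercerKernel (expectedResidualKernel Q P f k K) ∧
    (∀ x y, HasSum (fun i => pushedEigenvalue Q P f k lam φ i * φ i x * φ i y)
      (expectedResidualKernel Q P f k K x y)) ∧
    (∀ i, 0 ≤ pushedEigenvalue Q P f k lam φ i) ∧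
    (∀ i x, ∫ y, expectedResidualKernel Q P f k K x y * φ i y ∂P
      = pushedEigenvalue Q P f k lam φ i * φ i x) := by
  have : CompactSpace X := isCompact_iff_compactSpace.1 hX
  obtain ⟨B, hB⟩ := hf.exists_pushedEigenvalue_le hK hdec (k := k)
  have hnn := hf.pushedEigenvalue_nonneg hK hdec (k := k)
  have hsum (x y : X) := (hf.integrable_and_hasSum_residualKernel hK hdec (k := k) x y).2
  refine ⟨?_, hf.integrable_projCoeff_self hK hdec, hf.integrable_projCoeff_sq hK hdec,
    fun i => (hf.hasSum_integral_projCoeff_sq hK hdec i).summable,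
    fun x y => (hf.integrable_and_hasSum_residualKernel hK hdec x y).1,
    hdec.isMercerKernel hK hnn hB hsum, hsum, hnn, hdec.integral_kernel_mul hnn hB hsum⟩
  filter_upwards [hf.ae_memLp_posDef hK hdec] with ω ⟨h1, h2⟩
  exact ⟨h1, h2.det_isUnit⟩
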